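/- Let $d=2$, $\omega>0$ and $\lambda>0$, and let $H_0^\omega=-\frac12\Delta_{\vec x}-\frac12\Delta_{\vec y}+\frac{\omega^2y^2}{2}-\omega$ on $L^2(\mathbb R^4)$, $\vec x,\vec y\in\mathbb R^2$. Then there are bounded operators $G^\lambda_\omega=(H_0^\omega+\lambda)^{-1}$ on $L^2(\mathbb R^4)$ and $\mathcal G^\lambda_\omega:L^2(\mathbb R^2)\to L^2(\mathbb R^4)$ such that $G^\lambda_\omega$ is the integral operator with kernel $$G^\lambda_\omega(\vec x,\vec y;\vec x',\vec y')=\frac{\omega}{2\pi^2}\int_0^1 d\nu\,\frac{\nu^{\lambda/\omega-1}}{(1-\nu^2)\ln\frac1\nu}\exp\Big\{-\frac\omega2\,\frac{1-\nu}{1+\nu}(y^2+y'^2)-\frac{\omega}{2\ln\frac1\nu}(\vec x-\vec x')^2-\frac{\omega\nu}{1-\nu^2}(\vec y-\vec y')^2\Big\}$$ and $\mathcal G^\lambda_\omega$ is given by $$(\mathcal G^\lambda_\omega f)(\vec x,\vec y)=\int_{\mathbb R^2}d\vec x'\,G^\lambda_\omega(\vec x,\vec y;\vec x',\vec x')\,f(\vec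 x').$$ For every integer $k\ge 0$ with $k<\lambda$ and every real $p>\frac{2}{k+1}$, the operator $$T^k_\omega=(\mathcal G^\lambda_\omega)^*\,(G^\lambda_\omega)^k\,\mathcal G^\lambda_\omega:\ L^2(\mathbb R^2)\to L^2(\mathbb R^2)$$ belongs to the Schatten class $\mathscr B_p$, i.e. it is compact and its singular values $\mu_n$, repeated according to multiplicity, satisfy $\sum_n\mu_n^p<\infty$. -/

import Mathlib

open MeasureTheory

noncomputable section

namespace ZeroRange

/-- The physical space `ℝ²`, with the Euclidean norm. -/
abbrev Plane : Type := EuclideanSpace ℝ (Fin 2)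

/-- The two-particle configuration space `ℝ² × ℝ² = ℝ⁴`; its `volume` is Lebesgue measure. -/
abbrev Config : Type := Plane × Plane

/-- The complex Hilbert space `L²(ℝ²)`. -/
abbrev L2Plane : Type := Lp ℂ 2 (volume : Measure Plane)

/-- The complex Hilbert space `L²(ℝ⁴)`. -/
abbrev L2Config : Type := Lp ℂ 2 (volume : Measure Config)

/-- The free Hamiltonian `H₀ = -½ Δ_x - ½ Δ_y + ω² |y|² / 2 - ω d / 2` for `d = 2`, as a
differential expression (used below on smooth compactly supported functions only). -/
def freeHamiltonian (ω : ℝ) (φ : Config → ℂ) (z : Config) : ℂ :=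
  -(1 / 2 : ℂ) * Laplacian.laplacian (fun x : Plane => φ (x, z.2)) z.1
    - (1 / 2 : ℂ) * Laplacian.laplacian (fun y : Plane => φ (z.1, y)) z.2
    + ((ω ^ 2 * ‖z.2‖ ^ 2 / 2 - ω : ℝ) : ℂ) * φ z

/-- `G = (H₀ + λ)⁻¹`: for every `f ∈ L²(ℝ⁴)`, the function `G f ∈ L²(ℝ⁴)` solves
`(H₀ + λ) (G f) = f` in the sense of distributions. For `λ > 0` the `L²` solution is unique, as
`H₀` is nonnegative and essentially self-adjoint on the smooth compactly supported functions. -/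
def IsFreeResolvent (ω lam : ℝ) (G : L2Config →L[ℂ] L2Config) : Prop :=
  ∀ (f : L2Config) (φ : Config → ℂ), ContDiff ℝ ((⊤ : ℕ∞) : WithTop ℕ∞) φ → HasCompactSupport φ →
    ∫ z, G f z * (freeHamiltonian ω φ z + (lam : ℂ) * φ z) = ∫ z, f z * φ z

/-- The Green function `G^λ_ω(x, y; x', y')` of `H₀ + λ` for `d = 2`, with `z = (x, y)` and
`w = (x', y')`. The integral converges for `z ≠ w`. -/
def greenKernel (ω lam : ℝ) (z w : Config) : ℝ :=
  ω / (2 * Real.pi ^ 2) * ∫ ν in Set.Ioo (0 : ℝ) 1,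
    ν ^ (lam / ω - 1) / ((1 - ν ^ 2) * Real.log (1 / ν)) *
      Real.exp (-(ω / 2) * ((1 - ν) / (1 + ν)) * (‖z.2‖ ^ 2 + ‖w.2‖ ^ 2)
        - ω / (2 * Real.log (1 / ν)) * ‖z.1 - w.1‖ ^ 2
        - ω * ν / (1 - ν ^ 2) * ‖z.2 - w.2‖ ^ 2)

/-- The kernel `G^λ_ω(x, y; x', x')` of the potential of a charge on the plane `x = y`. -/
def potentialKernel (ω lam : ℝ) (z : Config) (x' : Plane) : ℝ :=
  greenKernel ω lam z (x', x')

/-- `A` is the integral operator with kernel `K`: for every `f ∈ L²`, for almost every `z` the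
integral `∫ K(z, w) f(w) dw` converges absolutely and equals `(A f)(z)`. -/
def IsIntegralOperator {X Y : Type*} [MeasureSpace X] [MeasureSpace Y] (K : Y → X → ℝ)
    (A : Lp ℂ 2 (volume : Measure X) →L[ℂ] Lp ℂ 2 (volume : Measure Y)) : Prop :=
  ∀ f : Lp ℂ 2 (volume : Measure X), ∀ᵐ z : Y,
    Integrable (fun w : X => (K z w : ℂ) * f w) ∧ A f z = ∫ w : X, (K z w : ℂ) * f w

/-- The multiplicity of `σ > 0` as a singular value of `A`: the dimension of the eigenspace of
`A* A` for the eigenvalue `σ²` (finite for compact `A`; zero if `σ` is not a singular value). -/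
def singularMultiplicity {H K : Type*}
    [NormedAddCommGroup H] [InnerProductSpace ℂ H] [CompleteSpace H]
    [NormedAddCommGroup K] [InnerProductSpace ℂ K] [CompleteSpace K]
    (A : H →L[ℂ] K) (σ : ℝ) : ℕ :=
  Module.finrank ℂ (Module.End.eigenspace
    ((ContinuousLinearMap.adjoint A ∘L A : H →L[ℂ] H) : H →ₗ[ℂ] H) ((σ ^ 2 : ℝ) : ℂ))

/-- The Schatten class `B_p(H, K)`, `0 < p < ∞`: compact operators whose singular values, repeated
according to multiplicity, have a finite sum of `p`-th powers. -/
def IsSchatten {H K : Type*}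
    [NormedAddCommGroup H] [InnerProductSpace ℂ H] [CompleteSpace H]
    [NormedAddCommGroup K] [InnerProductSpace ℂ K] [CompleteSpace K]
    (p : ℝ) (A : H →L[ℂ] K) : Prop :=
  IsCompactOperator A ∧
    ∑' σ : {σ : ℝ // 0 < σ},
      (singularMultiplicity A σ : ENNReal) * ENNReal.ofReal ((σ : ℝ) ^ p) < ⊤

end ZeroRange

end

/-! Everything is expressed through the heat semigroup `exp(-t H₀)`, whose kernel is explicit: a
plane heat kernel in `x` times a Mehler kernel in `y`, times `exp (ω t)`. With `ν = exp(-ω t)` the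
Green function becomes `∫₀^∞ exp(-λ t) exp(-t H₀) dt`, and by the semigroup law `G ^ k ∘ Pot` is the
same integral with weight `t^k exp(-λ t) / k!` and sources on the plane `x = y`
(`isKernelOp_pow_comp`).

The Schatten bound comes from Gelfand numbers. Cut the time integral at `δ`. By a weighted Schur
test the part `t ≤ δ` has norm of order `δ^(k+1/2)` (`l2Bounded_diagKernel`). The part `t > δ`
factors through the trace `R` of `exp(-δ H₀)` on `x = y`. The kernel of `R* R` is `heatKernel` at
time `2δ` on that plane, again a Gaussian and hence `c` times a Mehler kernel of some time `s`
(`exists_heatKernel_diag_eq_mehler`), with `c` at most of order `1/δ` and `s` at least of order `δ`.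
Writing the Mehler operator of time `s` as a `2m`-th power of a Hilbert–Schmidt operator and taking
`m` large, about `δ^(-2-τ)` linear conditions bring `R` down to `δ^(k+1/2)` (`gelfandLE_traceOp`).

So `Pot` and `G ^ k ∘ Pot` are of size `δ^(1/2)` and `δ^(k+1/2)` after about `δ^(-2-τ)` conditions,
and `Pot* G ^ k Pot` is of size `δ^(k+1)`. At most about `ε^(-(2+τ)/(k+1))` singular values exceed
`ε`, which suffices for every `p > 2/(k+1)`, since `τ > 0` is arbitrary.

That `G` solves the resolvent equation follows from the heat equation, Green's identity, the limit
of the semigroup as `t → 0`, and the fundamental theorem of calculus in `t`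
(`integral_timeKernel_mul_freeHamiltonian`). -/

namespace ZeroRange

/-! ### Gelfand numbers, compactness and singular values -/

section Gelfand

variable {H K L : Type*}
  [NormedAddCommGroup H] [InnerProductSpace ℂ H]
  [NormedAddCommGroup K] [InnerProductSpace ℂ K]
  [NormedAddCommGroup L] [InnerProductSpace ℂ L]

/-- The `(n+1)`-st Gelfand number of `A` is at most `ε`: `A` is bounded by `ε` on a closed subspace
cut out by `n` continuous linear equations. -/
def GelfandLE (A : H →L[ℂ] K) (n : ℕ) (ε : ℝ) : Prop :=
  ∃ l : H →L[ℂ] (Fin n → ℂ), ∀ x, l x = 0 → ‖A x‖ ≤ ε * ‖x‖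

/-- Serves whenever two systems of linear conditions have to hold at once: their numbers add. -/
theorem gelfandLE_of_injective_pair {n m : ℕ} (A : H →L[ℂ] K) (ε : ℝ)
    (l₁ : H →L[ℂ] (Fin n → ℂ)) (l₂ : H →L[ℂ] (Fin m → ℂ))
    (h : ∀ x, l₁ x = 0 → l₂ x = 0 → ‖A x‖ ≤ ε * ‖x‖) : GelfandLE A (n + m) ε := by
  refine ⟨ContinuousLinearMap.pi fun i => Fin.addCases
    (fun j => (ContinuousLinearMap.proj j).comp l₁) (fun j => (ContinuousLinearMap.proj j).comp l₂) i,
    fun x hx => h x ?_ ?_⟩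
  · ext j
    simpa using congrFun hx (Fin.castAdd m j)
  · ext j
    simpa using congrFun hx (Fin.natAdd n j)

theorem GelfandLE.mono {A : H →L[ℂ] K} {n m : ℕ} {ε η : ℝ} (h : GelfandLE A n ε)
    (hnm : n ≤ m) (hε : ε ≤ η) : GelfandLE A m η := by
  obtain ⟨l, hl⟩ := h
  obtain ⟨d, rfl⟩ := Nat.exists_eq_add_of_le hnm
  exact gelfandLE_of_injective_pair A η l 0 fun x hx _ =>
    (hl x hx).trans (by gcongr)

theorem GelfandLE.add_of_norm_le {A B : H →L[ℂ] K} {n : ℕ} {ε η : ℝ} (h : GelfandLE A n ε)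
    (hB : ‖B‖ ≤ η) : GelfandLE (A + B) n (ε + η) := by
  obtain ⟨l, hl⟩ := h
  refine ⟨l, fun x hx => ?_⟩
  calc ‖(A + B) x‖ ≤ ‖A x‖ + ‖B x‖ := norm_add_le _ _
    _ ≤ ε * ‖x‖ + η * ‖x‖ := add_le_add (hl x hx) (B.le_of_opNorm_le hB x)
    _ = (ε + η) * ‖x‖ := by ring

theorem GelfandLE.of_norm_le {A : H →L[ℂ] K} {B : H →L[ℂ] L} {n : ℕ} {ε c : ℝ}
    (h : GelfandLE B n ε) (hc : 0 ≤ c) (hAB : ∀ x, ‖A x‖ ≤ c * ‖B x‖) :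
    GelfandLE A n (c * ε) := by
  obtain ⟨l, hl⟩ := h
  refine ⟨l, fun x hx => (hAB x).trans ?_⟩
  rw [mul_assoc]
  exact mul_le_mul_of_nonneg_left (hl x hx) hc

theorem GelfandLE.comp {A : K →L[ℂ] L} {B : H →L[ℂ] K} {n m : ℕ} {ε η : ℝ} (hε : 0 ≤ ε)
    (hA : GelfandLE A n ε) (hB : GelfandLE B m η) : GelfandLE (A ∘L B) (n + m) (ε * η) := by
  obtain ⟨a, ha⟩ := hA
  obtain ⟨b, hb⟩ := hB
  refine gelfandLE_of_injective_pair _ _ (a ∘L B) b fun x h₁ h₂ => ?_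
  calc ‖A (B x)‖ ≤ ε * ‖B x‖ := ha _ h₁
    _ ≤ ε * (η * ‖x‖) := by gcongr; exact hb x h₂
    _ = ε * η * ‖x‖ := by ring

theorem GelfandLE.pow {A : H →L[ℂ] H} {n : ℕ} {ε : ℝ} (hε : 0 ≤ ε)
    (hA : GelfandLE A n ε) (m : ℕ) : GelfandLE (A ^ m) (m * n) (ε ^ m) := by
  induction m with
  | zero => exact ⟨0, fun x _ => by simp⟩
  | succ m ih =>
    rw [pow_succ, pow_succ, Nat.succ_mul]
    exact ih.comp (pow_nonneg hε m) hA

/-- With `T = A* B` one has `‖T x‖² = ⟨B x, A (T x)⟩`. Imposing the conditions of `A` on `T x` and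
those of `B` on `x` bounds both factors, so Gelfand numbers of the adjoint are not needed. -/
theorem GelfandLE.adjoint_comp [CompleteSpace H] [CompleteSpace K] {A B : H →L[ℂ] K}
    {n m : ℕ} {ε η : ℝ} (hε : 0 ≤ ε) (hη : 0 ≤ η) (hA : GelfandLE A n ε) (hB : GelfandLE B m η) :
    GelfandLE (ContinuousLinearMap.adjoint A ∘L B) (n + m) (ε * η) := by
  obtain ⟨a, ha⟩ := hA
  obtain ⟨b, hb⟩ := hB
  set T := ContinuousLinearMap.adjoint A ∘L B with hT
  refine gelfandLE_of_injective_pair _ _ (a ∘L T) b fun x h₁ h₂ => ?_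
  have h3 : ‖T x‖ ^ 2 ≤ ‖B x‖ * ‖A (T x)‖ := by
    rw [← inner_self_eq_norm_sq (𝕜 := ℂ)]
    nth_rewrite 1 [hT]
    rw [ContinuousLinearMap.comp_apply, ContinuousLinearMap.adjoint_inner_left]
    exact (RCLike.re_le_norm _).trans (norm_inner_le_norm _ _)
  have h4 := ha (T x) h₁
  have h5 := hb x h₂
  rcases (norm_nonneg (T x)).eq_or_lt with h0 | h0
  · rw [← h0]
    positivity
  · have : ‖T x‖ * ‖T x‖ ≤ (ε * η * ‖x‖) * ‖T x‖ := by
      calc ‖T x‖ * ‖T x‖ = ‖T x‖ ^ 2 := by ring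
        _ ≤ ‖B x‖ * ‖A (T x)‖ := h3
        _ ≤ (η * ‖x‖) * (ε * ‖T x‖) := by gcongr
        _ = _ := by ring
    exact le_of_mul_le_mul_right this h0

/-- Gelfand numbers of an operator with finite Hilbert–Schmidt norm. -/
theorem gelfandLE_of_sum_sq_le {A : H →L[ℂ] K} {S ε : ℝ} (hε : 0 < ε)
    (hS : ∀ (n : ℕ) (v : Fin n → H), Orthonormal ℂ v → ∑ i, ‖A (v i)‖ ^ 2 ≤ S) :
    GelfandLE A ⌊S / ε ^ 2⌋₊ ε := by
  classical
  -- Orthonormal families on which `A` exceeds `ε` have at most `S / ε²` members. A family of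
  -- maximal size supplies the linear conditions: orthogonality to its members.
  let P : ℕ → Prop := fun n => ∃ v : Fin n → H, Orthonormal ℂ v ∧ ∀ i, ε < ‖A (v i)‖
  have hbound : ∀ n, P n → n ≤ ⌊S / ε ^ 2⌋₊ := by
    rintro n ⟨v, hv, hA⟩
    apply Nat.le_floor
    rw [le_div_iff₀ (by positivity)]
    calc (n : ℝ) * ε ^ 2 = ∑ i : Fin n, ε ^ 2 := by simp
      _ ≤ ∑ i, ‖A (v i)‖ ^ 2 := by
          gcongr with i
          exact (hA i).le
      _ ≤ S := hS n v hv
  have h0 : P 0 := ⟨Fin.elim0, by simp [Orthonormal], fun i => i.elim0⟩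
  obtain ⟨N, hN⟩ : ∃ N, Nat.findGreatest P ⌊S / ε ^ 2⌋₊ = N := ⟨_, rfl⟩
  have hPN : P N := hN ▸ Nat.findGreatest_spec (P := P) (Nat.zero_le ⌊S / ε ^ 2⌋₊) h0
  obtain ⟨v, hv, hvA⟩ := hPN
  have hmain : GelfandLE A N ε := by
    refine ⟨ContinuousLinearMap.pi fun i => innerSL ℂ (v i), fun x hx => ?_⟩
    have hx' : ∀ i, inner ℂ (v i) x = 0 := fun i => by simpa using congrFun hx i
    by_contra hlt
    push Not at hlt
    have hx0 : x ≠ 0 := by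
      rintro rfl
      simp at hlt
    have hnx : 0 < ‖x‖ := norm_pos_iff.2 hx0
    -- A vector orthogonal to the family and violating the bound would, once normalised, enlarge it.
    have hP : P (N + 1) := by
      refine ⟨Fin.cons (((‖x‖⁻¹ : ℝ) : ℂ) • x) v, ?_, ?_⟩
      · constructor
        · intro i
          refine Fin.cases ?_ (fun j => ?_) i
          · simp [norm_smul, hnx.ne']
          · simpa using hv.1 j
        · intro i j
          refine Fin.cases ?_ (fun i => ?_) i <;> refine Fin.cases ?_ (fun j => ?_) j
          · simp
          · intro _
            simp only [Fin.cons_zero, Fin.cons_succ]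
            rw [← inner_conj_symm, inner_smul_right, hx']
            simp
          · intro _
            simp only [Fin.cons_zero, Fin.cons_succ]
            rw [inner_smul_right, hx']
            simp
          · intro hij
            simp only [Fin.cons_succ]
            exact hv.2 (fun h => hij (by rw [h]))
      · intro i
        refine Fin.cases ?_ (fun j => ?_) i
        · simp only [Fin.cons_zero, map_smul, norm_smul]
          simp only [Complex.norm_real, norm_inv, norm_norm]
          rw [inv_mul_eq_div, lt_div_iff₀ hnx]
          exact hlt
        · simpa using hvA j
    have := Nat.le_findGreatest (hbound _ hP) hP
    omega
  exact hmain.mono (hN ▸ Nat.findGreatest_le _) le_rfl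

/-- In infinite dimension `finrank` is `0` and the empty family serves, so eigenspaces need not be
known to be finite-dimensional beforehand. -/
theorem exists_orthonormal_fin_finrank (E : Submodule ℂ H) :
    ∃ v : Fin (Module.finrank ℂ E) → E, Orthonormal ℂ v := by
  by_cases h : FiniteDimensional ℂ E
  · exact ⟨stdOrthonormalBasis ℂ E, (stdOrthonormalBasis ℂ E).orthonormal⟩
  · have h0 : Module.finrank ℂ E = 0 := Module.finrank_of_not_finite h
    have : IsEmpty (Fin (Module.finrank ℂ E)) := by rw [h0]; infer_instance
    exact ⟨isEmptyElim, by simp [Orthonormal, Pairwise]⟩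

variable [CompleteSpace H] [CompleteSpace K]

/-- The orthogonal complement of the subspace cut out by `l` is finite-dimensional, and replacing
`A` by `A` composed with the projection onto it costs at most `ε / 2` in norm. So `A` is a norm
limit of compact operators. -/
theorem isCompactOperator_of_gelfandLE {A : H →L[ℂ] K}
    (h : ∀ ε > 0, ∃ n, GelfandLE A n ε) : IsCompactOperator A := by
  have hmem : A ∈ closure {B : H →L[ℂ] K | IsCompactOperator B} := by
    rw [Metric.mem_closure_iff]
    intro ε hε
    obtain ⟨n, l, hl⟩ := h (ε / 2) (half_pos hε)
    set U : Submodule ℂ H := LinearMap.ker (l : H →ₗ[ℂ] (Fin n → ℂ)) with hU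
    have : CompleteSpace U := (ContinuousLinearMap.isClosed_ker l).completeSpace_coe
    have hfin : FiniteDimensional ℂ Uᗮ := by
      have hinj : Function.Injective ((l : H →ₗ[ℂ] (Fin n → ℂ)).domRestrict Uᗮ) := by
        rw [← LinearMap.ker_eq_bot, LinearMap.ker_eq_bot']
        rintro ⟨x, hx⟩ hx0
        have hxU : x ∈ U := hx0
        have : x ∈ U ⊓ Uᗮ := ⟨hxU, hx⟩
        rw [Submodule.inf_orthogonal_eq_bot] at this
        exact Subtype.ext ((Submodule.mem_bot ℂ).1 this)
      exact Module.Finite.of_injective _ hinj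
    refine ⟨A ∘L Uᗮ.starProjection, ?_, ?_⟩
    · show IsCompactOperator (A ∘L Uᗮ.starProjection)
      have h1 : IsCompactOperator (Uᗮ.orthogonalProjectionOnto) :=
        isCompactOperator_of_locallyCompactSpace_dom
          Uᗮ.orthogonalProjectionOnto
      exact (h1.clm_comp (A ∘L Uᗮ.subtypeL))
    · rw [dist_eq_norm]
      refine lt_of_le_of_lt (ContinuousLinearMap.opNorm_le_bound _ (half_pos hε).le fun x => ?_)
        (half_lt_self hε)
      have hx : x - Uᗮ.starProjection x ∈ U := by
        have := Submodule.sub_starProjection_mem_orthogonal (K := Uᗮ) x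
        rwa [Submodule.orthogonal_orthogonal] at this
      have h2 : ‖x - Uᗮ.starProjection x‖ ≤ ‖x‖ := by
        have h3 := Submodule.starProjection_add_starProjection_orthogonal (K := U) x
        have h4 : x - Uᗮ.starProjection x = U.starProjection x := by
          rw [eq_comm, eq_sub_iff_add_eq]; exact h3
        rw [h4]
        exact U.norm_starProjection_apply_le x
      calc ‖(A - A ∘L Uᗮ.starProjection) x‖ = ‖A (x - Uᗮ.starProjection x)‖ := by simp
        _ ≤ ε / 2 * ‖x - Uᗮ.starProjection x‖ := hl _ hx
        _ ≤ ε / 2 * ‖x‖ := by gcongr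
  have hcl : IsClosed {B : H →L[ℂ] K | IsCompactOperator B} :=
    isClosed_setOfPred_isCompactOperator
  rw [hcl.closure_eq] at hmem
  exact hmem

/-- At most `n` singular values (with multiplicity) exceed a bound for the `(n+1)`-st Gelfand
number. -/
theorem sum_singularMultiplicity_le {A : H →L[ℂ] K} {n : ℕ} {ε : ℝ} (hε : 0 ≤ ε)
    (hA : GelfandLE A n ε) (F : Finset {σ : ℝ // 0 < σ}) (hF : ∀ σ ∈ F, ε < σ) :
    ∑ σ ∈ F, singularMultiplicity A σ ≤ n := by
  classical
  obtain ⟨l, hl⟩ := hA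
  set T : H →L[ℂ] H := ContinuousLinearMap.adjoint A ∘L A with hT
  have hsymm : (T : H →ₗ[ℂ] H).IsSymmetric := fun x y => by
    simp [hT, ContinuousLinearMap.adjoint_inner_left, ContinuousLinearMap.adjoint_inner_right]
  let f : F → ℂ := fun σ => (((σ : {σ : ℝ // 0 < σ}) : ℝ) ^ 2 : ℝ)
  have hf : Function.Injective f := by
    intro a b hab
    have h1 : ((a : {σ : ℝ // 0 < σ}) : ℝ) ^ 2 = ((b : {σ : ℝ // 0 < σ}) : ℝ) ^ 2 :=
      Complex.ofReal_injective hab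
    exact Subtype.ext (Subtype.ext
      ((pow_left_inj₀ a.1.2.le b.1.2.le two_ne_zero).1 h1))
  have horth := (hsymm.orthogonalFamily_eigenspaces).comp hf
  choose v hv using fun σ : F =>
    exists_orthonormal_fin_finrank (Module.End.eigenspace (T : H →ₗ[ℂ] H) (f σ))
  have hw := horth.orthonormal_sigma_orthonormal (v_family := v) hv
  set w := fun a : (Σ σ : F, Fin (Module.finrank ℂ
    (Module.End.eigenspace (T : H →ₗ[ℂ] H) (f σ)))) => ((v a.1 a.2 : _) : H) with hwdef
  replace hw : Orthonormal ℂ w := hw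
  have hTw : ∀ a, T (w a) = f a.1 • w a := fun a =>
    Module.End.mem_eigenspace_iff.1 (v a.1 a.2).2
  have hcard : Fintype.card (Σ σ : F, Fin (Module.finrank ℂ
      (Module.End.eigenspace (T : H →ₗ[ℂ] H) (f σ)))) = ∑ σ ∈ F, singularMultiplicity A σ := by
    rw [Fintype.card_sigma, ← Finset.sum_coe_sort F]
    simp only [Fintype.card_fin]
    rfl
  rw [← hcard]
  by_contra! hlt
  -- With more than `n` orthonormal eigenvectors of `A* A`, some nonzero combination `Ψ c` is killed
  -- by the `n` conditions. There `‖A (Ψ c)‖² = ∑ σ² |c|²` exceeds `ε² ‖Ψ c‖²`, a contradiction.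
  let Ψ : ((Σ σ : F, Fin (Module.finrank ℂ
      (Module.End.eigenspace (T : H →ₗ[ℂ] H) (f σ)))) → ℂ) →ₗ[ℂ] H :=
    Fintype.linearCombination ℂ w
  have hker := LinearMap.ker_ne_bot_of_finrank_lt (f := (l : H →ₗ[ℂ] (Fin n → ℂ)) ∘ₗ Ψ)
    (by simpa using hlt)
  obtain ⟨c, hc, hc0⟩ := Submodule.exists_mem_ne_zero_of_ne_bot hker
  have hΨ : Ψ c = ∑ i, c i • w i := by simp [Ψ, Fintype.linearCombination_apply]
  have hx := hl (Ψ c) hc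
  have h1 : ‖Ψ c‖ ^ 2 = ∑ i, ‖c i‖ ^ 2 := by
    rw [← inner_self_eq_norm_sq (𝕜 := ℂ), hΨ, hw.inner_sum, map_sum]
    refine Finset.sum_congr rfl fun i _ => ?_
    rw [RCLike.conj_mul]
    norm_cast
  have h2 : ‖A (Ψ c)‖ ^ 2 = ∑ i, ((i.1 : {σ : ℝ // 0 < σ}) : ℝ) ^ 2 * ‖c i‖ ^ 2 := by
    have h3 : T (Ψ c) = ∑ i, (f i.1 * c i) • w i := by
      rw [hΨ, map_sum]
      refine Finset.sum_congr rfl fun i _ => ?_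
      rw [map_smul, hTw, smul_smul, mul_comm]
    have h4 : ‖A (Ψ c)‖ ^ 2 = RCLike.re (inner ℂ (Ψ c) (T (Ψ c))) := by
      have h5 : T (Ψ c) = ContinuousLinearMap.adjoint A (A (Ψ c)) := rfl
      rw [h5, ContinuousLinearMap.adjoint_inner_right, inner_self_eq_norm_sq (𝕜 := ℂ)]
    rw [h4, h3, hΨ, hw.inner_sum, map_sum]
    refine Finset.sum_congr rfl fun i _ => ?_
    have : (starRingEnd ℂ) (c i) * (f i.1 * c i) = f i.1 * ((starRingEnd ℂ) (c i) * c i) := by ring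
    rw [this, RCLike.conj_mul]
    simp only [f]
    rw [← RCLike.ofReal_pow]
    exact (Complex.re_ofReal_mul _ _).trans (by rw [RCLike.ofReal_eq_complex_ofReal, Complex.ofReal_re])
  obtain ⟨i, hi⟩ := Function.ne_iff.1 hc0
  have h5 : ε ^ 2 * ∑ i, ‖c i‖ ^ 2 <
      ∑ i, ((i.1 : {σ : ℝ // 0 < σ}) : ℝ) ^ 2 * ‖c i‖ ^ 2 := by
    rw [Finset.mul_sum]
    refine Finset.sum_lt_sum (fun j _ => ?_) ⟨i, Finset.mem_univ _, ?_⟩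
    · have := hF j.1 j.1.2
      gcongr
    · have h6 : 0 < ‖c i‖ := norm_pos_iff.2 hi
      have := hF i.1 i.1.2
      gcongr
  rw [← h1, ← h2, ← mul_pow] at h5
  exact absurd h5 (not_lt.2 (by gcongr))

theorem singularMultiplicity_eq_zero_of_norm_lt {A : H →L[ℂ] K} {σ : ℝ} (hσ : ‖A‖ < σ) :
    singularMultiplicity A σ = 0 := by
  have hpos : 0 < σ := (norm_nonneg A).trans_lt hσ
  have hG : GelfandLE A 0 ‖A‖ := ⟨0, fun x _ => A.le_opNorm x⟩
  simpa using sum_singularMultiplicity_le (norm_nonneg A) hG {⟨σ, hpos⟩} (by simpa using hσ)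

/-- Power decay of the Gelfand numbers gives Schatten class membership. -/
theorem isSchatten_of_gelfandLE {A : H →L[ℂ] K} {p q C : ℝ} (hq : 0 < q) (hqp : q < p)
    (h : ∀ ε : ℝ, 0 < ε → ε ≤ 1 → ∃ n : ℕ, GelfandLE A n ε ∧ (n : ℝ) ≤ C * ε ^ (-q)) :
    IsSchatten p A := by
  have hp : 0 < p := hq.trans hqp
  refine ⟨isCompactOperator_of_gelfandLE fun ε hε => ?_, ?_⟩
  · obtain ⟨n, hn, -⟩ := h (min ε 1) (by positivity) (min_le_right _ _)
    exact ⟨n, hn.mono le_rfl (min_le_left _ _)⟩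
  set a : ℝ := max ‖A‖ 1 with ha
  have ha1 : 1 ≤ a := le_max_right _ _
  have ha0 : 0 < a := by positivity
  -- Dyadic shells: every `σ ≤ a` lies in some `(a 2^(-j-1), a 2^(-j)]`, hence satisfies `e j < σ ≤
  -- r j` because `a ≥ 1`. Leaving `a` out of `e j` keeps it below `1`, the range in which `h`
  -- applies.
  let r : ℕ → ℝ := fun j => a * (1 / 2) ^ j
  let e : ℕ → ℝ := fun j => (1 / 2) ^ (j + 1)
  have he0 : ∀ j, 0 < e j := fun j => by positivity
  have he1 : ∀ j, e j ≤ 1 := fun j => pow_le_one₀ (by norm_num) (by norm_num)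
  choose n hn hnC using fun j => h (e j) (he0 j) (he1 j)
  have hkey : ∀ σ : {σ : ℝ // 0 < σ},
      (singularMultiplicity A σ : ENNReal) * ENNReal.ofReal ((σ : ℝ) ^ p) ≤
      ∑' j, ENNReal.ofReal (r j ^ p) *
        (if e j < (σ : ℝ) then (singularMultiplicity A σ : ENNReal) else 0) := by
    intro σ
    by_cases hσ : a < σ
    · rw [singularMultiplicity_eq_zero_of_norm_lt ((le_max_left _ _).trans_lt hσ)]
      simp
    push Not at hσ
    obtain ⟨j, hj1, hj2⟩ := exists_nat_pow_near_of_lt_one (x := (σ : ℝ) / a) (y := 1 / 2)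
      (div_pos σ.2 ha0) ((div_le_one ha0).2 hσ) (by norm_num) (by norm_num)
    have h1 : e j < (σ : ℝ) := by
      rw [lt_div_iff₀ ha0] at hj1
      exact lt_of_le_of_lt (le_mul_of_one_le_right (he0 j).le ha1) hj1
    have h2 : (σ : ℝ) ≤ r j := by
      rw [div_le_iff₀ ha0] at hj2
      simpa [r, mul_comm] using hj2
    refine le_trans ?_ (ENNReal.le_tsum j)
    rw [if_pos h1, mul_comm]
    have hσ0 := σ.2.le
    gcongr
  have hcount : ∀ j, ∑' σ : {σ : ℝ // 0 < σ},
      (if e j < (σ : ℝ) then (singularMultiplicity A σ : ENNReal) else 0) ≤ n j := by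
    intro j
    rw [ENNReal.tsum_eq_iSup_sum]
    refine iSup_le fun F => ?_
    rw [← Finset.sum_filter]
    have := sum_singularMultiplicity_le (he0 j).le (hn j)
      (F.filter fun σ => e j < (σ : ℝ)) (by simp)
    exact_mod_cast this
  calc ∑' σ : {σ : ℝ // 0 < σ},
        (singularMultiplicity A σ : ENNReal) * ENNReal.ofReal ((σ : ℝ) ^ p)
      ≤ ∑' σ : {σ : ℝ // 0 < σ}, ∑' j, ENNReal.ofReal (r j ^ p) *
        (if e j < (σ : ℝ) then (singularMultiplicity A σ : ENNReal) else 0) :=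
        ENNReal.tsum_le_tsum hkey
    _ = ∑' j, ENNReal.ofReal (r j ^ p) * ∑' σ : {σ : ℝ // 0 < σ},
        (if e j < (σ : ℝ) then (singularMultiplicity A σ : ENNReal) else 0) := by
        rw [ENNReal.tsum_comm]
        simp_rw [ENNReal.tsum_mul_left]
    _ ≤ ∑' j, ENNReal.ofReal (r j ^ p) * n j := by
        gcongr with j
        exact hcount j
    -- `r j ^ p` is of order `2^(-jp)` and the count of order `2^(jq)`, which leaves a geometric
    -- series of ratio `2^(q-p) < 1`.
    _ ≤ ∑' j : ℕ, ENNReal.ofReal (a ^ p * C * 2 ^ q * ((1 / 2) ^ (p - q)) ^ j) := by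
        gcongr with j
        rw [← ENNReal.ofReal_natCast, ← ENNReal.ofReal_mul (by positivity)]
        apply ENNReal.ofReal_le_ofReal
        refine (mul_le_mul_of_nonneg_left (hnC j) (by positivity)).trans (le_of_eq ?_)
        have h2 : (0 : ℝ) < 1 / 2 := by norm_num
        simp only [r, e]
        rw [Real.mul_rpow ha0.le (by positivity), ← Real.rpow_natCast, ← Real.rpow_natCast,
          ← Real.rpow_natCast, ← Real.rpow_mul h2.le, ← Real.rpow_mul h2.le,
          ← Real.rpow_mul h2.le]
        have h3 : (2 : ℝ) ^ q = (1 / 2) ^ (-q) := by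
          rw [one_div, Real.inv_rpow (by norm_num), Real.rpow_neg (by norm_num), inv_inv]
        rw [h3]
        have h4 : ((1 : ℝ) / 2) ^ ((j : ℝ) * p) * (1 / 2) ^ (((j + 1 : ℕ) : ℝ) * -q) =
            (1 / 2) ^ (-q) * (1 / 2) ^ ((p - q) * (j : ℝ)) := by
          rw [← Real.rpow_add h2, ← Real.rpow_add h2]
          push_cast
          ring_nf
        linear_combination (a ^ p * C) * h4
    _ < ⊤ := by
        have hr : ((1 : ℝ) / 2) ^ (p - q) < 1 :=
          Real.rpow_lt_one (by norm_num) (by norm_num) (by linarith)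
        have hs : Summable fun j : ℕ => a ^ p * C * 2 ^ q * (((1 : ℝ) / 2) ^ (p - q)) ^ j :=
          (summable_geometric_of_lt_one (by positivity) hr).mul_left _
        exact hs.tsum_ofReal_lt_top

end Gelfand

/-! ### Integral operators with nonnegative kernels on L² -/

section Kernel
open scoped ENNReal ComplexConjugate

theorem eLpNorm_two_sq {X E : Type*} [MeasurableSpace X] [NormedAddCommGroup E] (μ : Measure X)
    (f : X → E) : eLpNorm f 2 μ ^ 2 = ∫⁻ x, ‖f x‖ₑ ^ 2 ∂μ := by
  have h := eLpNorm_nnreal_pow_eq_lintegral (μ := μ) (f := f) (p := 2) two_ne_zero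
  simp only [NNReal.coe_ofNat, ENNReal.coe_ofNat, ENNReal.rpow_ofNat] at h
  exact h

theorem ofReal_norm_sq_Lp_two {X E : Type*} [MeasurableSpace X] [NormedAddCommGroup E]
    {μ : Measure X} (f : Lp E 2 μ) : ENNReal.ofReal (‖f‖ ^ 2) = ∫⁻ x, ‖f x‖ₑ ^ 2 ∂μ := by
  rw [← eLpNorm_two_sq, ← Lp.enorm_def, ENNReal.ofReal_pow (norm_nonneg _), ofReal_norm]

theorem lintegral_enorm_sq_Lp_two_lt_top {X E : Type*} [MeasurableSpace X] [NormedAddCommGroup E]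
    {μ : Measure X} (f : Lp E 2 μ) : ∫⁻ x, ‖f x‖ₑ ^ 2 ∂μ < ∞ := by
  rw [← ofReal_norm_sq_Lp_two]
  exact ENNReal.ofReal_lt_top

theorem memLp_two_of_lintegral_enorm_sq {X E : Type*} [MeasurableSpace X] [NormedAddCommGroup E]
    {μ : Measure X} {f : X → E} (hf : AEStronglyMeasurable f μ)
    (h : ∫⁻ x, ‖f x‖ₑ ^ 2 ∂μ < ∞) : MemLp f 2 μ := by
  refine ⟨hf, ?_⟩
  rw [← eLpNorm_two_sq] at h
  exact lt_of_not_ge fun h' => by simp [top_le_iff.1 h'] at h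

/-- The Cauchy–Schwarz inequality for a function dominated by a geometric mean. -/
theorem sq_lintegral_le_mul {X : Type*} [MeasurableSpace X] {μ : Measure X} {f a b : X → ℝ≥0∞}
    (ha : AEMeasurable a μ) (hb : AEMeasurable b μ) (h : ∀ᵐ x ∂μ, f x ^ 2 ≤ a x * b x) :
    (∫⁻ x, f x ∂μ) ^ 2 ≤ (∫⁻ x, a x ∂μ) * ∫⁻ x, b x ∂μ := by
  have h2 : ∀ c : ℝ≥0∞, (c ^ (1 / 2 : ℝ)) ^ 2 = c := fun c => by
    rw [← ENNReal.rpow_natCast, ← ENNReal.rpow_mul]; norm_num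
  have h1 : ∫⁻ x, f x ∂μ ≤ (∫⁻ x, a x ∂μ) ^ (1 / 2 : ℝ) * (∫⁻ x, b x ∂μ) ^ (1 / 2 : ℝ) := by
    refine le_trans (lintegral_mono_ae (h.mono fun x hx => ?_))
      (ENNReal.lintegral_mul_norm_pow_le ha hb (p := 1 / 2) (q := 1 / 2)
        (by norm_num) (by norm_num) (by norm_num))
    refine (ENNReal.pow_le_pow_left_iff two_ne_zero).1 ?_
    rw [mul_pow, h2, h2]
    exact hx
  calc (∫⁻ x, f x ∂μ) ^ 2
      ≤ ((∫⁻ x, a x ∂μ) ^ (1 / 2 : ℝ) * (∫⁻ x, b x ∂μ) ^ (1 / 2 : ℝ)) ^ 2 := by gcongr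
    _ = _ := by rw [mul_pow, h2, h2]

variable {X Y Z : Type*} [MeasureSpace X] [MeasureSpace Y] [MeasureSpace Z]

/-- The nonnegative kernel `k` acts on nonnegative functions as an operator of `L²` norm at
most `C`. -/
def L2Bounded (k : Y → X → ℝ≥0∞) (C : ℝ≥0∞) : Prop :=
  ∀ g : X → ℝ≥0∞, Measurable g → ∫⁻ z, (∫⁻ x, k z x * g x) ^ 2 ≤ C ^ 2 * ∫⁻ x, g x ^ 2

/-- `A` is the integral operator with the nonnegative kernel `k`. -/
def IsKernelOp (k : Y → X → ℝ≥0∞)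
    (A : Lp ℂ 2 (volume : Measure X) →L[ℂ] Lp ℂ 2 (volume : Measure Y)) : Prop :=
  IsIntegralOperator (fun z x => (k z x).toReal) A

theorem L2Bounded.mono {k : Y → X → ℝ≥0∞} {C D : ℝ≥0∞} (h : L2Bounded k C) (hCD : C ≤ D) :
    L2Bounded k D := fun g hg => (h g hg).trans (by gcongr)

/-- The Schur test. -/
theorem L2Bounded.of_schur [SFinite (volume : Measure X)] [SFinite (volume : Measure Y)]
    {k k₁ k₂ : Y → X → ℝ≥0∞} {C C₁ C₂ : ℝ≥0∞}
    (h₁ : Measurable (Function.uncurry k₁)) (h₂ : Measurable (Function.uncurry k₂))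
    (hk : ∀ z x, k z x ^ 2 ≤ k₁ z x * k₂ z x) (hC₁ : ∀ z, ∫⁻ x, k₁ z x ≤ C₁)
    (hC₂ : ∀ x, ∫⁻ z, k₂ z x ≤ C₂) (hC : C₁ * C₂ ≤ C ^ 2) : L2Bounded k C := by
  intro g hg
  have hm : Measurable (Function.uncurry fun z x => k₂ z x * g x ^ 2) :=
    h₂.mul ((hg.comp measurable_snd).pow_const 2)
  calc ∫⁻ z, (∫⁻ x, k z x * g x) ^ 2
      ≤ ∫⁻ z, C₁ * ∫⁻ x, k₂ z x * g x ^ 2 := by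
        refine lintegral_mono fun z => ?_
        refine (sq_lintegral_le_mul (a := fun x => k₁ z x) (b := fun x => k₂ z x * g x ^ 2)
          (h₁.comp measurable_prodMk_left).aemeasurable
          (hm.comp measurable_prodMk_left).aemeasurable (.of_forall fun x => ?_)).trans ?_
        · rw [mul_pow, ← mul_assoc]
          gcongr
          exact hk z x
        · gcongr
          exact hC₁ z
    _ = C₁ * ∫⁻ x, (∫⁻ z, k₂ z x) * g x ^ 2 := by
        rw [lintegral_const_mul _ hm.lintegral_prod_right, lintegral_lintegral_swap hm.aemeasurable]
        congr 1
        refine lintegral_congr fun x => ?_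
        rw [lintegral_mul_const]
        exact h₂.comp measurable_prodMk_right
    _ ≤ C₁ * ∫⁻ x, C₂ * g x ^ 2 := by
        gcongr with x
        exact hC₂ x
    _ = (C₁ * C₂) * ∫⁻ x, g x ^ 2 := by
        rw [lintegral_const_mul _ (hg.pow_const 2), mul_assoc]
    _ ≤ C ^ 2 * ∫⁻ x, g x ^ 2 := by gcongr

theorem L2Bounded.comp [SFinite (volume : Measure X)] [SFinite (volume : Measure Y)]
    {k : Z → Y → ℝ≥0∞} {l : Y → X → ℝ≥0∞} {m : Z → X → ℝ≥0∞} {C D : ℝ≥0∞}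
    (hkm : Measurable (Function.uncurry k)) (hlm : Measurable (Function.uncurry l))
    (hk : L2Bounded k C) (hl : L2Bounded l D)
    (hm : ∀ z x, m z x = ∫⁻ y, k z y * l y x) : L2Bounded m (C * D) := by
  intro g hg
  have h2 : Measurable fun y => ∫⁻ x, l y x * g x :=
    (hlm.mul (hg.comp measurable_snd)).lintegral_prod_right
  have h1 : ∀ z, ∫⁻ x, m z x * g x = ∫⁻ y, k z y * ∫⁻ x, l y x * g x := by
    intro z
    have h3 : Measurable (Function.uncurry fun x y => k z y * (l y x * g x)) :=
      (hkm.comp (measurable_const.prodMk measurable_snd)).mul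
        ((hlm.comp measurable_swap).mul (hg.comp measurable_fst))
    calc ∫⁻ x, m z x * g x = ∫⁻ x, ∫⁻ y, k z y * (l y x * g x) := by
          refine lintegral_congr fun x => ?_
          rw [hm, ← lintegral_mul_const]
          · simp_rw [mul_assoc]
          · exact (hkm.comp measurable_prodMk_left).mul (hlm.comp measurable_prodMk_right)
      _ = ∫⁻ y, ∫⁻ x, k z y * (l y x * g x) := lintegral_lintegral_swap h3.aemeasurable
      _ = _ := by
          refine lintegral_congr fun y => ?_
          rw [lintegral_const_mul]
          exact (hlm.comp measurable_prodMk_left).mul hg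
  simp_rw [h1]
  calc _ ≤ C ^ 2 * ∫⁻ y, (∫⁻ x, l y x * g x) ^ 2 := hk _ h2
    _ ≤ C ^ 2 * (D ^ 2 * ∫⁻ x, g x ^ 2) := by gcongr; exact hl g hg
    _ = _ := by ring

theorem L2Bounded.ae_lintegral_lt_top [SFinite (volume : Measure X)] {k : Y → X → ℝ≥0∞}
    {C : ℝ≥0∞} (hkm : Measurable (Function.uncurry k)) (hk : L2Bounded k C) (hC : C ≠ ∞)
    {g : X → ℝ≥0∞} (hg : Measurable g) (hg2 : ∫⁻ x, g x ^ 2 < ∞) :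
    ∀ᵐ z, ∫⁻ x, k z x * g x < ∞ := by
  have hm : Measurable fun z => ∫⁻ x, k z x * g x :=
    (hkm.mul (hg.comp measurable_snd)).lintegral_prod_right
  have := ae_lt_top (hm.pow_const 2)
    ((hk g hg).trans_lt (ENNReal.mul_lt_top (by simp [hC.lt_top]) hg2)).ne
  filter_upwards [this] with z hz
  exact lt_of_not_ge fun h => by simp [top_le_iff.1 h] at hz

theorem enorm_toReal_mul_le (a : ℝ≥0∞) (b : ℂ) : ‖((a.toReal : ℝ) : ℂ) * b‖ₑ ≤ a * ‖b‖ₑ := by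
  rw [enorm_mul]
  gcongr
  rw [← ofReal_norm, Complex.norm_real, Real.norm_of_nonneg ENNReal.toReal_nonneg]
  exact ENNReal.ofReal_toReal_le

theorem measurable_toReal_mul {k : Y → X → ℝ≥0∞} (hkm : Measurable (Function.uncurry k))
    {f : X → ℂ} (hf : Measurable f) :
    Measurable (Function.uncurry fun z x => (((k z x).toReal : ℝ) : ℂ) * f x) :=
  (Complex.measurable_ofReal.comp hkm.ennreal_toReal).mul (hf.comp measurable_snd)

theorem L2Bounded.ae_integrable [SFinite (volume : Measure X)] {k : Y → X → ℝ≥0∞} {C : ℝ≥0∞}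
    (hkm : Measurable (Function.uncurry k)) (hk : L2Bounded k C) (hC : C ≠ ∞)
    {f : X → ℂ} (hf : Measurable f) (hf2 : ∫⁻ x, ‖f x‖ₑ ^ 2 < ∞) :
    ∀ᵐ z, Integrable fun x => (((k z x).toReal : ℝ) : ℂ) * f x := by
  filter_upwards [hk.ae_lintegral_lt_top hkm hC hf.enorm hf2] with z hz
  refine ⟨((measurable_toReal_mul hkm hf).comp measurable_prodMk_left).aestronglyMeasurable, ?_⟩
  exact (lintegral_mono fun x => enorm_toReal_mul_le _ _).trans_lt hz

theorem L2Bounded.lintegral_enorm_sq_le {k : Y → X → ℝ≥0∞} {C : ℝ≥0∞} (hk : L2Bounded k C)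
    {f : X → ℂ} (hf : Measurable f) :
    ∫⁻ z, ‖∫ x, (((k z x).toReal : ℝ) : ℂ) * f x‖ₑ ^ 2 ≤ C ^ 2 * ∫⁻ x, ‖f x‖ₑ ^ 2 := by
  refine le_trans (lintegral_mono fun z => ?_) (hk _ hf.enorm)
  gcongr
  exact (enorm_integral_le_lintegral_enorm _).trans
    (lintegral_mono fun x => enorm_toReal_mul_le _ _)

theorem measurable_Lp_two (f : Lp ℂ 2 (volume : Measure X)) : Measurable f :=
  (Lp.stronglyMeasurable f).measurable

theorem IsKernelOp.norm_le {k : Y → X → ℝ≥0∞} {C : ℝ}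
    {A : Lp ℂ 2 (volume : Measure X) →L[ℂ] Lp ℂ 2 (volume : Measure Y)} (hA : IsKernelOp k A)
    (hC : 0 ≤ C) (hk : L2Bounded k (ENNReal.ofReal C)) : ‖A‖ ≤ C := by
  refine A.opNorm_le_bound hC fun f => ?_
  have h1 : ENNReal.ofReal (‖A f‖ ^ 2) ≤ ENNReal.ofReal ((C * ‖f‖) ^ 2) := by
    rw [mul_pow, ENNReal.ofReal_mul (by positivity), ofReal_norm_sq_Lp_two, ofReal_norm_sq_Lp_two,
      ENNReal.ofReal_pow hC]
    refine le_trans (le_of_eq (lintegral_congr_ae ?_)) (hk.lintegral_enorm_sq_le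
      (measurable_Lp_two f))
    filter_upwards [hA f] with z hz
    rw [hz.2]
  exact (pow_le_pow_iff_left₀ (norm_nonneg _) (by positivity) two_ne_zero).1
    ((ENNReal.ofReal_le_ofReal_iff (by positivity)).1 h1)

/-- Turns identities between kernels into identities between operators. -/
theorem IsIntegralOperator.unique {K : Y → X → ℝ}
    {A B : Lp ℂ 2 (volume : Measure X) →L[ℂ] Lp ℂ 2 (volume : Measure Y)}
    (hA : IsIntegralOperator K A) (hB : IsIntegralOperator K B) : A = B := by
  ext1 f
  apply Lp.ext
  filter_upwards [hA f, hB f] with z h1 h2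
  rw [h1.2, h2.2]

/-- The L² bound makes the defining integral absolutely convergent for almost every `z`, so the
pointwise formula is additive almost everywhere and defines a bounded linear map. -/
theorem L2Bounded.exists_isKernelOp [SFinite (volume : Measure X)] {k : Y → X → ℝ≥0∞} {C : ℝ≥0∞}
    (hkm : Measurable (Function.uncurry k)) (hk : L2Bounded k C) (hC : C ≠ ∞) :
    ∃ A : Lp ℂ 2 (volume : Measure X) →L[ℂ] Lp ℂ 2 (volume : Measure Y), IsKernelOp k A := by
  have hmem : ∀ f : Lp ℂ 2 (volume : Measure X),
      MemLp (fun z => ∫ x, (((k z x).toReal : ℝ) : ℂ) * f x) 2 (volume : Measure Y) := fun f =>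
    memLp_two_of_lintegral_enorm_sq
      (measurable_toReal_mul hkm (measurable_Lp_two f)).stronglyMeasurable.integral_prod_right.aestronglyMeasurable
      ((hk.lintegral_enorm_sq_le (measurable_Lp_two f)).trans_lt
        (ENNReal.mul_lt_top (by simp [hC.lt_top]) (lintegral_enorm_sq_Lp_two_lt_top f)))
  have hInt : ∀ f : Lp ℂ 2 (volume : Measure X), ∀ᵐ z : Y,
      Integrable fun x => (((k z x).toReal : ℝ) : ℂ) * f x := fun f =>
    hk.ae_integrable hkm hC (measurable_Lp_two f) (lintegral_enorm_sq_Lp_two_lt_top f)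
  let L : Lp ℂ 2 (volume : Measure X) →ₗ[ℂ] Lp ℂ 2 (volume : Measure Y) :=
    { toFun := fun f => (hmem f).toLp _
      map_add' := fun f g => by
        apply Lp.ext
        filter_upwards [(hmem (f + g)).coeFn_toLp, (hmem f).coeFn_toLp, (hmem g).coeFn_toLp,
          hInt f, hInt g, Lp.coeFn_add ((hmem f).toLp _) ((hmem g).toLp _)] with z h1 h2 h3 h4 h5 h6
        rw [h1, h6, Pi.add_apply, h2, h3, ← integral_add h4 h5]
        refine integral_congr_ae ?_
        filter_upwards [Lp.coeFn_add f g] with x hx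
        rw [hx, Pi.add_apply, mul_add]
      map_smul' := fun c f => by
        apply Lp.ext
        filter_upwards [(hmem (c • f)).coeFn_toLp, (hmem f).coeFn_toLp,
          Lp.coeFn_smul c ((hmem f).toLp _)] with z h1 h2 h3
        rw [RingHom.id_apply, h1, h3, Pi.smul_apply, h2, smul_eq_mul, ← integral_const_mul]
        refine integral_congr_ae ?_
        filter_upwards [Lp.coeFn_smul c f] with x hx
        rw [hx, Pi.smul_apply, smul_eq_mul]
        ring }
  refine ⟨L.mkContinuous C.toReal fun f => ?_, fun f => ?_⟩
  · have h1 : ENNReal.ofReal (‖L f‖ ^ 2) ≤ ENNReal.ofReal ((C.toReal * ‖f‖) ^ 2) := by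
      rw [mul_pow, ENNReal.ofReal_mul (by positivity), ofReal_norm_sq_Lp_two,
        ofReal_norm_sq_Lp_two, ENNReal.ofReal_pow ENNReal.toReal_nonneg, ENNReal.ofReal_toReal hC]
      refine le_trans (le_of_eq (lintegral_congr_ae ?_)) (hk.lintegral_enorm_sq_le
        (measurable_Lp_two f))
      filter_upwards [(hmem f).coeFn_toLp] with z hz
      simp only [L, LinearMap.coe_mk, AddHom.coe_mk, hz]
    exact (pow_le_pow_iff_left₀ (norm_nonneg _) (by positivity) two_ne_zero).1
      ((ENNReal.ofReal_le_ofReal_iff (by positivity)).1 h1)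
  · filter_upwards [(hmem f).coeFn_toLp, hInt f] with z h1 h2
    exact ⟨h2, h1⟩

theorem IsKernelOp.add [SFinite (volume : Measure X)] {k l m : Y → X → ℝ≥0∞} {C D : ℝ≥0∞}
    {A B : Lp ℂ 2 (volume : Measure X) →L[ℂ] Lp ℂ 2 (volume : Measure Y)}
    (hkm : Measurable (Function.uncurry k)) (hlm : Measurable (Function.uncurry l))
    (hk : L2Bounded k C) (hl : L2Bounded l D) (hC : C ≠ ∞) (hD : D ≠ ∞)
    (hA : IsKernelOp k A) (hB : IsKernelOp l B) (hm : ∀ z x, m z x = k z x + l z x) :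
    IsKernelOp m (A + B) := by
  intro f
  have hf := measurable_Lp_two f
  have hf2 := lintegral_enorm_sq_Lp_two_lt_top f
  filter_upwards [hA f, hB f, hk.ae_lintegral_lt_top hkm hC hf.enorm hf2,
    hl.ae_lintegral_lt_top hlm hD hf.enorm hf2, Lp.coeFn_add (A f) (B f)] with z h1 h2 h3 h4 h5
  have hsum : (fun x => (((m z x).toReal : ℝ) : ℂ) * f x) =ᵐ[volume]
      fun x => (((k z x).toReal : ℝ) : ℂ) * f x + (((l z x).toReal : ℝ) : ℂ) * f x := by
    have h6 := ae_lt_top ((hkm.comp measurable_prodMk_left).mul hf.enorm) h3.ne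
    have h7 := ae_lt_top ((hlm.comp measurable_prodMk_left).mul hf.enorm) h4.ne
    -- The kernels may be infinite, where `toReal` is `0` and fails to be additive. Almost
    -- everywhere, though, the products with `‖f x‖ₑ` are finite, so the kernels are finite wherever
    -- `f x ≠ 0`.
    filter_upwards [h6, h7] with x h6 h7
    by_cases hx : f x = 0
    · simp [hx]
    have hx' : ‖f x‖ₑ ≠ 0 := enorm_ne_zero.2 hx
    have h8 : k z x ≠ ∞ := fun h => by
      simp [h, ENNReal.top_mul hx'] at h6
    have h9 : l z x ≠ ∞ := fun h => by
      simp [h, ENNReal.top_mul hx'] at h7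
    rw [hm, ENNReal.toReal_add h8 h9]
    push_cast
    ring
  refine ⟨(h1.1.add h2.1).congr hsum.symm, ?_⟩
  rw [add_apply, h5, Pi.add_apply, h1.2, h2.2, integral_congr_ae hsum,
    integral_add h1.1 h2.1]

theorem IsKernelOp.const_smul {k m : Y → X → ℝ≥0∞} {c : ℝ} (hc : 0 ≤ c)
    {A : Lp ℂ 2 (volume : Measure X) →L[ℂ] Lp ℂ 2 (volume : Measure Y)}
    (hA : IsKernelOp k A) (hm : ∀ z x, m z x = ENNReal.ofReal c * k z x) :
    IsKernelOp m ((c : ℂ) • A) := by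
  intro f
  filter_upwards [hA f, Lp.coeFn_smul (c : ℂ) (A f)] with z h1 h2
  have h3 : (fun x => (((m z x).toReal : ℝ) : ℂ) * f x) =
      fun x => (c : ℂ) * ((((k z x).toReal : ℝ) : ℂ) * f x) := by
    funext x
    rw [hm, ENNReal.toReal_mul, ENNReal.toReal_ofReal hc]
    push_cast
    ring
  rw [h3]
  refine ⟨h1.1.const_mul _, ?_⟩
  rw [smul_apply, h2, Pi.smul_apply, h1.2, smul_eq_mul, integral_const_mul]

theorem IsKernelOp.comp [SFinite (volume : Measure X)] [SFinite (volume : Measure Y)]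
    {k : Z → Y → ℝ≥0∞} {l : Y → X → ℝ≥0∞} {m : Z → X → ℝ≥0∞} {C D : ℝ≥0∞}
    {A : Lp ℂ 2 (volume : Measure Y) →L[ℂ] Lp ℂ 2 (volume : Measure Z)}
    {B : Lp ℂ 2 (volume : Measure X) →L[ℂ] Lp ℂ 2 (volume : Measure Y)}
    (hkm : Measurable (Function.uncurry k)) (hlm : Measurable (Function.uncurry l))
    (hk : L2Bounded k C) (hl : L2Bounded l D) (hC : C ≠ ∞) (hD : D ≠ ∞)
    (hA : IsKernelOp k A) (hB : IsKernelOp l B) (hm : ∀ z x, m z x = ∫⁻ y, k z y * l y x) :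
    IsKernelOp m (A ∘L B) := by
  intro f
  have hf := measurable_Lp_two f
  have hf2 := lintegral_enorm_sq_Lp_two_lt_top f
  have hBm : Measurable fun y => ∫⁻ x, l y x * ‖f x‖ₑ :=
    (hlm.mul (hf.enorm.comp measurable_snd)).lintegral_prod_right
  have hB2 : ∫⁻ y, (∫⁻ x, l y x * ‖f x‖ₑ) ^ 2 < ∞ :=
    (hl _ hf.enorm).trans_lt (ENNReal.mul_lt_top (by simp [hD.lt_top]) hf2)
  filter_upwards [hA (B f), hk.ae_lintegral_lt_top hkm hC hBm hB2] with z h1 h2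
  have hFm : Measurable (Function.uncurry fun y x =>
      (((k z y).toReal : ℝ) : ℂ) * ((((l y x).toReal : ℝ) : ℂ) * f x)) :=
    (Complex.measurable_ofReal.comp
      (hkm.comp (measurable_const.prodMk measurable_fst)).ennreal_toReal).mul
      (measurable_toReal_mul hlm hf)
  have hEm : Measurable (Function.uncurry fun y x => k z y * (l y x * ‖f x‖ₑ)) :=
    (hkm.comp (measurable_const.prodMk measurable_fst)).mul
      (hlm.mul (hf.enorm.comp measurable_snd))
  have hE : ∫⁻ y, ∫⁻ x, k z y * (l y x * ‖f x‖ₑ) < ∞ := by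
    refine lt_of_eq_of_lt (lintegral_congr fun y => ?_) h2
    rw [lintegral_const_mul]
    exact (hlm.comp measurable_prodMk_left).mul hf.enorm
  have hFi : Integrable (Function.uncurry fun y x =>
      (((k z y).toReal : ℝ) : ℂ) * ((((l y x).toReal : ℝ) : ℂ) * f x))
      ((volume : Measure Y).prod (volume : Measure X)) := by
    refine ⟨hFm.aestronglyMeasurable, ?_⟩
    refine lt_of_le_of_lt ?_ hE
    rw [lintegral_prod _ hFm.enorm.aemeasurable]
    refine lintegral_mono fun y => lintegral_mono fun x => ?_
    refine (enorm_toReal_mul_le _ _).trans ?_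
    gcongr
    exact enorm_toReal_mul_le _ _
  have hswap : ∫⁻ x, ∫⁻ y, k z y * (l y x * ‖f x‖ₑ) < ∞ := by
    rwa [← lintegral_lintegral_swap hEm.aemeasurable]
  -- For almost every `x` with `f x ≠ 0` the composed kernel is finite, and only then does `toReal`
  -- commute with the integral over `y`.
  have hker : (fun x => ∫ y, (((k z y).toReal : ℝ) : ℂ) * ((((l y x).toReal : ℝ) : ℂ) * f x))
      =ᵐ[volume] fun x => (((m z x).toReal : ℝ) : ℂ) * f x := by
    have h3 := ae_lt_top (hEm.comp measurable_swap).lintegral_prod_right' hswap.ne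
    filter_upwards [h3] with x hx
    by_cases hfx : f x = 0
    · simp [hfx]
    have hfx' : ‖f x‖ₑ ≠ 0 := enorm_ne_zero.2 hfx
    have hkl : Measurable fun y => k z y * l y x :=
      (hkm.comp measurable_prodMk_left).mul (hlm.comp measurable_prodMk_right)
    have h4 : ∫⁻ y, k z y * l y x < ∞ := by
      have : (∫⁻ y, k z y * l y x) * ‖f x‖ₑ < ∞ := by
        rw [← lintegral_mul_const _ hkl]
        simpa [Function.uncurry, mul_assoc] using hx
      exact lt_of_not_ge fun h => by simp [top_le_iff.1 h, ENNReal.top_mul hfx'] at this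
    have h5 : ∫ y, (k z y * l y x).toReal = (m z x).toReal := by
      rw [hm, integral_toReal hkl.aemeasurable (ae_lt_top hkl h4.ne)]
    rw [← h5, ← integral_complex_ofReal, ← integral_mul_const]
    refine integral_congr_ae (.of_forall fun y => ?_)
    simp only [ENNReal.toReal_mul]
    push_cast
    ring
  refine ⟨hFi.integral_prod_right.congr hker, ?_⟩
  rw [ContinuousLinearMap.comp_apply, h1.2, ← integral_congr_ae hker,
    ← integral_integral_swap hFi]
  refine integral_congr_ae ?_
  filter_upwards [hB f] with y hy
  rw [hy.2, integral_const_mul]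

/-- Fubini for the bilinear form of a bounded kernel. -/
theorem L2Bounded.integral_mul_swap [SFinite (volume : Measure X)] [SFinite (volume : Measure Y)]
    {k : Y → X → ℝ≥0∞} {C : ℝ≥0∞}
    (hkm : Measurable (Function.uncurry k)) (hk : L2Bounded k C) (hC : C ≠ ∞)
    {f : X → ℂ} (hf : Measurable f) (hf2 : ∫⁻ x, ‖f x‖ₑ ^ 2 < ∞)
    {g : Y → ℂ} (hg : Measurable g) (hg2 : ∫⁻ y, ‖g y‖ₑ ^ 2 < ∞) :
    ∫ y, (∫ x, (((k y x).toReal : ℝ) : ℂ) * f x) * g y =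
      ∫ x, f x * ∫ y, (((k y x).toReal : ℝ) : ℂ) * g y := by
  have hFm : Measurable (Function.uncurry fun y x => (((k y x).toReal : ℝ) : ℂ) * f x * g y) :=
    (measurable_toReal_mul hkm hf).mul (hg.comp measurable_fst)
  have hIm : Measurable fun y => ∫⁻ x, k y x * ‖f x‖ₑ :=
    (hkm.mul (hf.enorm.comp measurable_snd)).lintegral_prod_right
  have hE : ∫⁻ y, (∫⁻ x, k y x * ‖f x‖ₑ) * ‖g y‖ₑ < ∞ := by
    have h1 := sq_lintegral_le_mul (μ := (volume : Measure Y))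
      (f := fun y => (∫⁻ x, k y x * ‖f x‖ₑ) * ‖g y‖ₑ) (hIm.pow_const 2).aemeasurable
      (hg.enorm.pow_const 2).aemeasurable (.of_forall fun y => (mul_pow _ _ _).le)
    have h2 : (∫⁻ y, (∫⁻ x, k y x * ‖f x‖ₑ) ^ 2) * ∫⁻ y, ‖g y‖ₑ ^ 2 < ∞ :=
      ENNReal.mul_lt_top ((hk _ hf.enorm).trans_lt
        (ENNReal.mul_lt_top (by simp [hC.lt_top]) hf2)) hg2
    exact lt_of_not_ge fun h => by simp [top_le_iff.1 h] at h1; exact h2.ne h1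
  have hFi : Integrable (Function.uncurry fun y x => (((k y x).toReal : ℝ) : ℂ) * f x * g y)
      ((volume : Measure Y).prod (volume : Measure X)) := by
    refine ⟨hFm.aestronglyMeasurable, lt_of_le_of_lt ?_ hE⟩
    rw [lintegral_prod _ hFm.enorm.aemeasurable]
    refine lintegral_mono fun y => ?_
    rw [← lintegral_mul_const]
    · refine lintegral_mono fun x => ?_
      simp only [Function.uncurry]
      rw [enorm_mul]
      gcongr
      exact enorm_toReal_mul_le _ _
    · exact (hkm.comp measurable_prodMk_left).mul hf.enorm
  calc ∫ y, (∫ x, (((k y x).toReal : ℝ) : ℂ) * f x) * g y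
      = ∫ y, ∫ x, (((k y x).toReal : ℝ) : ℂ) * f x * g y := by
        refine integral_congr_ae (.of_forall fun y => ?_)
        simp only [integral_mul_const]
    _ = ∫ x, ∫ y, (((k y x).toReal : ℝ) : ℂ) * f x * g y := integral_integral_swap hFi
    _ = _ := by
        refine integral_congr_ae (.of_forall fun x => ?_)
        simp only [← integral_const_mul]
        refine integral_congr_ae (.of_forall fun y => ?_)
        simp only
        ring

/-- The kernel is real, so Fubini for the bilinear form, applied to `f` and the conjugate of `g`,
identifies the adjoint with the transposed kernel. -/
theorem IsKernelOp.adjoint_eq [SFinite (volume : Measure X)] [SFinite (volume : Measure Y)]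
    {k : Y → X → ℝ≥0∞} {C : ℝ≥0∞}
    {A : Lp ℂ 2 (volume : Measure X) →L[ℂ] Lp ℂ 2 (volume : Measure Y)}
    {B : Lp ℂ 2 (volume : Measure Y) →L[ℂ] Lp ℂ 2 (volume : Measure X)}
    (hkm : Measurable (Function.uncurry k)) (hk : L2Bounded k C) (hC : C ≠ ∞)
    (hA : IsKernelOp k A) (hB : IsKernelOp (fun x y => k y x) B) :
    ContinuousLinearMap.adjoint A = B := by
  symm
  rw [ContinuousLinearMap.eq_adjoint_iff]
  intro g f
  rw [L2.inner_def, L2.inner_def]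
  have hg := measurable_Lp_two g
  have h := hk.integral_mul_swap hkm hC (measurable_Lp_two f) (lintegral_enorm_sq_Lp_two_lt_top f)
    (g := fun y => conj (g y)) (Complex.continuous_conj.measurable.comp hg)
    (by simpa using lintegral_enorm_sq_Lp_two_lt_top g)
  calc ∫ x, inner ℂ (B g x) (f x)
      = ∫ x, f x * ∫ y, (((k y x).toReal : ℝ) : ℂ) * conj (g y) := by
        refine integral_congr_ae ?_
        filter_upwards [hB g] with x hx
        rw [hx.2, RCLike.inner_apply, ← integral_conj]
        simp
    _ = ∫ y, (∫ x, (((k y x).toReal : ℝ) : ℂ) * f x) * conj (g y) := h.symm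
    _ = ∫ y, inner ℂ (g y) (A f y) := by
        refine integral_congr_ae ?_
        filter_upwards [hA f] with y hy
        rw [hy.2, RCLike.inner_apply]

/-- Bessel's inequality for an integral operator with square integrable kernel. -/
theorem IsKernelOp.sum_norm_sq_le [SFinite (volume : Measure X)] {k : Y → X → ℝ≥0∞} {S : ℝ}
    {A : Lp ℂ 2 (volume : Measure X) →L[ℂ] Lp ℂ 2 (volume : Measure Y)}
    (hkm : Measurable (Function.uncurry k)) (hA : IsKernelOp k A) (hS : 0 ≤ S)
    (hk : ∫⁻ z, ∫⁻ x, k z x ^ 2 ≤ ENNReal.ofReal S)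
    (n : ℕ) (v : Fin n → Lp ℂ 2 (volume : Measure X)) (hv : Orthonormal ℂ v) :
    ∑ i, ‖A (v i)‖ ^ 2 ≤ S := by
  have hm : Measurable fun z => ∫⁻ x, k z x ^ 2 := (hkm.pow_const 2).lintegral_prod_right
  have hfin := ae_lt_top hm (hk.trans_lt ENNReal.ofReal_lt_top).ne
  have hAv : ∀ᵐ z, ∀ i, A (v i) z = ∫ x, (((k z x).toReal : ℝ) : ℂ) * v i x := by
    rw [ae_all_iff]
    intro i
    filter_upwards [hA (v i)] with z hz
    exact hz.2
  have hpt : ∀ᵐ z, ∑ i, ‖A (v i) z‖ₑ ^ 2 ≤ ∫⁻ x, k z x ^ 2 := by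
    filter_upwards [hfin, hAv] with z hz hAz
    have hz2 : ∫⁻ x, ‖(((k z x).toReal : ℝ) : ℂ)‖ₑ ^ 2 ≤ ∫⁻ x, k z x ^ 2 := by
      refine lintegral_mono fun x => ?_
      have := enorm_toReal_mul_le (k z x) 1
      simp only [mul_one, enorm_one] at this
      gcongr
    have hmem : MemLp (fun x => (((k z x).toReal : ℝ) : ℂ)) 2 (volume : Measure X) :=
      memLp_two_of_lintegral_enorm_sq (Complex.measurable_ofReal.comp
        (hkm.comp measurable_prodMk_left).ennreal_toReal).aestronglyMeasurable (hz2.trans_lt hz)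
    -- For fixed `z`, the values `A (v i) z` are, up to conjugation, the coefficients of the row `k
    -- z ·` in the family `v`. Bessel's inequality is applied to this row and then integrated over
    -- `z`.
    have hin : ∀ i, ‖A (v i) z‖ = ‖inner ℂ (v i) (hmem.toLp _)‖ := by
      intro i
      rw [hAz, norm_inner_symm, L2.inner_def]
      congr 1
      refine integral_congr_ae ?_
      filter_upwards [hmem.coeFn_toLp] with x hx
      rw [hx, RCLike.inner_apply, Complex.conj_ofReal, mul_comm]
    have hB := hv.sum_inner_products_le (hmem.toLp _) (s := Finset.univ)
    calc ∑ i, ‖A (v i) z‖ₑ ^ 2 = ENNReal.ofReal (∑ i, ‖inner ℂ (v i) (hmem.toLp _)‖ ^ 2) := by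
          rw [ENNReal.ofReal_sum_of_nonneg fun i _ => by positivity]
          refine Finset.sum_congr rfl fun i _ => ?_
          rw [← hin, ENNReal.ofReal_pow (norm_nonneg _), ofReal_norm]
      _ ≤ ENNReal.ofReal (‖hmem.toLp _‖ ^ 2) := ENNReal.ofReal_le_ofReal hB
      _ = ∫⁻ x, ‖(((k z x).toReal : ℝ) : ℂ)‖ₑ ^ 2 := by
          rw [ofReal_norm_sq_Lp_two]
          refine lintegral_congr_ae ?_
          filter_upwards [hmem.coeFn_toLp] with x hx
          rw [hx]
      _ ≤ _ := hz2
  rw [← ENNReal.ofReal_le_ofReal_iff hS, ENNReal.ofReal_sum_of_nonneg fun i _ => by positivity]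
  simp_rw [ofReal_norm_sq_Lp_two]
  rw [← lintegral_finsetSum _ fun i _ => (measurable_Lp_two _).enorm.pow_const 2]
  exact (lintegral_mono_ae hpt).trans hk

end Kernel

/-! ### Gaussian, Mehler and heat kernels in closed form -/

section Gaussian
open scoped ENNReal
open Real (exp sinh cosh)

theorem integrable_exp_neg_mul_sq_norm_plane {D : ℝ} (hD : 0 < D) :
    Integrable fun v : Plane => exp (-D * ‖v‖ ^ 2) := by
  have h := GaussianFourier.integrable_cexp_neg_mul_sq_norm_add (V := Plane) (b := (D : ℂ))
    (by simpa using hD) 0 0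
  refine (h.norm).congr (.of_forall fun v => ?_)
  simp only [Complex.norm_exp]
  congr 1
  norm_cast
  simp

theorem lintegral_exp_neg_mul_sq_norm_plane {D : ℝ} (hD : 0 < D) :
    ∫⁻ v : Plane, ENNReal.ofReal (exp (-D * ‖v‖ ^ 2)) = ENNReal.ofReal (Real.pi / D) := by
  rw [← ofReal_integral_eq_lintegral_ofReal (integrable_exp_neg_mul_sq_norm_plane hD)
    (.of_forall fun v => (Real.exp_pos _).le), GaussianFourier.integral_rexp_neg_mul_sq_norm hD]
  simp

theorem lintegral_exp_neg_mul_sq_norm_add_inner {D : ℝ} (hD : 0 < D) (w : Plane) :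
    ∫⁻ v : Plane, ENNReal.ofReal (exp (-D * ‖v‖ ^ 2 + 2 * inner ℝ w v)) =
      ENNReal.ofReal (Real.pi / D * exp (‖w‖ ^ 2 / D)) := by
  have h : ∀ v : Plane, ENNReal.ofReal (exp (-D * ‖v‖ ^ 2 + 2 * inner ℝ w v)) =
      ENNReal.ofReal (exp (‖w‖ ^ 2 / D)) *
        ENNReal.ofReal (exp (-D * ‖v - D⁻¹ • w‖ ^ 2)) := by
    intro v
    rw [← ENNReal.ofReal_mul (Real.exp_pos _).le, ← Real.exp_add]
    congr 2
    rw [norm_sub_sq_real, norm_smul, inner_smul_right, real_inner_comm, Real.norm_eq_abs,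
      mul_pow, sq_abs]
    field_simp
    ring
  simp_rw [h]
  rw [lintegral_const_mul' _ _ ENNReal.ofReal_ne_top,
    lintegral_sub_right_eq_self (fun v : Plane => ENNReal.ofReal (exp (-D * ‖v‖ ^ 2))),
    lintegral_exp_neg_mul_sq_norm_plane hD, ← ENNReal.ofReal_mul (Real.exp_pos _).le, mul_comm]

/-- The symmetric Gaussian kernel `c exp(-α (|u|² + |v|²) + 2 β u·v)` on the plane. -/
noncomputable def gaussKernel (c α β : ℝ) (u v : Plane) : ℝ :=
  c * exp (-α * (‖u‖ ^ 2 + ‖v‖ ^ 2) + 2 * β * inner ℝ u v)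

theorem gaussKernel_comm (c α β : ℝ) (u v : Plane) :
    gaussKernel c α β u v = gaussKernel c α β v u := by
  simp only [gaussKernel, real_inner_comm u v, add_comm (‖u‖ ^ 2)]

theorem gaussKernel_nonneg {c : ℝ} (hc : 0 ≤ c) (α β : ℝ) (u v : Plane) :
    0 ≤ gaussKernel c α β u v := mul_nonneg hc (Real.exp_pos _).le

theorem continuous_gaussKernel (c α β : ℝ) :
    Continuous fun q : Plane × Plane => gaussKernel c α β q.1 q.2 := by
  unfold gaussKernel
  fun_prop

theorem measurable_gaussKernel_left (c α β : ℝ) (u : Plane) :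
    Measurable fun v : Plane => gaussKernel c α β u v :=
  ((continuous_gaussKernel c α β).comp (by fun_prop : Continuous fun v => (u, v))).measurable

theorem lintegral_gaussKernel {c α : ℝ} (hc : 0 ≤ c) (hα : 0 < α) (β : ℝ) (u : Plane) :
    ∫⁻ v, ENNReal.ofReal (gaussKernel c α β u v) =
      ENNReal.ofReal (c * Real.pi / α * exp (-((α ^ 2 - β ^ 2) / α) * ‖u‖ ^ 2)) := by
  have h : ∀ v, ENNReal.ofReal (gaussKernel c α β u v) =
      ENNReal.ofReal (c * exp (-α * ‖u‖ ^ 2)) *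
        ENNReal.ofReal (exp (-α * ‖v‖ ^ 2 + 2 * inner ℝ (β • u) v)) := by
    intro v
    rw [← ENNReal.ofReal_mul (by positivity), gaussKernel, mul_assoc c (exp _), ← Real.exp_add,
      real_inner_smul_left]
    ring_nf
  simp_rw [h]
  rw [lintegral_const_mul' _ _ ENNReal.ofReal_ne_top, lintegral_exp_neg_mul_sq_norm_add_inner hα,
    ← ENNReal.ofReal_mul (by positivity)]
  congr 1
  have h2 : exp (-((α ^ 2 - β ^ 2) / α) * ‖u‖ ^ 2) =
      exp (-α * ‖u‖ ^ 2) * exp (‖β • u‖ ^ 2 / α) := by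
    rw [← Real.exp_add, norm_smul, Real.norm_eq_abs, mul_pow, sq_abs]
    congr 1
    field_simp
    ring
  rw [h2]
  ring

theorem lintegral_gaussKernel_le {c α β : ℝ} (hc : 0 ≤ c) (hα : 0 < α) (hβ : β ^ 2 ≤ α ^ 2)
    (u : Plane) :
    ∫⁻ v, ENNReal.ofReal (gaussKernel c α β u v) ≤ ENNReal.ofReal (c * Real.pi / α) := by
  rw [lintegral_gaussKernel hc hα]
  apply ENNReal.ofReal_le_ofReal
  have hpi := Real.pi_pos
  refine mul_le_of_le_one_right (by positivity) (Real.exp_le_one_iff.2 ?_)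
  have : 0 ≤ (α ^ 2 - β ^ 2) / α := div_nonneg (by linarith) hα.le
  nlinarith [sq_nonneg ‖u‖]

/-- Completing the square in `v`. The relations `hα₁` and `hα₂` say that the result is again
symmetric, with one `α` for both outer variables. -/
theorem lintegral_gaussKernel_mul {c₁ α₁ β₁ c₂ α₂ β₂ c α β : ℝ} (hc₁ : 0 ≤ c₁) (hc₂ : 0 ≤ c₂)
    (hD : 0 < α₁ + α₂) (hβ : β * (α₁ + α₂) = β₁ * β₂)
    (hα₁ : α * (α₁ + α₂) = α₁ * (α₁ + α₂) - β₁ ^ 2)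
    (hα₂ : α * (α₁ + α₂) = α₂ * (α₁ + α₂) - β₂ ^ 2)
    (hc : c * (α₁ + α₂) = c₁ * c₂ * Real.pi) (u w : Plane) :
    ∫⁻ v, ENNReal.ofReal (gaussKernel c₁ α₁ β₁ u v) * ENNReal.ofReal (gaussKernel c₂ α₂ β₂ v w) =
      ENNReal.ofReal (gaussKernel c α β u w) := by
  have h : ∀ v, ENNReal.ofReal (gaussKernel c₁ α₁ β₁ u v) *
      ENNReal.ofReal (gaussKernel c₂ α₂ β₂ v w) =
      ENNReal.ofReal (c₁ * c₂ * exp (-α₁ * ‖u‖ ^ 2 - α₂ * ‖w‖ ^ 2)) *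
        ENNReal.ofReal (exp (-(α₁ + α₂) * ‖v‖ ^ 2 + 2 * inner ℝ (β₁ • u + β₂ • w) v)) := by
    intro v
    rw [← ENNReal.ofReal_mul (gaussKernel_nonneg hc₁ _ _ _ _), ← ENNReal.ofReal_mul (by positivity),
      gaussKernel, gaussKernel, mul_mul_mul_comm, ← Real.exp_add, mul_assoc (c₁ * c₂),
      ← Real.exp_add, inner_add_left, real_inner_smul_left, real_inner_smul_left,
      real_inner_comm w v]
    ring_nf
  simp_rw [h]
  rw [lintegral_const_mul' _ _ ENNReal.ofReal_ne_top, lintegral_exp_neg_mul_sq_norm_add_inner hD,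
    ← ENNReal.ofReal_mul (by positivity), gaussKernel]
  congr 1
  have hc' : c = c₁ * c₂ * Real.pi / (α₁ + α₂) := by rw [eq_div_iff hD.ne', hc]
  have h2 : exp (-α * (‖u‖ ^ 2 + ‖w‖ ^ 2) + 2 * β * inner ℝ u w) =
      exp (-α₁ * ‖u‖ ^ 2 - α₂ * ‖w‖ ^ 2) * exp (‖β₁ • u + β₂ • w‖ ^ 2 / (α₁ + α₂)) := by
    rw [← Real.exp_add]
    congr 1
    have h3 : ‖β₁ • u + β₂ • w‖ ^ 2 =
        β₁ ^ 2 * ‖u‖ ^ 2 + 2 * (β₁ * β₂) * inner ℝ u w + β₂ ^ 2 * ‖w‖ ^ 2 := by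
      rw [norm_add_sq_real, norm_smul, norm_smul, real_inner_smul_left, real_inner_smul_right,
        Real.norm_eq_abs, Real.norm_eq_abs, mul_pow, mul_pow, sq_abs, sq_abs]
      ring
    rw [h3, ← sub_eq_iff_eq_add', eq_div_iff hD.ne']
    linear_combination (-‖u‖ ^ 2) * hα₁ - ‖w‖ ^ 2 * hα₂ + 2 * inner ℝ u w * hβ
  rw [hc', h2]
  ring

/-- The Mehler kernel of the plane oscillator of frequency `κ`. -/
noncomputable def mehler (κ s : ℝ) (u v : Plane) : ℝ :=
  gaussKernel (κ / (2 * Real.pi * sinh s)) (κ / 2 * (cosh s / sinh s)) (κ / (2 * sinh s)) u v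

/-- The semigroup law: the parameter relations of the Gaussian composition reduce to the addition
formulas of `sinh` and `cosh` and to `cosh² = sinh² + 1`. -/
theorem lintegral_mehler_mul {κ s t : ℝ} (hκ : 0 < κ) (hs : 0 < s) (ht : 0 < t) (u w : Plane) :
    ∫⁻ v, ENNReal.ofReal (mehler κ s u v) * ENNReal.ofReal (mehler κ t v w) =
      ENNReal.ofReal (mehler κ (s + t) u w) := by
  have h1 := Real.sinh_pos_iff.2 hs
  have h2 := Real.sinh_pos_iff.2 ht
  have h3 := Real.sinh_pos_iff.2 (add_pos hs ht)
  have c1 := Real.cosh_pos s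
  have c2 := Real.cosh_pos t
  have hpi := Real.pi_pos
  have e1 := Real.sinh_add s t
  have e2 := Real.cosh_add s t
  have e3 := Real.cosh_sq s
  have e4 := Real.cosh_sq t
  have h3' := h3.ne'
  unfold mehler
  apply lintegral_gaussKernel_mul (by positivity) (by positivity) (by positivity)
  · rw [e1] at h3' ⊢
    field_simp
    ring
  · rw [e1] at h3' ⊢
    rw [e2]
    field_simp
    linear_combination (-(cosh s * sinh t + cosh t * sinh s) * sinh t) * e3
  · rw [e1] at h3' ⊢
    rw [e2]
    field_simp
    linear_combination (-(cosh s * sinh t + cosh t * sinh s) * sinh s) * e4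
  · rw [e1] at h3' ⊢
    field_simp
    ring

/-- The square of the kernel is again Gaussian, with doubled exponents; integrating out `v` leaves
the rate `κ tanh s` in `u`. This is the squared Hilbert–Schmidt norm, of order `s⁻²` for small `s`.
-/
theorem lintegral_mehler_sq {κ s : ℝ} (hκ : 0 < κ) (hs : 0 < s) :
    ∫⁻ u, ∫⁻ v, ENNReal.ofReal (mehler κ s u v) ^ 2 = ENNReal.ofReal (1 / (4 * sinh s ^ 2)) := by
  have h1 := Real.sinh_pos_iff.2 hs
  have c1 := Real.cosh_pos s
  have hpi := Real.pi_pos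
  have e3 := Real.cosh_sq s
  have h : ∀ u v, ENNReal.ofReal (mehler κ s u v) ^ 2 = ENNReal.ofReal (gaussKernel
      ((κ / (2 * Real.pi * sinh s)) ^ 2) (κ * (cosh s / sinh s)) (κ / sinh s) u v) := by
    intro u v
    rw [mehler, ← ENNReal.ofReal_pow (gaussKernel_nonneg (by positivity) _ _ _ _), gaussKernel,
      gaussKernel, mul_pow, ← Real.exp_nat_mul]
    congr 3
    push_cast
    field_simp
  simp_rw [h]
  have h2 : ∀ u, ∫⁻ v, ENNReal.ofReal (gaussKernel
      ((κ / (2 * Real.pi * sinh s)) ^ 2) (κ * (cosh s / sinh s)) (κ / sinh s) u v) =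
      ENNReal.ofReal ((κ / (2 * Real.pi * sinh s)) ^ 2 * Real.pi / (κ * (cosh s / sinh s))) *
      ENNReal.ofReal (exp (-(κ * (sinh s / cosh s)) * ‖u‖ ^ 2)) := by
    intro u
    rw [lintegral_gaussKernel (by positivity) (by positivity), ← ENNReal.ofReal_mul (by positivity)]
    congr 4
    field_simp
    rw [e3]
    ring
  simp_rw [h2]
  rw [lintegral_const_mul' _ _ ENNReal.ofReal_ne_top,
    lintegral_exp_neg_mul_sq_norm_plane (by positivity), ← ENNReal.ofReal_mul (by positivity)]
  congr 1
  field_simp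
  ring

theorem measurable_mehler (κ s : ℝ) :
    Measurable (Function.uncurry fun u v : Plane => ENNReal.ofReal (mehler κ s u v)) :=
  (continuous_gaussKernel _ _ _).measurable.ennreal_ofReal

theorem lintegral_mehler_le {κ s : ℝ} (hκ : 0 < κ) (hs : 0 < s) (u : Plane) :
    ∫⁻ v, ENNReal.ofReal (mehler κ s u v) ≤ ENNReal.ofReal (1 / cosh s) := by
  have h1 := Real.sinh_pos_iff.2 hs
  have c1 := Real.cosh_pos s
  have hpi := Real.pi_pos
  have e3 := Real.cosh_sq s
  refine (lintegral_gaussKernel_le (by positivity) (by positivity) ?_ u).trans (le_of_eq ?_)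
  · rw [mul_pow, div_pow, div_pow, div_pow, mul_pow, e3, ← mul_div_assoc,
      div_le_div_iff₀ (by positivity) (by positivity)]
    have : 0 ≤ κ ^ 2 * sinh s ^ 4 := by positivity
    nlinarith
  · congr 1
    field_simp

/-- The heat kernel of the plane for `-½ Δ`. -/
noncomputable def planeHeat (t : ℝ) (u v : Plane) : ℝ :=
  gaussKernel (1 / (2 * Real.pi * t)) (1 / (2 * t)) (1 / (2 * t)) u v

theorem lintegral_planeHeat_mul {s t : ℝ} (hs : 0 < s) (ht : 0 < t) (u w : Plane) :
    ∫⁻ v, ENNReal.ofReal (planeHeat s u v) * ENNReal.ofReal (planeHeat t v w) =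
      ENNReal.ofReal (planeHeat (s + t) u w) := by
  have hpi := Real.pi_pos
  unfold planeHeat
  apply lintegral_gaussKernel_mul (by positivity) (by positivity) (by positivity)
  all_goals
    field_simp
    ring

theorem lintegral_planeHeat_le {t : ℝ} (ht : 0 < t) (u : Plane) :
    ∫⁻ v, ENNReal.ofReal (planeHeat t u v) ≤ 1 := by
  have hpi := Real.pi_pos
  refine (lintegral_gaussKernel_le (by positivity) (by positivity) le_rfl u).trans (le_of_eq ?_)
  rw [← ENNReal.ofReal_one]
  congr 1
  field_simp

theorem planeHeat_eq {t : ℝ} (u v : Plane) :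
    planeHeat t u v = 1 / (2 * Real.pi * t) * exp (-(1 / (2 * t)) * ‖u - v‖ ^ 2) := by
  rw [planeHeat, gaussKernel, norm_sub_sq_real]
  ring_nf

theorem planeHeat_le {t : ℝ} (ht : 0 < t) (u v : Plane) :
    planeHeat t u v ≤ 1 / (2 * Real.pi * t) := by
  have hpi := Real.pi_pos
  rw [planeHeat_eq]
  refine mul_le_of_le_one_right (by positivity) (Real.exp_le_one_iff.2 ?_)
  have : 0 ≤ 1 / (2 * t) * ‖u - v‖ ^ 2 := by positivity
  linarith

/-- The kernel of `exp(-t H₀)`. -/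
noncomputable def heatKernel (ω t : ℝ) (z w : Config) : ℝ :=
  planeHeat t z.1 w.1 * (exp (ω * t) * mehler ω (ω * t) z.2 w.2)

theorem heatKernel_comm (ω t : ℝ) (z w : Config) : heatKernel ω t z w = heatKernel ω t w z := by
  simp only [heatKernel, planeHeat, mehler, gaussKernel_comm _ _ _ z.1, gaussKernel_comm _ _ _ z.2]

theorem planeHeat_nonneg {t : ℝ} (ht : 0 < t) (u v : Plane) : 0 ≤ planeHeat t u v := by
  have := Real.pi_pos
  exact gaussKernel_nonneg (by positivity) _ _ _ _

theorem mehler_nonneg {κ s : ℝ} (hκ : 0 < κ) (hs : 0 < s) (u v : Plane) : 0 ≤ mehler κ s u v := by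
  have := Real.pi_pos
  have := Real.sinh_pos_iff.2 hs
  exact gaussKernel_nonneg (by positivity) _ _ _ _

theorem heatKernel_nonneg {ω t : ℝ} (hω : 0 < ω) (ht : 0 < t) (z w : Config) :
    0 ≤ heatKernel ω t z w :=
  mul_nonneg (planeHeat_nonneg ht _ _)
    (mul_nonneg (Real.exp_pos _).le (mehler_nonneg hω (mul_pos hω ht) _ _))

theorem measurable_heatKernel (ω : ℝ) :
    Measurable fun q : ℝ × Config × Config => heatKernel ω q.1 q.2.1 q.2.2 := by
  unfold heatKernel planeHeat mehler gaussKernel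
  have h1 : Measurable fun q : ℝ × Config × Config => sinh (ω * q.1) :=
    Real.measurable_sinh.comp (by fun_prop)
  have h2 : Measurable fun q : ℝ × Config × Config => cosh (ω * q.1) :=
    Real.measurable_cosh.comp (by fun_prop)
  fun_prop

theorem ofReal_heatKernel {ω t : ℝ} (ht : 0 < t) (z w : Config) :
    ENNReal.ofReal (heatKernel ω t z w) = ENNReal.ofReal (planeHeat t z.1 w.1) *
      (ENNReal.ofReal (exp (ω * t)) * ENNReal.ofReal (mehler ω (ω * t) z.2 w.2)) := by
  rw [heatKernel, ENNReal.ofReal_mul (planeHeat_nonneg ht _ _),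
    ENNReal.ofReal_mul (Real.exp_pos _).le]

theorem measurable_ofReal_planeHeat_left (t : ℝ) (u : Plane) :
    Measurable fun v => ENNReal.ofReal (planeHeat t u v) :=
  (measurable_gaussKernel_left _ _ _ u).ennreal_ofReal

theorem measurable_ofReal_mehler_left (κ s : ℝ) (u : Plane) :
    Measurable fun v => ENNReal.ofReal (mehler κ s u v) :=
  (measurable_gaussKernel_left _ _ _ u).ennreal_ofReal

theorem measurable_ofReal_planeHeat_right (t : ℝ) (u : Plane) :
    Measurable fun v => ENNReal.ofReal (planeHeat t v u) := by
  simpa only [planeHeat, gaussKernel_comm _ _ _ u] using measurable_ofReal_planeHeat_left t u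

theorem measurable_ofReal_mehler_right (κ s : ℝ) (u : Plane) :
    Measurable fun v => ENNReal.ofReal (mehler κ s v u) := by
  simpa only [mehler, gaussKernel_comm _ _ _ u] using measurable_ofReal_mehler_left κ s u

/-- The semigroup property of the heat kernel. -/
theorem lintegral_heatKernel_mul {ω s t : ℝ} (hω : 0 < ω) (hs : 0 < s) (ht : 0 < t)
    (z w : Config) :
    ∫⁻ y, ENNReal.ofReal (heatKernel ω s z y) * ENNReal.ofReal (heatKernel ω t y w) =
      ENNReal.ofReal (heatKernel ω (s + t) z w) := by
  have h : ∀ y : Config,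
      ENNReal.ofReal (heatKernel ω s z y) * ENNReal.ofReal (heatKernel ω t y w) =
      (ENNReal.ofReal (planeHeat s z.1 y.1) * ENNReal.ofReal (planeHeat t y.1 w.1)) *
      (ENNReal.ofReal (exp (ω * (s + t))) * (ENNReal.ofReal (mehler ω (ω * s) z.2 y.2) *
        ENNReal.ofReal (mehler ω (ω * t) y.2 w.2))) := by
    intro y
    rw [ofReal_heatKernel hs, ofReal_heatKernel ht, mul_add, Real.exp_add,
      ENNReal.ofReal_mul (Real.exp_pos _).le]
    ring
  simp_rw [h]
  rw [Measure.volume_eq_prod, lintegral_prod_mul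
    (f := fun x => ENNReal.ofReal (planeHeat s z.1 x) * ENNReal.ofReal (planeHeat t x w.1))
    (g := fun y => ENNReal.ofReal (exp (ω * (s + t))) * (ENNReal.ofReal (mehler ω (ω * s) z.2 y) *
        ENNReal.ofReal (mehler ω (ω * t) y w.2)))
    ((measurable_ofReal_planeHeat_left _ _).mul
      (measurable_ofReal_planeHeat_right _ _)).aemeasurable
    (((measurable_ofReal_mehler_left _ _ _).mul
      (measurable_ofReal_mehler_right _ _ _)).const_mul _).aemeasurable,
    lintegral_planeHeat_mul hs ht, lintegral_const_mul' _ _ ENNReal.ofReal_ne_top,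
    lintegral_mehler_mul hω (mul_pos hω hs) (mul_pos hω ht), ofReal_heatKernel (add_pos hs ht),
    mul_add]

/-- The growth `exp (ω t)` comes from the shift `-ω` in `H₀`; the mass bound `1 / cosh (ω t)` of the
Mehler kernel absorbs it uniformly in `t`. -/
theorem exp_mul_inv_cosh_le (x : ℝ) : exp x * (1 / cosh x) ≤ 2 := by
  have h := Real.cosh_pos x
  rw [mul_one_div, div_le_iff₀ h, Real.cosh_eq]
  have := Real.exp_pos (-x)
  linarith

theorem lintegral_exp_mul_mehler_le {ω t : ℝ} (hω : 0 < ω) (ht : 0 < t) (u : Plane) :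
    ∫⁻ v, ENNReal.ofReal (exp (ω * t)) * ENNReal.ofReal (mehler ω (ω * t) u v) ≤ 2 := by
  rw [lintegral_const_mul' _ _ ENNReal.ofReal_ne_top]
  calc _ ≤ ENNReal.ofReal (exp (ω * t)) * ENNReal.ofReal (1 / cosh (ω * t)) := by
        gcongr
        exact lintegral_mehler_le hω (mul_pos hω ht) u
    _ = ENNReal.ofReal (exp (ω * t) * (1 / cosh (ω * t))) :=
        (ENNReal.ofReal_mul (Real.exp_pos _).le).symm
    _ ≤ ENNReal.ofReal 2 := ENNReal.ofReal_le_ofReal (exp_mul_inv_cosh_le _)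
    _ = 2 := by norm_num

theorem lintegral_heatKernel_le {ω t : ℝ} (hω : 0 < ω) (ht : 0 < t) (z : Config) :
    ∫⁻ w, ENNReal.ofReal (heatKernel ω t z w) ≤ 2 := by
  simp_rw [ofReal_heatKernel ht]
  rw [Measure.volume_eq_prod, lintegral_prod_mul
    (f := fun x => ENNReal.ofReal (planeHeat t z.1 x))
    (g := fun y => ENNReal.ofReal (exp (ω * t)) * ENNReal.ofReal (mehler ω (ω * t) z.2 y))
    (measurable_ofReal_planeHeat_left _ _).aemeasurable
    ((measurable_ofReal_mehler_left _ _ _).const_mul _).aemeasurable]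
  calc _ ≤ (1 : ℝ≥0∞) * 2 := by
        gcongr
        · exact lintegral_planeHeat_le ht _
        · exact lintegral_exp_mul_mehler_le hω ht _
    _ = 2 := one_mul _

/-- One integration over the plane serves only the Mehler factor; the other factor is bounded by its
maximum `1 / (2πt)`. This is the singularity that sources on `x = y` produce. -/
theorem lintegral_heatKernel_diag_le {ω t : ℝ} (hω : 0 < ω) (ht : 0 < t) (z : Config) :
    ∫⁻ u : Plane, ENNReal.ofReal (heatKernel ω t z (u, u)) ≤ ENNReal.ofReal (1 / t) := by
  have hpi := Real.pi_gt_three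
  calc _ ≤ ∫⁻ u : Plane, ENNReal.ofReal (1 / (2 * Real.pi * t)) *
        (ENNReal.ofReal (exp (ω * t)) * ENNReal.ofReal (mehler ω (ω * t) z.2 u)) := by
        refine lintegral_mono fun u => ?_
        simp only
        rw [ofReal_heatKernel ht]
        gcongr
        exact planeHeat_le ht _ _
    _ ≤ ENNReal.ofReal (1 / (2 * Real.pi * t)) * 2 := by
        rw [lintegral_const_mul' _ _ ENNReal.ofReal_ne_top]
        gcongr
        exact lintegral_exp_mul_mehler_le hω ht _
    _ = ENNReal.ofReal (1 / (2 * Real.pi * t) * 2) := by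
        rw [ENNReal.ofReal_mul (by positivity)]
        norm_num
    _ ≤ _ := by
        apply ENNReal.ofReal_le_ofReal
        rw [div_mul_eq_mul_div, div_le_div_iff₀ (by positivity) ht]
        nlinarith

/-- On the plane of coincidence the heat kernel is a multiple of a Mehler kernel. -/
theorem exists_heatKernel_diag_eq_mehler {ω t : ℝ} (hω : 0 < ω) (ht : 0 < t) :
    ∃ c κ s : ℝ, 0 ≤ c ∧ 0 < κ ∧ 0 < s ∧ c ≤ exp (ω * t) / t ∧ ω * t / 2 ≤ sinh s ∧
      ∀ u v : Plane, heatKernel ω t (u, u) (v, v) = c * mehler κ s u v := by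
  have hpi := Real.pi_gt_three
  have hs := Real.sinh_pos_iff.2 (mul_pos hω ht)
  have hc := Real.cosh_pos (ω * t)
  have hsq := Real.cosh_sq (ω * t)
  set S := sinh (ω * t) with hS
  set Ch := cosh (ω * t) with hCh
  have hSt : ω * t ≤ S := Real.self_le_sinh_iff.2 (mul_pos hω ht).le
  -- `α` and `β` add the exponents of the two factors. To match them with a Mehler kernel one solves
  -- `κ/2 coth s = α` and `κ / (2 sinh s) = β`, so `(κ/2)² = α² - β²`, `sinh s = κ / (2β)` and `cosh
  -- s = α / β`. Then `κ ≥ ω` and `β ≤ 1/t` give `sinh s ≥ ω t / 2`.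
  set α : ℝ := 1 / (2 * t) + ω / 2 * (Ch / S) with hα
  set β : ℝ := 1 / (2 * t) + ω / (2 * S) with hβ
  have hβ0 : 0 < β := by positivity
  have hα0 : 0 < α := by positivity
  have hSC : 1 ≤ Ch := Real.one_le_cosh _
  have hαβ : (ω / 2) ^ 2 ≤ α ^ 2 - β ^ 2 := by
    have h1 : α ^ 2 - β ^ 2 = (ω / 2) ^ 2 + ω / (2 * t * S) * (Ch - 1) := by
      rw [hα, hβ]
      field_simp
      linear_combination (t ^ 2 * ω ^ 2) * hsq
    rw [h1]
    have : 0 ≤ ω / (2 * t * S) * (Ch - 1) := mul_nonneg (by positivity) (by linarith)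
    linarith
  have hd : 0 < α ^ 2 - β ^ 2 := lt_of_lt_of_le (by positivity) hαβ
  set κ : ℝ := 2 * √(α ^ 2 - β ^ 2) with hκ
  have hκ0 : 0 < κ := by positivity
  have hκω : ω ≤ κ := by
    have : ω / 2 ≤ √(α ^ 2 - β ^ 2) := Real.le_sqrt_of_sq_le hαβ
    linarith
  have hκ2 : κ ^ 2 = 4 * (α ^ 2 - β ^ 2) := by
    rw [hκ, mul_pow, Real.sq_sqrt hd.le]
    ring
  set s := Real.arsinh (κ / (2 * β)) with hsdef
  have hsinh : sinh s = κ / (2 * β) := Real.sinh_arsinh _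
  have hcosh : cosh s = α / β := by
    have h1 : cosh s ^ 2 = (α / β) ^ 2 := by
      rw [Real.cosh_sq, hsinh, div_pow, div_pow, hκ2]
      field_simp
      ring
    exact (pow_left_inj₀ (Real.cosh_pos _).le (by positivity) two_ne_zero).1 h1
  have hβle : β ≤ 1 / t := by
    have : ω / (2 * S) ≤ 1 / (2 * t) := by
      rw [div_le_div_iff₀ (by positivity) (by positivity)]
      nlinarith
    have h2 : 1 / t = 1 / (2 * t) + 1 / (2 * t) := by field_simp; ring
    rw [hβ, h2]
    gcongr
  -- `c` is the product of the two prefactors divided by `β / π`, the prefactor of `mehler κ s`.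
  refine ⟨1 / (2 * Real.pi * t) * (exp (ω * t) * (ω / (2 * Real.pi * S))) * (Real.pi / β), κ, s,
    by positivity, hκ0, Real.arsinh_pos_iff.2 (by positivity), ?_, ?_, ?_⟩
  · have h1 : Real.pi / β ≤ Real.pi * (2 * t) := by
      rw [div_le_iff₀ hβ0, hβ]
      have : 0 ≤ Real.pi * (2 * t) * (ω / (2 * S)) := by positivity
      have h2 : Real.pi * (2 * t) * (1 / (2 * t)) = Real.pi := by field_simp
      nlinarith
    have h2 : ω / (2 * Real.pi * S) ≤ 1 / t := by
      rw [div_le_div_iff₀ (by positivity) ht]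
      nlinarith
    calc _ ≤ 1 / (2 * Real.pi * t) * (exp (ω * t) * (1 / t)) * (Real.pi * (2 * t)) := by gcongr
      _ = exp (ω * t) / t := by field_simp
  · rw [hsinh, div_le_div_iff₀ (by norm_num) (by positivity)]
    have : ω * t * β ≤ ω := by
      calc ω * t * β ≤ ω * t * (1 / t) := by gcongr
        _ = ω := by field_simp
    nlinarith
  · intro u v
    have e1 : κ / (2 * Real.pi * sinh s) = β / Real.pi := by
      rw [hsinh]; field_simp
    have e2 : κ / 2 * (cosh s / sinh s) = α := by
      rw [hsinh, hcosh]; field_simp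
    have e3 : κ / (2 * sinh s) = β := by
      rw [hsinh]; field_simp
    rw [mehler, e1, e2, e3, heatKernel, planeHeat, mehler]
    simp only [gaussKernel]
    have e4 : exp (-α * (‖u‖ ^ 2 + ‖v‖ ^ 2) + 2 * β * inner ℝ u v) =
        exp (-(1 / (2 * t)) * (‖u‖ ^ 2 + ‖v‖ ^ 2) + 2 * (1 / (2 * t)) * inner ℝ u v) *
        exp (-(ω / 2 * (Ch / S)) * (‖u‖ ^ 2 + ‖v‖ ^ 2) + 2 * (ω / (2 * S)) * inner ℝ u v) := by
      rw [← Real.exp_add, hα, hβ]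
      ring_nf
    rw [e4, ← hS, ← hCh]
    field_simp

end Gaussian

/-! ### Time integrals of the heat kernel and their weights -/

section TimeKernel
open scoped ENNReal
open Real (exp sinh cosh)

attribute [local irreducible] heatKernel

/-- The kernel of `∫₀^∞ φ(t) exp(-t H₀) dt`. -/
noncomputable def timeKernel (ω : ℝ) (φ : ℝ → ℝ≥0∞) (z w : Config) : ℝ≥0∞ :=
  ∫⁻ t in Set.Ioi (0 : ℝ), φ t * ENNReal.ofReal (heatKernel ω t z w)

/-- The restriction of `timeKernel` to sources on the plane of coincidence. -/
noncomputable def diagKernel (ω : ℝ) (φ : ℝ → ℝ≥0∞) (z : Config) (u : Plane) : ℝ≥0∞ :=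
  timeKernel ω φ z (u, u)

theorem timeKernel_comm (ω : ℝ) (φ : ℝ → ℝ≥0∞) (z w : Config) :
    timeKernel ω φ z w = timeKernel ω φ w z := by
  simp only [timeKernel, heatKernel_comm ω _ z w]

theorem measurable_ofReal_heatKernel (ω t : ℝ) :
    Measurable (Function.uncurry fun z w : Config => ENNReal.ofReal (heatKernel ω t z w)) :=
  ((measurable_heatKernel ω).comp (measurable_const.prodMk measurable_id)).ennreal_ofReal

theorem measurable_mul_heatKernel (ω : ℝ) {φ : ℝ → ℝ≥0∞} (hφ : Measurable φ) :
    Measurable fun q : (Config × Config) × ℝ =>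
      φ q.2 * ENNReal.ofReal (heatKernel ω q.2 q.1.1 q.1.2) :=
  (hφ.comp measurable_snd).mul
    ((measurable_heatKernel ω).comp (measurable_snd.prodMk measurable_fst)).ennreal_ofReal

theorem measurable_heatKernel_time (ω : ℝ) (z w : Config) :
    Measurable fun t : ℝ => ENNReal.ofReal (heatKernel ω t z w) := by
  have h : Measurable fun t : ℝ => heatKernel ω t z w :=
    (measurable_heatKernel ω).comp
      (g := fun q : ℝ × Config × Config => heatKernel ω q.1 q.2.1 q.2.2)
      (measurable_id.prodMk (measurable_const (a := (z, w))))
  exact h.ennreal_ofReal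

theorem measurable_timeKernel (ω : ℝ) {φ : ℝ → ℝ≥0∞} (hφ : Measurable φ) :
    Measurable (Function.uncurry (timeKernel ω φ)) :=
  (measurable_mul_heatKernel ω hφ).lintegral_prod_right'

theorem measurable_diagKernel (ω : ℝ) {φ : ℝ → ℝ≥0∞} (hφ : Measurable φ) :
    Measurable (Function.uncurry (diagKernel ω φ)) :=
  (measurable_timeKernel ω hφ).comp
    (measurable_fst.prodMk (measurable_snd.prodMk measurable_snd))

theorem lintegral_timeKernel_le {ω : ℝ} (hω : 0 < ω) {φ : ℝ → ℝ≥0∞} (hφ : Measurable φ)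
    (z : Config) : ∫⁻ w, timeKernel ω φ z w ≤ 2 * ∫⁻ t in Set.Ioi (0 : ℝ), φ t := by
  have hm : Measurable (Function.uncurry fun (w : Config) (t : ℝ) =>
      φ t * ENNReal.ofReal (heatKernel ω t z w)) :=
    (measurable_mul_heatKernel ω hφ).comp
      ((measurable_const.prodMk measurable_fst).prodMk measurable_snd)
  unfold timeKernel
  rw [lintegral_lintegral_swap hm.aemeasurable, ← lintegral_const_mul _ hφ]
  refine setLIntegral_mono' measurableSet_Ioi fun t ht => ?_
  have h2 : Measurable fun w => ENNReal.ofReal (heatKernel ω t z w) :=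
    (measurable_ofReal_heatKernel ω t).comp measurable_prodMk_left
  rw [lintegral_const_mul _ h2, mul_comm 2]
  gcongr
  exact lintegral_heatKernel_le hω ht z

theorem lintegral_diagKernel_le {ω : ℝ} (hω : 0 < ω) {φ : ℝ → ℝ≥0∞} (hφ : Measurable φ)
    (z : Config) : ∫⁻ u, diagKernel ω φ z u ≤
      ∫⁻ t in Set.Ioi (0 : ℝ), φ t * ENNReal.ofReal (1 / t) := by
  have hm : Measurable (Function.uncurry fun (u : Plane) (t : ℝ) =>
      φ t * ENNReal.ofReal (heatKernel ω t z (u, u))) :=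
    (measurable_mul_heatKernel ω hφ).comp
      ((measurable_const.prodMk (measurable_fst.prodMk measurable_fst)).prodMk measurable_snd)
  unfold diagKernel timeKernel
  rw [lintegral_lintegral_swap hm.aemeasurable]
  refine setLIntegral_mono' measurableSet_Ioi fun t ht => ?_
  have h2 : Measurable fun u : Plane => ENNReal.ofReal (heatKernel ω t z (u, u)) :=
    (measurable_ofReal_heatKernel ω t).comp
      (measurable_const.prodMk (measurable_id.prodMk measurable_id))
  rw [lintegral_const_mul _ h2]
  gcongr
  exact lintegral_heatKernel_diag_le hω ht z

theorem l2Bounded_timeKernel {ω : ℝ} (hω : 0 < ω) {φ : ℝ → ℝ≥0∞} (hφ : Measurable φ) :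
    L2Bounded (timeKernel ω φ) (2 * ∫⁻ t in Set.Ioi (0 : ℝ), φ t) := by
  refine L2Bounded.of_schur (measurable_timeKernel ω hφ) (measurable_timeKernel ω hφ)
    (fun z x => (sq _).le) (lintegral_timeKernel_le hω hφ) (fun x => ?_) (sq _).ge
  simp_rw [timeKernel_comm ω φ _ x]
  exact lintegral_timeKernel_le hω hφ x

/-- Integrating over the source plane costs `1/t`, integrating over `z` only a constant. In the
Schur test the weight `φ` is therefore split as the geometric mean of `φ √t` and `φ / √t`, and each
side then costs a multiple of `∫ φ / √t`. -/
theorem l2Bounded_diagKernel {ω : ℝ} (hω : 0 < ω) {φ : ℝ → ℝ≥0∞} (hφ : Measurable φ) :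
    L2Bounded (diagKernel ω φ)
      (2 * ∫⁻ t in Set.Ioi (0 : ℝ), φ t * ENNReal.ofReal (1 / √t)) := by
  set I := ∫⁻ t in Set.Ioi (0 : ℝ), φ t * ENNReal.ofReal (1 / √t) with hI
  have h1 : Measurable fun t => φ t * ENNReal.ofReal √t :=
    hφ.mul (Real.continuous_sqrt.measurable.ennreal_ofReal)
  have h2 : Measurable fun t => φ t * ENNReal.ofReal (1 / √t) :=
    hφ.mul (measurable_const.div Real.continuous_sqrt.measurable).ennreal_ofReal
  refine L2Bounded.of_schur (C₁ := I) (C₂ := 2 * I) (measurable_diagKernel ω h1)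
    (measurable_diagKernel ω h2) (fun z u => ?_)
    (fun z => (lintegral_diagKernel_le hω h1 z).trans (le_of_eq ?_)) (fun u => ?_) ?_
  · refine sq_lintegral_le_mul
      (h1.mul (measurable_heatKernel_time ω z (u, u))).aemeasurable
      (h2.mul (measurable_heatKernel_time ω z (u, u))).aemeasurable ?_
    filter_upwards [ae_restrict_mem measurableSet_Ioi] with t ht
    have ht0 : 0 < √t := Real.sqrt_pos.2 ht
    have h3 : ENNReal.ofReal √t * ENNReal.ofReal (1 / √t) = 1 := by
      rw [← ENNReal.ofReal_mul ht0.le, mul_one_div_cancel ht0.ne', ENNReal.ofReal_one]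
    refine le_of_eq ?_
    calc _ = (φ t * ENNReal.ofReal (heatKernel ω t z (u, u))) ^ 2 *
          (ENNReal.ofReal √t * ENNReal.ofReal (1 / √t)) := by rw [h3, mul_one]
      _ = _ := by ring
  · refine setLIntegral_congr_fun measurableSet_Ioi fun t ht => ?_
    have ht0 : 0 < √t := Real.sqrt_pos.2 ht
    rw [mul_assoc, ← ENNReal.ofReal_mul ht0.le]
    congr 2
    have := Real.mul_self_sqrt (Set.mem_Ioi.1 ht).le
    rw [mul_one_div, div_eq_div_iff (Set.mem_Ioi.1 ht).ne' ht0.ne', this, one_mul]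
  · simp only [diagKernel, timeKernel_comm ω _ _ (u, u)]
    exact lintegral_timeKernel_le hω h2 (u, u)
  · calc I * (2 * I) = 2 * I ^ 2 := by ring
      _ ≤ 4 * I ^ 2 := by gcongr; norm_num
      _ = (2 * I) ^ 2 := by ring

theorem setLIntegral_Ioi_add (F : ℝ → ℝ≥0∞) (a : ℝ) :
    ∫⁻ s in Set.Ioi (0 : ℝ), F (s + a) = ∫⁻ t in Set.Ioi a, F t := by
  rw [← lintegral_indicator measurableSet_Ioi, ← lintegral_indicator measurableSet_Ioi,
    ← lintegral_add_right_eq_self ((Set.Ioi a).indicator F) a]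
  refine lintegral_congr fun s => ?_
  simp [Set.indicator]

theorem lintegral_timeKernel_mul_heatKernel {ω : ℝ} (hω : 0 < ω) {φ : ℝ → ℝ≥0∞}
    (hφ : Measurable φ) {t : ℝ} (ht : 0 < t) (z w : Config) :
    ∫⁻ y, timeKernel ω φ z y * ENNReal.ofReal (heatKernel ω t y w) =
      ∫⁻ s in Set.Ioi (0 : ℝ), φ s * ENNReal.ofReal (heatKernel ω (s + t) z w) := by
  have hm : Measurable fun q : Config × ℝ =>
      φ q.2 * ENNReal.ofReal (heatKernel ω q.2 z q.1) :=
    (measurable_mul_heatKernel ω hφ).comp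
      ((measurable_const.prodMk measurable_fst).prodMk measurable_snd)
  have hw : Measurable fun y => ENNReal.ofReal (heatKernel ω t y w) :=
    (measurable_ofReal_heatKernel ω t).comp measurable_prodMk_right
  calc _ = ∫⁻ y, ∫⁻ s in Set.Ioi (0 : ℝ), φ s * ENNReal.ofReal (heatKernel ω s z y) *
        ENNReal.ofReal (heatKernel ω t y w) := by
        refine lintegral_congr fun y => ?_
        have h3 : Measurable fun s => φ s * ENNReal.ofReal (heatKernel ω s z y) :=
          hφ.mul (measurable_heatKernel_time ω z y)
        rw [timeKernel, lintegral_mul_const _ h3]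
    _ = ∫⁻ s in Set.Ioi (0 : ℝ), ∫⁻ y, φ s * ENNReal.ofReal (heatKernel ω s z y) *
        ENNReal.ofReal (heatKernel ω t y w) :=
        lintegral_lintegral_swap (hm.mul (hw.comp measurable_fst)).aemeasurable
    _ = _ := by
        refine setLIntegral_congr_fun measurableSet_Ioi fun s hs => ?_
        have h2 : Measurable fun y => ENNReal.ofReal (heatKernel ω s z y) *
            ENNReal.ofReal (heatKernel ω t y w) :=
          ((measurable_ofReal_heatKernel ω s).comp measurable_prodMk_left).mul hw
        simp only [mul_assoc]
        rw [lintegral_const_mul _ h2, lintegral_heatKernel_mul hω hs ht]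

/-- By the semigroup law, composing two time integrals convolves their weights. -/
theorem lintegral_timeKernel_mul {ω : ℝ} (hω : 0 < ω) {φ ψ χ : ℝ → ℝ≥0∞}
    (hφ : Measurable φ) (hψ : Measurable ψ)
    (hχ : ∀ u > 0, ∫⁻ t in Set.Ioo 0 u, φ (u - t) * ψ t = χ u) (z w : Config) :
    ∫⁻ y, timeKernel ω φ z y * timeKernel ω ψ y w = timeKernel ω χ z w := by
  have hT : Measurable fun y => timeKernel ω φ z y :=
    (measurable_timeKernel ω hφ).comp measurable_prodMk_left
  have hm : Measurable fun q : Config × ℝ =>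
      ψ q.2 * ENNReal.ofReal (heatKernel ω q.2 q.1 w) :=
    (measurable_mul_heatKernel ω hψ).comp
      ((measurable_fst.prodMk measurable_const).prodMk measurable_snd)
  have hP := measurable_heatKernel_time ω z w
  calc _ = ∫⁻ y, ∫⁻ t in Set.Ioi (0 : ℝ), timeKernel ω φ z y *
        (ψ t * ENNReal.ofReal (heatKernel ω t y w)) := by
        refine lintegral_congr fun y => ?_
        have h3 : Measurable fun t => ψ t * ENNReal.ofReal (heatKernel ω t y w) :=
          hψ.mul (measurable_heatKernel_time ω y w)
        rw [lintegral_const_mul _ h3, ← timeKernel]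
    _ = ∫⁻ t in Set.Ioi (0 : ℝ), ∫⁻ y, timeKernel ω φ z y *
        (ψ t * ENNReal.ofReal (heatKernel ω t y w)) :=
        lintegral_lintegral_swap ((hT.comp measurable_fst).mul hm).aemeasurable
    _ = ∫⁻ t in Set.Ioi (0 : ℝ), ψ t *
        ∫⁻ u in Set.Ioi t, φ (u - t) * ENNReal.ofReal (heatKernel ω u z w) := by
        refine setLIntegral_congr_fun measurableSet_Ioi fun t ht => ?_
        have hw : Measurable fun y => ENNReal.ofReal (heatKernel ω t y w) :=
          (measurable_ofReal_heatKernel ω t).comp measurable_prodMk_right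
        simp only [mul_left_comm _ (ψ t)]
        have h3 : Measurable fun y => timeKernel ω φ z y * ENNReal.ofReal (heatKernel ω t y w) :=
          hT.mul hw
        rw [lintegral_const_mul _ h3, lintegral_timeKernel_mul_heatKernel hω hφ ht,
          ← setLIntegral_Ioi_add (fun u => φ (u - t) * ENNReal.ofReal (heatKernel ω u z w)) t]
        simp
    -- Extending both weights by zero turns the triangle `0 < t < u` into the whole plane, where
    -- Tonelli applies.
    _ = ∫⁻ t, ∫⁻ u, (Set.Ioi (0 : ℝ)).indicator ψ t * (Set.Ioi (0 : ℝ)).indicator φ (u - t) *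
        ENNReal.ofReal (heatKernel ω u z w) := by
        rw [← lintegral_indicator measurableSet_Ioi]
        refine lintegral_congr fun t => ?_
        by_cases ht : t ∈ Set.Ioi (0 : ℝ)
        · have h3 : Measurable fun u => φ (u - t) * ENNReal.ofReal (heatKernel ω u z w) :=
            (hφ.comp (measurable_id.sub_const t)).mul hP
          rw [Set.indicator_of_mem ht, Set.indicator_of_mem ht, ← lintegral_const_mul _ h3,
            ← lintegral_indicator measurableSet_Ioi]
          refine lintegral_congr fun u => ?_
          by_cases hu : t < u <;> simp [Set.indicator, hu, mul_assoc]
        · simp [Set.indicator_of_notMem ht]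
    _ = ∫⁻ u, ∫⁻ t, (Set.Ioi (0 : ℝ)).indicator ψ t * (Set.Ioi (0 : ℝ)).indicator φ (u - t) *
        ENNReal.ofReal (heatKernel ω u z w) := by
        refine lintegral_lintegral_swap (Measurable.aemeasurable ?_)
        exact (((hψ.indicator measurableSet_Ioi).comp measurable_fst).mul
          ((hφ.indicator measurableSet_Ioi).comp (measurable_snd.sub measurable_fst))).mul
          (hP.comp measurable_snd)
    _ = timeKernel ω χ z w := by
        rw [timeKernel, ← lintegral_indicator measurableSet_Ioi]
        refine lintegral_congr fun u => ?_
        have hmu : Measurable fun t => (Set.Ioi (0 : ℝ)).indicator ψ t *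
            (Set.Ioi (0 : ℝ)).indicator φ (u - t) :=
          (hψ.indicator measurableSet_Ioi).mul
            ((hφ.indicator measurableSet_Ioi).comp (measurable_const.sub measurable_id))
        rw [lintegral_mul_const _ hmu]
        have hpt : ∀ t, (Set.Ioi (0 : ℝ)).indicator ψ t * (Set.Ioi (0 : ℝ)).indicator φ (u - t) =
            (Set.Ioo 0 u).indicator (fun t => φ (u - t) * ψ t) t := by
          intro t
          by_cases h1 : 0 < t <;> by_cases h2 : t < u <;>
            simp [Set.indicator, h1, h2, mul_comm]
        simp_rw [hpt]
        rw [lintegral_indicator measurableSet_Ioo]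
        by_cases hu : u ∈ Set.Ioi (0 : ℝ)
        · rw [hχ u hu, Set.indicator_of_mem hu]
        · rw [Set.indicator_of_notMem hu, Set.Ioo_eq_empty (fun h => hu h)]
          simp

/-- The weight `t^k e^{-λt} / k!`. -/
noncomputable def timeWeight (lam : ℝ) (k : ℕ) (t : ℝ) : ℝ≥0∞ :=
  ENNReal.ofReal (t ^ k / k.factorial * exp (-lam * t))

theorem measurable_timeWeight (lam : ℝ) (k : ℕ) : Measurable (timeWeight lam k) := by
  unfold timeWeight
  fun_prop

theorem timeWeight_convolution (lam : ℝ) (k : ℕ) {u : ℝ} (hu : 0 < u) :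
    ∫⁻ t in Set.Ioo 0 u, timeWeight lam 0 (u - t) * timeWeight lam k t =
      timeWeight lam (k + 1) u := by
  have h : ∀ t ∈ Set.Ioo 0 u, timeWeight lam 0 (u - t) * timeWeight lam k t =
      ENNReal.ofReal (exp (-lam * u) / k.factorial * t ^ k) := by
    intro t ht
    have ht0 := ht.1.le
    rw [timeWeight, timeWeight, ← ENNReal.ofReal_mul (by positivity)]
    congr 1
    have : exp (-lam * u) = exp (-lam * (u - t)) * exp (-lam * t) := by
      rw [← Real.exp_add]; ring_nf
    rw [this]
    simp
    ring
  rw [setLIntegral_congr_fun measurableSet_Ioo h, ← ofReal_integral_eq_lintegral_ofReal,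
    integral_const_mul, ← integral_Ioc_eq_integral_Ioo,
    ← intervalIntegral.integral_of_le hu.le, integral_pow, timeWeight]
  · congr 1
    rw [Nat.factorial_succ]
    push_cast
    field_simp
    simp
  · have hc : Continuous fun t : ℝ => exp (-lam * u) / k.factorial * t ^ k := by fun_prop
    exact (hc.integrableOn_Icc (a := 0) (b := u)).mono_set Set.Ioo_subset_Icc_self
  · filter_upwards [ae_restrict_mem measurableSet_Ioo] with t ht
    have ht0 := ht.1.le
    simp only [Pi.zero_apply]
    positivity

theorem lintegral_timeWeight_lt_top {lam : ℝ} (hlam : 0 < lam) (k : ℕ) :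
    ∫⁻ t in Set.Ioi (0 : ℝ), timeWeight lam k t < ∞ := by
  have h := integrableOn_rpow_mul_exp_neg_mul_rpow (s := k) (p := 1) (b := lam)
    (by have : (0 : ℝ) ≤ k := k.cast_nonneg
        linarith) (by norm_num) hlam
  refine lt_of_le_of_lt (setLIntegral_mono' measurableSet_Ioi fun t ht => ?_) h.2
  have ht0 : (0 : ℝ) < t := ht
  rw [timeWeight, ← ofReal_norm]
  apply ENNReal.ofReal_le_ofReal
  simp only [Real.rpow_natCast, Real.rpow_one]
  rw [norm_mul, Real.norm_eq_abs, Real.norm_eq_abs,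
    abs_of_nonneg (by positivity), abs_of_nonneg (by positivity)]
  gcongr
  exact div_le_self (by positivity) (by exact_mod_cast k.factorial_pos)

theorem lintegral_timeWeight_div_sqrt_lt_top {lam : ℝ} (hlam : 0 < lam) (k : ℕ) :
    ∫⁻ t in Set.Ioi (0 : ℝ), timeWeight lam k t * ENNReal.ofReal (1 / √t) < ∞ := by
  have h := integrableOn_rpow_mul_exp_neg_mul_rpow (s := k - 1 / 2) (p := 1) (b := lam)
    (by have : (0 : ℝ) ≤ k := k.cast_nonneg
        linarith) (by norm_num) hlam
  refine lt_of_le_of_lt (setLIntegral_mono' measurableSet_Ioi fun t ht => ?_) h.2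
  have ht0 : (0 : ℝ) < t := ht
  rw [timeWeight, ← ENNReal.ofReal_mul (by positivity), ← ofReal_norm]
  apply ENNReal.ofReal_le_ofReal
  simp only [Real.rpow_one]
  rw [norm_mul, Real.norm_eq_abs, Real.norm_eq_abs,
    abs_of_nonneg (by positivity), abs_of_nonneg (by positivity), Real.rpow_sub ht0,
    Real.rpow_natCast, ← Real.sqrt_eq_rpow, mul_right_comm, mul_one_div]
  gcongr
  exact div_le_self (by positivity) (by exact_mod_cast k.factorial_pos)

/-- On `(0, δ]` the weight is at most `δ^k`, and `∫₀^δ t^(-1/2) dt = 2 √δ`. -/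
theorem lintegral_timeWeight_div_sqrt_Ioc_le {lam : ℝ} (hlam : 0 < lam) (k : ℕ) {δ : ℝ}
    (hδ : 0 < δ) :
    ∫⁻ t in Set.Ioc 0 δ, timeWeight lam k t * ENNReal.ofReal (1 / √t) ≤
      ENNReal.ofReal (2 * δ ^ (k + 1 / 2 : ℝ)) := by
  have hInt : IntegrableOn (fun t : ℝ => δ ^ k * t ^ (-1 / 2 : ℝ)) (Set.Ioc 0 δ) := by
    rw [← intervalIntegrable_iff_integrableOn_Ioc_of_le hδ.le]
    exact (intervalIntegral.intervalIntegrable_rpow' (by norm_num)).const_mul _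
  calc _ ≤ ∫⁻ t in Set.Ioc 0 δ, ENNReal.ofReal (δ ^ k * t ^ (-1 / 2 : ℝ)) := by
        refine setLIntegral_mono' measurableSet_Ioc fun t ht => ?_
        have ht0 : 0 < t := ht.1
        rw [timeWeight, ← ENNReal.ofReal_mul (by positivity)]
        apply ENNReal.ofReal_le_ofReal
        have h1 : 1 / √t = t ^ (-1 / 2 : ℝ) := by
          rw [Real.sqrt_eq_rpow, neg_div, Real.rpow_neg ht0.le, one_div]
        rw [h1]
        gcongr
        calc t ^ k / k.factorial * exp (-lam * t) ≤ t ^ k * 1 := by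
              gcongr
              · exact div_le_self (by positivity) (by exact_mod_cast k.factorial_pos)
              · rw [Real.exp_le_one_iff]
                nlinarith
          _ ≤ δ ^ k := by
              rw [mul_one]
              gcongr
              exact ht.2
    _ = ENNReal.ofReal (2 * δ ^ (k + 1 / 2 : ℝ)) := by
        rw [← ofReal_integral_eq_lintegral_ofReal hInt]
        · congr 1
          rw [integral_const_mul, ← intervalIntegral.integral_of_le hδ.le,
            integral_rpow (Or.inl (by norm_num)), Real.rpow_add hδ (k : ℝ), Real.rpow_natCast]
          norm_num
          ring
        · filter_upwards [ae_restrict_mem measurableSet_Ioc] with t ht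
          have ht0 := ht.1.le
          simp only [Pi.zero_apply]
          positivity

end TimeKernel

/-! ### Gelfand numbers of the heat trace on the plane of coincidence -/

section Singular
open scoped ENNReal
open Real (exp sinh cosh)

attribute [local irreducible] heatKernel mehler

/-- The kernel of `exp(-t H₀)` with sources on the plane of coincidence. -/
noncomputable def traceKernel (ω t : ℝ) (z : Config) (u : Plane) : ℝ≥0∞ :=
  ENNReal.ofReal (heatKernel ω t z (u, u))

theorem measurable_traceKernel (ω t : ℝ) : Measurable (Function.uncurry (traceKernel ω t)) :=
  (measurable_ofReal_heatKernel ω t).comp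
    (measurable_fst.prodMk (measurable_snd.prodMk measurable_snd))

theorem measurable_traceKernel_swap (ω t : ℝ) :
    Measurable (Function.uncurry fun u z => traceKernel ω t z u) :=
  (measurable_traceKernel ω t).comp measurable_swap

/-- The Schur bounds are `1/t` and `2`, and their product is at most the square of their sum. The
bound is crude, but only its finiteness matters later. -/
theorem l2Bounded_traceKernel {ω t : ℝ} (hω : 0 < ω) (ht : 0 < t) :
    L2Bounded (traceKernel ω t) (ENNReal.ofReal (1 / t) + 2) := by
  refine L2Bounded.of_schur (measurable_traceKernel ω t) (measurable_traceKernel ω t)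
    (fun z x => (sq _).le) (fun z => lintegral_heatKernel_diag_le hω ht z)
    (C₂ := 2) (fun u => ?_) ?_
  · simp only [traceKernel, heatKernel_comm ω t _ (u, u)]
    exact lintegral_heatKernel_le hω ht _
  · rw [sq]
    gcongr
    · exact le_self_add
    · exact le_add_self

theorem l2Bounded_traceKernel_swap {ω t : ℝ} (hω : 0 < ω) (ht : 0 < t) :
    L2Bounded (fun u z => traceKernel ω t z u) (ENNReal.ofReal (1 / t) + 2) := by
  refine L2Bounded.of_schur (C₁ := 2) (measurable_traceKernel_swap ω t)
    (measurable_traceKernel_swap ω t)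
    (fun z x => (sq _).le) (fun u => ?_) (fun z => lintegral_heatKernel_diag_le hω ht z) ?_
  · simp only [traceKernel, heatKernel_comm ω t _ (u, u)]
    exact lintegral_heatKernel_le hω ht _
  · rw [sq, mul_comm]
    gcongr
    · exact le_self_add
    · exact le_add_self

theorem mehler_comm (κ s : ℝ) (u v : Plane) : mehler κ s u v = mehler κ s v u := by
  rw [mehler, mehler, gaussKernel_comm]

theorem l2Bounded_mehler {κ s : ℝ} (hκ : 0 < κ) (hs : 0 < s) :
    L2Bounded (fun u v => ENNReal.ofReal (mehler κ s u v)) 1 := by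
  have h : ∀ u, ∫⁻ v, ENNReal.ofReal (mehler κ s u v) ≤ 1 := fun u => by
    refine (lintegral_mehler_le hκ hs u).trans ?_
    rw [← ENNReal.ofReal_one]
    exact ENNReal.ofReal_le_ofReal ((div_le_one (Real.cosh_pos s)).2 (Real.one_le_cosh s))
  refine L2Bounded.of_schur (measurable_mehler κ s) (measurable_mehler κ s)
    (fun z x => (sq _).le) h (fun u => ?_) (C₂ := 1) (by simp)
  simp only [mehler_comm κ s _ u]
  exact h u

theorem exists_mehlerOp {κ s : ℝ} (hκ : 0 < κ) (hs : 0 < s) :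
    ∃ M : L2Plane →L[ℂ] L2Plane, IsKernelOp (fun u v => ENNReal.ofReal (mehler κ s u v)) M :=
  (l2Bounded_mehler hκ hs).exists_isKernelOp (measurable_mehler κ s) ENNReal.one_ne_top

theorem isKernelOp_mehler_pow {κ s : ℝ} (hκ : 0 < κ) (hs : 0 < s) {M : L2Plane →L[ℂ] L2Plane}
    (hM : IsKernelOp (fun u v => ENNReal.ofReal (mehler κ s u v)) M) (n : ℕ) :
    IsKernelOp (fun u v => ENNReal.ofReal (mehler κ ((n + 1 : ℕ) * s) u v)) (M ^ (n + 1)) := by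
  induction n with
  | zero => simpa using hM
  | succ n ih =>
    have hpos : 0 < ((n + 1 : ℕ) : ℝ) * s := by positivity
    rw [pow_succ]
    refine IsKernelOp.comp (measurable_mehler κ _) (measurable_mehler κ s)
      (l2Bounded_mehler hκ hpos) (l2Bounded_mehler hκ hs) ENNReal.one_ne_top ENNReal.one_ne_top
      ih hM fun u w => ?_
    rw [lintegral_mehler_mul hκ hpos hs]
    congr 2
    push_cast
    ring

theorem adjoint_mehlerOp {κ s : ℝ} (hκ : 0 < κ) (hs : 0 < s) {M : L2Plane →L[ℂ] L2Plane}
    (hM : IsKernelOp (fun u v => ENNReal.ofReal (mehler κ s u v)) M) :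
    ContinuousLinearMap.adjoint M = M :=
  hM.adjoint_eq (measurable_mehler κ s) (l2Bounded_mehler hκ hs) ENNReal.one_ne_top
    (by simpa only [mehler_comm κ s] using hM)

theorem gelfandLE_mehlerOp {κ s ε : ℝ} (hκ : 0 < κ) (hs : 0 < s) (hε : 0 < ε)
    {M : L2Plane →L[ℂ] L2Plane}
    (hM : IsKernelOp (fun u v => ENNReal.ofReal (mehler κ s u v)) M) :
    GelfandLE M ⌊1 / (4 * sinh s ^ 2) / ε ^ 2⌋₊ ε :=
  gelfandLE_of_sum_sq_le hε (hM.sum_norm_sq_le (measurable_mehler κ s) (by positivity)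
    (lintegral_mehler_sq hκ hs).le)

/-- `‖R f‖² = ⟨f, R* R f⟩ = c ⟨f, M^(2m) f⟩ = c ‖M^m f‖²`, since `M` is self-adjoint. -/
theorem norm_sq_of_adjoint_comp_eq_pow {H K : Type*} [NormedAddCommGroup H]
    [InnerProductSpace ℂ H] [CompleteSpace H] [NormedAddCommGroup K] [InnerProductSpace ℂ K]
    [CompleteSpace K] {R : H →L[ℂ] K} {M : H →L[ℂ] H} {c : ℝ} {m : ℕ}
    (hM : ContinuousLinearMap.adjoint M = M)
    (hR : ContinuousLinearMap.adjoint R ∘L R = (c : ℂ) • M ^ (m + m)) (f : H) :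
    ‖R f‖ ^ 2 = c * ‖(M ^ m) f‖ ^ 2 := by
  have hMm : ContinuousLinearMap.adjoint (M ^ m) = M ^ m := by
    rw [← ContinuousLinearMap.star_eq_adjoint] at hM ⊢
    rw [star_pow, hM]
  have h1 : ‖R f‖ ^ 2 = RCLike.re (inner ℂ f ((ContinuousLinearMap.adjoint R ∘L R) f)) := by
    rw [ContinuousLinearMap.comp_apply, ContinuousLinearMap.adjoint_inner_right,
      inner_self_eq_norm_sq (𝕜 := ℂ)]
  have h2 : ‖(M ^ m) f‖ ^ 2 = RCLike.re (inner ℂ f ((M ^ (m + m)) f)) := by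
    rw [pow_add, mul_apply_eq_comp, ← inner_self_eq_norm_sq (𝕜 := ℂ)]
    nth_rewrite 1 [← hMm]
    rw [ContinuousLinearMap.adjoint_inner_left]
  rw [h1, hR, h2, smul_apply, inner_smul_right]
  exact Complex.re_ofReal_mul _ _

/-- A trace of the heat semigroup has the Gelfand numbers of a power of a Mehler operator. -/
theorem exists_mehlerOp_norm_sq {ω δ : ℝ} (hω : 0 < ω) (hδ : 0 < δ) {m : ℕ} (hm : 0 < m)
    {R : L2Plane →L[ℂ] L2Config} (hR : IsKernelOp (traceKernel ω δ) R) :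
    ∃ (c κ s : ℝ) (M : L2Plane →L[ℂ] L2Plane), 0 ≤ c ∧ 0 < κ ∧ 0 < s ∧
      c ≤ exp (ω * (δ + δ)) / (δ + δ) ∧ ω * δ ≤ sinh s ∧
      IsKernelOp (fun u v => ENNReal.ofReal (mehler κ (s / (2 * m)) u v)) M ∧
      ∀ f, ‖R f‖ ^ 2 = c * ‖(M ^ m) f‖ ^ 2 := by
  -- The time is `δ + δ` because `R* R` composes two heat kernels of time `δ`. The Mehler operator
  -- `M` has time `s / (2m)`, so that `M ^ (m + m)` has time `s`.
  obtain ⟨c, κ, s, hc, hκ, hs, hcle, hsle, hker⟩ :=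
    exists_heatKernel_diag_eq_mehler hω (add_pos hδ hδ)
  have hm0 : (0 : ℝ) < m := by exact_mod_cast hm
  have hs' : 0 < s / (2 * m) := by positivity
  obtain ⟨M, hM⟩ := exists_mehlerOp hκ hs'
  refine ⟨c, κ, s, M, hc, hκ, hs, hcle, by linarith, hM, fun f => ?_⟩
  refine norm_sq_of_adjoint_comp_eq_pow (adjoint_mehlerOp hκ hs' hM) ?_ f
  have htop : ENNReal.ofReal (1 / δ) + 2 ≠ ∞ := by simp
  obtain ⟨B, hB⟩ := (l2Bounded_traceKernel_swap hω hδ).exists_isKernelOp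
    (measurable_traceKernel_swap ω δ) htop
  rw [hR.adjoint_eq (measurable_traceKernel ω δ) (l2Bounded_traceKernel hω hδ) htop hB]
  have h1 : IsKernelOp (fun u v => ENNReal.ofReal c * ENNReal.ofReal (mehler κ s u v)) (B ∘L R) := by
    refine IsKernelOp.comp (measurable_traceKernel_swap ω δ)
      (measurable_traceKernel ω δ) (l2Bounded_traceKernel_swap hω hδ)
      (l2Bounded_traceKernel hω hδ) htop htop hB hR fun u v => ?_
    simp only [traceKernel, heatKernel_comm ω δ _ (u, u)]
    rw [lintegral_heatKernel_mul hω hδ hδ, hker, ENNReal.ofReal_mul hc]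
  have h2 : IsKernelOp (fun u v => ENNReal.ofReal (mehler κ s u v)) (M ^ (m + m)) := by
    have h3 := isKernelOp_mehler_pow hκ hs' hM (m + m - 1)
    have h4 : m + m - 1 + 1 = m + m := by omega
    rw [h4] at h3
    have h5 : ((m + m : ℕ) : ℝ) * (s / (2 * m)) = s := by
      push_cast
      field_simp
      ring
    rwa [h5] at h3
  exact h1.unique (h2.const_smul hc fun u v => rfl)

theorem sinh_le_two_mul {s : ℝ} (hs : 0 ≤ s) (hs1 : s ≤ 1) : sinh s ≤ 2 * s := by
  have h1 := (abs_le.1 (Real.abs_exp_sub_one_sub_id_le (x := s) (by rwa [abs_of_nonneg hs]))).2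
  have h2 := Real.add_one_le_exp (-s)
  rw [Real.sinh_eq]
  nlinarith

/-- For `s ≤ 1`, `sinh s ≤ 2 s` gives `s ≥ ω δ / 2`; for `s ≥ 1`, already `s ≥ δ`. -/
theorem min_mul_le_of_le_sinh {ω δ s : ℝ} (hδ : 0 < δ) (hδ1 : δ ≤ 1) (hs : 0 < s)
    (h : ω * δ ≤ sinh s) : min 1 (ω / 2) * δ ≤ s := by
  rcases le_total s 1 with hs1 | hs1
  · have := sinh_le_two_mul hs.le hs1
    calc min 1 (ω / 2) * δ ≤ ω / 2 * δ := by gcongr; exact min_le_right _ _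
      _ ≤ s := by linarith
  · calc min 1 (ω / 2) * δ ≤ 1 * 1 := by gcongr; exact min_le_left _ _
      _ ≤ s := by linarith

/-- Gelfand numbers of the traces of the heat semigroup, uniformly for small times. -/
theorem gelfandLE_traceOp {ω : ℝ} (hω : 0 < ω) (k : ℕ) {τ : ℝ} (hτ : 0 < τ) :
    ∃ C : ℝ, 0 < C ∧ ∀ δ : ℝ, 0 < δ → δ ≤ 1 → ∀ R : L2Plane →L[ℂ] L2Config,
      IsKernelOp (traceKernel ω δ) R →
      ∃ n : ℕ, GelfandLE R n (C * δ ^ (k + 1 / 2 : ℝ)) ∧ (n : ℝ) ≤ C * δ ^ (-(2 + τ)) := by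
  -- The count of conditions will be of order `δ^(-2 - 2(k+1)/m)`; this `m` makes the excess
  -- `2(k+1)/m` smaller than `τ`.
  obtain ⟨m, hm⟩ := exists_nat_gt (2 * (k + 1) / τ)
  have hm0 : (0 : ℝ) < m := lt_of_le_of_lt (by positivity) hm
  have hmpos : 0 < m := by exact_mod_cast hm0
  set a := min 1 (ω / 2) with ha
  have ha0 : 0 < a := by positivity
  refine ⟨max (exp ω) (m ^ 3 / a ^ 2), by positivity, fun δ hδ hδ1 R hR => ?_⟩
  obtain ⟨c, κ, s, M, hc, hκ, hs, hcle, hsle, hM, hRM⟩ := exists_mehlerOp_norm_sq hω hδ hmpos hR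
  -- Chosen so that `ε ^ m = δ^(k+1)`; the factor `√c`, of order `δ^(-1/2)`, then leaves
  -- `δ^(k+1/2)`.
  set ε : ℝ := δ ^ ((k + 1) / m : ℝ) with hε
  have hε0 : 0 < ε := by positivity
  have hεm : ε ^ m = δ ^ (k + 1 : ℝ) := by
    rw [hε, ← Real.rpow_natCast, ← Real.rpow_mul hδ.le, div_mul_cancel₀ _ hm0.ne']
  have hs' : 0 < s / (2 * m) := by positivity
  have hG := (gelfandLE_mehlerOp hκ hs' hε0 hM).pow hε0.le m
  have hRle : ∀ f, ‖R f‖ ≤ √c * ‖(M ^ m) f‖ := fun f => by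
    rw [← pow_le_pow_iff_left₀ (norm_nonneg _) (by positivity) two_ne_zero, hRM, mul_pow,
      Real.sq_sqrt hc]
  have hG2 := hG.of_norm_le (Real.sqrt_nonneg c) hRle
  refine ⟨_, hG2.mono le_rfl ?_, ?_⟩
  · rw [hεm]
    have h1 : √c ≤ exp ω * δ ^ (-1 / 2 : ℝ) := by
      have h2 : c ≤ (exp ω * δ ^ (-1 / 2 : ℝ)) ^ 2 := by
        have h3 : (δ ^ (-1 / 2 : ℝ)) ^ 2 = 1 / δ := by
          rw [← Real.rpow_natCast, ← Real.rpow_mul hδ.le]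
          norm_num
          rw [Real.rpow_neg_one]
        rw [mul_pow, h3, ← Real.exp_nat_mul]
        calc c ≤ exp (ω * (δ + δ)) / (δ + δ) := hcle
          _ ≤ exp (ω * (1 + 1)) / δ := by gcongr; linarith
          _ = _ := by
              rw [mul_one_div]
              congr 2
              push_cast
              ring
      exact Real.sqrt_le_iff.2 ⟨by positivity, h2⟩
    calc √c * δ ^ (k + 1 : ℝ) ≤ exp ω * δ ^ (-1 / 2 : ℝ) * δ ^ (k + 1 : ℝ) := by gcongr
      _ = exp ω * δ ^ (k + 1 / 2 : ℝ) := by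
          rw [mul_assoc, ← Real.rpow_add hδ]
          congr 2
          ring
      _ ≤ _ := by gcongr; exact le_max_left _ _
  -- Bounds the squared Hilbert–Schmidt norm of `M` by a multiple of `δ⁻²`; the threshold `ε`
  -- contributes a further `ε⁻²`, and the power `m` a factor `m`.
  · have hsa : a * δ / (2 * m) ≤ sinh (s / (2 * m)) :=
      calc a * δ / (2 * m) ≤ s / (2 * m) := by
            gcongr
            exact min_mul_le_of_le_sinh hδ hδ1 hs hsle
        _ ≤ sinh (s / (2 * m)) := Real.self_le_sinh_iff.2 hs'.le
    push_cast
    calc (m : ℝ) * (⌊1 / (4 * sinh (s / (2 * m)) ^ 2) / ε ^ 2⌋₊ : ℝ)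
        ≤ m * (1 / (4 * sinh (s / (2 * m)) ^ 2) / ε ^ 2) := by
          gcongr
          exact Nat.floor_le (by positivity)
      _ ≤ m * (1 / (4 * (a * δ / (2 * m)) ^ 2) / ε ^ 2) := by gcongr
      _ = m ^ 3 / a ^ 2 * (δ ^ 2 * ε ^ 2)⁻¹ := by
          field_simp
          ring
      _ ≤ m ^ 3 / a ^ 2 * δ ^ (-(2 + τ)) := by
          gcongr
          have h1 : δ ^ 2 * ε ^ 2 = δ ^ (2 + 2 * (k + 1) / m : ℝ) := by
            rw [hε, ← Real.rpow_natCast δ 2, ← Real.rpow_natCast _ 2, ← Real.rpow_mul hδ.le,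
              ← Real.rpow_add hδ]
            congr 1
            push_cast
            ring
          rw [h1, ← Real.rpow_neg hδ.le]
          apply Real.rpow_le_rpow_of_exponent_ge hδ hδ1
          have h2 : 2 * ((k : ℝ) + 1) / m < τ := by
            rw [div_lt_iff₀ hτ] at hm
            rw [div_lt_iff₀ hm0]
            linarith
          linarith
      _ ≤ _ := by gcongr; exact le_max_right _ _

end Singular

/-! ### Splitting at time δ and the Schatten bound -/

section Schatten
open scoped ENNReal
open Real (exp sinh cosh)

attribute [local irreducible] heatKernel mehler

/-- Splitting `∫₀^∞` at time `δ`: the tail factors through the trace of `exp(-δ H₀)`. -/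
theorem diagKernel_indicator_Ioi {ω : ℝ} (hω : 0 < ω) {φ : ℝ → ℝ≥0∞} (hφ : Measurable φ)
    {δ : ℝ} (hδ : 0 < δ) (z : Config) (u : Plane) :
    diagKernel ω ((Set.Ioi δ).indicator φ) z u =
      ∫⁻ y, timeKernel ω (fun s => φ (s + δ)) z y * traceKernel ω δ y u := by
  have h := lintegral_timeKernel_mul_heatKernel hω
    (hφ.comp (measurable_id.add_const δ)) hδ z (u, u)
  have h2 := setLIntegral_Ioi_add (fun t => φ t * ENNReal.ofReal (heatKernel ω t z (u, u))) δ
  refine Eq.trans ?_ (h2.symm.trans h.symm)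
  rw [diagKernel, timeKernel, ← lintegral_indicator measurableSet_Ioi,
    ← lintegral_indicator measurableSet_Ioi]
  refine lintegral_congr fun t => ?_
  by_cases h1 : δ < t
  · simp [Set.indicator, h1, hδ.trans h1]
  · simp [Set.indicator, h1]

theorem diagKernel_eq_add (ω : ℝ) {φ : ℝ → ℝ≥0∞} (hφ : Measurable φ) (δ : ℝ)
    (z : Config) (u : Plane) :
    diagKernel ω φ z u = diagKernel ω ((Set.Ioi δ).indicator φ) z u +
      diagKernel ω ((Set.Iic δ).indicator φ) z u := by
  have h1 : Measurable fun t => (Set.Ioi δ).indicator φ t *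
      ENNReal.ofReal (heatKernel ω t z (u, u)) :=
    (hφ.indicator measurableSet_Ioi).mul (measurable_heatKernel_time ω z (u, u))
  rw [diagKernel, diagKernel, diagKernel, timeKernel, timeKernel, timeKernel,
    ← lintegral_add_left h1]
  refine lintegral_congr fun t => ?_
  by_cases h : t ≤ δ
  · simp [Set.indicator, h, not_lt.2 h]
  · simp [Set.indicator, h, not_le.1 h]

theorem lintegral_timeWeight_ne_top {lam : ℝ} (hlam : 0 < lam) (k : ℕ) :
    2 * ∫⁻ t in Set.Ioi (0 : ℝ), timeWeight lam k t ≠ ∞ :=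
  ENNReal.mul_ne_top (by norm_num) (lintegral_timeWeight_lt_top hlam k).ne

theorem lintegral_timeWeight_div_sqrt_ne_top {lam : ℝ} (hlam : 0 < lam) (k : ℕ) :
    2 * ∫⁻ t in Set.Ioi (0 : ℝ), timeWeight lam k t * ENNReal.ofReal (1 / √t) ≠ ∞ :=
  ENNReal.mul_ne_top (by norm_num) (lintegral_timeWeight_div_sqrt_lt_top hlam k).ne

/-- The long-time part is `B ∘ R` with `‖B‖` bounded uniformly in `δ`, so it inherits the Gelfand
numbers of `R`. The short-time part is already of the target size in norm and needs no conditions.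
-/
theorem gelfandLE_diagOp {ω lam : ℝ} (hω : 0 < ω) (hlam : 0 < lam) (k : ℕ) {τ : ℝ} (hτ : 0 < τ)
    {Q : L2Plane →L[ℂ] L2Config} (hQ : IsKernelOp (diagKernel ω (timeWeight lam k)) Q) :
    ∃ C : ℝ, 0 < C ∧ ∀ δ : ℝ, 0 < δ → δ ≤ 1 →
      ∃ n : ℕ, GelfandLE Q n (C * δ ^ (k + 1 / 2 : ℝ)) ∧ (n : ℝ) ≤ C * δ ^ (-(2 + τ)) := by
  obtain ⟨C, hC, hR⟩ := gelfandLE_traceOp hω k hτ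
  set φ := timeWeight lam k with hφdef
  have hφ : Measurable φ := measurable_timeWeight lam k
  set W := (2 * ∫⁻ t in Set.Ioi (0 : ℝ), φ t).toReal with hW
  have hWtop := lintegral_timeWeight_ne_top hlam k
  have hW0 : 0 ≤ W := ENNReal.toReal_nonneg
  -- `W * C` comes from `B ∘ R`, `4` from the short times, and the last `C` bounds the number of
  -- conditions.
  refine ⟨W * C + 4 + C, by positivity, fun δ hδ hδ1 => ?_⟩
  have htop : ENNReal.ofReal (1 / δ) + 2 ≠ ∞ := by simp
  obtain ⟨R, hRk⟩ := (l2Bounded_traceKernel hω hδ).exists_isKernelOp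
    (measurable_traceKernel ω δ) htop
  obtain ⟨n, hn, hnC⟩ := hR δ hδ hδ1 R hRk
  have hφδ : Measurable fun s => φ (s + δ) := hφ.comp (measurable_id.add_const δ)
  have hBb : L2Bounded (timeKernel ω fun s => φ (s + δ)) (ENNReal.ofReal W) := by
    refine (l2Bounded_timeKernel hω hφδ).mono ?_
    rw [hW, ENNReal.ofReal_toReal hWtop]
    refine mul_le_mul_right ?_ 2
    rw [setLIntegral_Ioi_add]
    exact lintegral_mono_set (Set.Ioi_subset_Ioi hδ.le)
  obtain ⟨B, hB⟩ := hBb.exists_isKernelOp (measurable_timeKernel ω hφδ) ENNReal.ofReal_ne_top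
  have hBn := hB.norm_le hW0 hBb
  have hBR := IsKernelOp.comp (measurable_timeKernel ω hφδ) (measurable_traceKernel ω δ) hBb
    (l2Bounded_traceKernel hω hδ) ENNReal.ofReal_ne_top htop hB hRk
    (diagKernel_indicator_Ioi hω hφ hδ)
  have hBRb := L2Bounded.comp (measurable_timeKernel ω hφδ) (measurable_traceKernel ω δ) hBb
    (l2Bounded_traceKernel hω hδ) (diagKernel_indicator_Ioi hω hφ hδ)
  have hIic : Measurable ((Set.Iic δ).indicator φ) := hφ.indicator measurableSet_Iic
  have hSb : L2Bounded (diagKernel ω ((Set.Iic δ).indicator φ))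
      (ENNReal.ofReal (4 * δ ^ (k + 1 / 2 : ℝ))) := by
    refine (l2Bounded_diagKernel hω hIic).mono ?_
    calc _ = 2 * ∫⁻ t in Set.Ioc 0 δ, φ t * ENNReal.ofReal (1 / √t) := by
          congr 1
          rw [← lintegral_indicator measurableSet_Ioi, ← lintegral_indicator measurableSet_Ioc]
          refine lintegral_congr fun t => ?_
          by_cases h1 : 0 < t <;> by_cases h2 : t ≤ δ <;> simp [Set.indicator, h1, h2]
      _ ≤ 2 * ENNReal.ofReal (2 * δ ^ (k + 1 / 2 : ℝ)) := by
          gcongr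
          exact lintegral_timeWeight_div_sqrt_Ioc_le hlam k hδ
      _ = ENNReal.ofReal (4 * δ ^ (k + 1 / 2 : ℝ)) := by
          rw [show (2 : ℝ≥0∞) = ENNReal.ofReal 2 by norm_num, ← ENNReal.ofReal_mul (by norm_num)]
          ring_nf
  obtain ⟨S, hS⟩ := hSb.exists_isKernelOp (measurable_diagKernel ω hIic) ENNReal.ofReal_ne_top
  have hSn := hS.norm_le (by positivity) hSb
  have hsum := IsKernelOp.add (measurable_diagKernel ω (hφ.indicator measurableSet_Ioi))
    (measurable_diagKernel ω hIic) hBRb hSb (ENNReal.mul_ne_top ENNReal.ofReal_ne_top htop)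
    ENNReal.ofReal_ne_top hBR hS (diagKernel_eq_add ω hφ δ)
  rw [hQ.unique hsum]
  have hG := (hn.of_norm_le (A := B ∘L R) hW0 fun x => B.le_of_opNorm_le hBn (R x)).add_of_norm_le hSn
  refine ⟨n, hG.mono le_rfl ?_, hnC.trans ?_⟩
  · have : 0 ≤ C * δ ^ (k + 1 / 2 : ℝ) := by positivity
    nlinarith
  · gcongr
    nlinarith [mul_nonneg hW0 hC.le]

/-- `G^k Pot` is the integral operator with weight `t^k e^{-λt} / k!`. -/
theorem isKernelOp_pow_comp {ω lam : ℝ} (hω : 0 < ω) (hlam : 0 < lam)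
    {G : L2Config →L[ℂ] L2Config} {Pot : L2Plane →L[ℂ] L2Config}
    (hG : IsKernelOp (timeKernel ω (timeWeight lam 0)) G)
    (hP : IsKernelOp (diagKernel ω (timeWeight lam 0)) Pot) (k : ℕ) :
    IsKernelOp (diagKernel ω (timeWeight lam k)) ((G ^ k) ∘L Pot) := by
  induction k with
  | zero => exact hP
  | succ k ih =>
    have h := IsKernelOp.comp (measurable_timeKernel ω (measurable_timeWeight lam 0))
      (measurable_diagKernel ω (measurable_timeWeight lam k))
      (l2Bounded_timeKernel hω (measurable_timeWeight lam 0))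
      (l2Bounded_diagKernel hω (measurable_timeWeight lam k))
      (lintegral_timeWeight_ne_top hlam 0) (lintegral_timeWeight_div_sqrt_ne_top hlam k) hG ih
      (m := diagKernel ω (timeWeight lam (k + 1))) fun z u =>
        (lintegral_timeKernel_mul hω (measurable_timeWeight lam 0) (measurable_timeWeight lam k)
          (fun u hu => timeWeight_convolution lam k hu) z (u, u)).symm
    rw [pow_succ']
    exact h

/-- `Pot` (weight index `0`) and `G ^ k ∘ Pot` (index `k`) are handled at the same cut-off `δ`;
their bounds `δ^(1/2)` and `δ^(k+1/2)` multiply while the numbers of conditions add. -/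
theorem isSchatten_adjoint_comp {ω lam : ℝ} (hω : 0 < ω) (hlam : 0 < lam)
    {G : L2Config →L[ℂ] L2Config} {Pot : L2Plane →L[ℂ] L2Config}
    (hG : IsKernelOp (timeKernel ω (timeWeight lam 0)) G)
    (hP : IsKernelOp (diagKernel ω (timeWeight lam 0)) Pot) (k : ℕ) {p : ℝ}
    (hp : 2 / ((k : ℝ) + 1) < p) :
    IsSchatten p (ContinuousLinearMap.adjoint Pot ∘L (G ^ k) ∘L Pot) := by
  have hk : (0 : ℝ) < k + 1 := by positivity
  rw [div_lt_iff₀ hk] at hp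
  -- Half of the room in `p (k + 1) > 2`, so that `q = (2 + τ) / (k + 1)` stays strictly below `p`.
  set τ : ℝ := (p * (k + 1) - 2) / 2 with hτ
  have hτ0 : 0 < τ := by rw [hτ]; linarith
  obtain ⟨C₀, hC₀, h₀⟩ := gelfandLE_diagOp hω hlam 0 hτ0 hP
  obtain ⟨C₁, hC₁, h₁⟩ := gelfandLE_diagOp hω hlam k hτ0 (isKernelOp_pow_comp hω hlam hG hP k)
  set D : ℝ := max (C₀ * C₁) 1 with hD
  have hD1 : 1 ≤ D := le_max_right _ _
  have hD0 : 0 < D := by positivity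
  set q : ℝ := (2 + τ) / (k + 1) with hq
  refine isSchatten_of_gelfandLE (q := q) (C := (C₀ + C₁) * D ^ q) (by positivity) ?_ ?_
  · rw [hq, div_lt_iff₀ hk]
    linarith
  intro ε hε hε1
  -- Solves `D δ^(k+1) = ε`. The maximum with `1` in `D` ensures `δ ≤ 1`.
  set δ : ℝ := (ε / D) ^ (1 / (k + 1) : ℝ) with hδ
  have hεD : 0 < ε / D := by positivity
  have hδ0 : 0 < δ := by positivity
  have hδ1 : δ ≤ 1 := Real.rpow_le_one hεD.le
    ((div_le_one hD0).2 (hε1.trans hD1)) (by positivity)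
  have hδk : δ ^ (k + 1 : ℝ) = ε / D := by
    rw [hδ, ← Real.rpow_mul hεD.le, one_div_mul_cancel hk.ne', Real.rpow_one]
  obtain ⟨n₀, hn₀, hn₀C⟩ := h₀ δ hδ0 hδ1
  obtain ⟨n₁, hn₁, hn₁C⟩ := h₁ δ hδ0 hδ1
  refine ⟨n₀ + n₁, (hn₀.adjoint_comp (by positivity) (by positivity) hn₁).mono le_rfl ?_, ?_⟩
  · calc C₀ * δ ^ ((0 : ℕ) + 1 / 2 : ℝ) * (C₁ * δ ^ (k + 1 / 2 : ℝ))
        = C₀ * C₁ * δ ^ (k + 1 : ℝ) := by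
          rw [mul_mul_mul_comm, ← Real.rpow_add hδ0]
          congr 2
          push_cast
          ring
      _ ≤ D * (ε / D) := by
          rw [hδk]
          gcongr
          exact le_max_left _ _
      _ = ε := by field_simp
  · have h2 : δ ^ (-(2 + τ)) = D ^ q * ε ^ (-q) := by
      rw [hδ, ← Real.rpow_mul hεD.le, show 1 / ((k : ℝ) + 1) * -(2 + τ) = -q by rw [hq]; ring,
        Real.div_rpow hε.le hD0.le, Real.rpow_neg hD0.le q, div_inv_eq_mul, mul_comm]
    rw [h2] at hn₀C hn₁C
    push_cast
    linarith

end Schatten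

/-! ### The Green function as a Laplace transform -/

section Green
open scoped ENNReal
open Real (exp sinh cosh)

theorem mehler_eq {κ s : ℝ} (u v : Plane) :
    mehler κ s u v = κ / (2 * Real.pi * sinh s) *
      exp (-(κ / 2 * ((cosh s - 1) / sinh s)) * (‖u‖ ^ 2 + ‖v‖ ^ 2)
        - κ / (2 * sinh s) * ‖u - v‖ ^ 2) := by
  rw [mehler, gaussKernel, norm_sub_sq_real]
  congr 2
  ring

theorem image_exp_neg_mul_Ioi {ω : ℝ} (hω : 0 < ω) :
    (fun t : ℝ => exp (-ω * t)) '' Set.Ioi 0 = Set.Ioo 0 1 := by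
  ext ν
  constructor
  · rintro ⟨t, ht, rfl⟩
    refine ⟨Real.exp_pos _, Real.exp_lt_one_iff.2 ?_⟩
    have := mul_pos hω (Set.mem_Ioi.1 ht)
    linarith
  · rintro ⟨h0, h1⟩
    refine ⟨-Real.log ν / ω, div_pos (neg_pos.2 (Real.log_neg h0 h1)) hω, ?_⟩
    have : -ω * (-Real.log ν / ω) = Real.log ν := by field_simp
    simp only [this, Real.exp_log h0]

/-- The Green function is the Laplace transform of the heat kernel. -/
theorem greenKernel_eq_integral {ω : ℝ} (hω : 0 < ω) (lam : ℝ) (z w : Config) :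
    greenKernel ω lam z w = ∫ t in Set.Ioi (0 : ℝ), exp (-lam * t) * heatKernel ω t z w := by
  -- Change of variables `ν = exp(-ω t)`, under which `ln (1/ν) = ω t` and `sinh`, `cosh` of `ω t`
  -- are rational in `ν`.
  rw [greenKernel, ← image_exp_neg_mul_Ioi hω,
    integral_image_eq_integral_abs_deriv_smul measurableSet_Ioi
      (f' := fun t => exp (-ω * t) * (-ω)) (fun t _ => ?_) (fun a _ b _ hab => ?_),
    ← integral_const_mul]
  · refine setIntegral_congr_fun measurableSet_Ioi fun t ht => ?_
    have ht0 : 0 < t := ht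
    have hpi := Real.pi_pos
    set ν := exp (-ω * t) with hν
    have hν0 : 0 < ν := Real.exp_pos _
    have hν1 : ν < 1 := Real.exp_lt_one_iff.2 (by nlinarith)
    have hlog : Real.log (1 / ν) = ω * t := by
      rw [one_div, Real.log_inv, hν, Real.log_exp]
      ring
    have hpow : ν ^ (lam / ω - 1) = exp (-lam * t) / ν := by
      rw [Real.rpow_sub hν0, Real.rpow_one, hν, ← Real.exp_mul]
      congr 2
      field_simp
    have hinv : exp (ω * t) = 1 / ν := by
      rw [hν, one_div, ← Real.exp_neg]
      ring_nf
    have hinv' : exp (-(ω * t)) = ν := by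
      rw [hν]
      ring_nf
    have h1ν : 0 < 1 - ν ^ 2 := by nlinarith
    have hsinh : sinh (ω * t) = (1 - ν ^ 2) / (2 * ν) := by
      rw [Real.sinh_eq, hinv, hinv']
      field_simp
    have hcosh : cosh (ω * t) = (1 + ν ^ 2) / (2 * ν) := by
      rw [Real.cosh_eq, hinv, hinv']
      field_simp
    have habs : |ν * -ω| = ν * ω := by
      rw [abs_mul, abs_neg, abs_of_pos hν0, abs_of_pos hω]
    rw [habs, smul_eq_mul, hlog, hpow, heatKernel, planeHeat_eq, mehler_eq, hsinh, hcosh, hinv]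
    have hE : exp (-(ω / 2) * ((1 - ν) / (1 + ν)) * (‖z.2‖ ^ 2 + ‖w.2‖ ^ 2)
        - ω / (2 * (ω * t)) * ‖z.1 - w.1‖ ^ 2 - ω * ν / (1 - ν ^ 2) * ‖z.2 - w.2‖ ^ 2) =
        exp (-(1 / (2 * t)) * ‖z.1 - w.1‖ ^ 2) *
        exp (-(ω / 2 * (((1 + ν ^ 2) / (2 * ν) - 1) / ((1 - ν ^ 2) / (2 * ν)))) *
          (‖z.2‖ ^ 2 + ‖w.2‖ ^ 2) - ω / (2 * ((1 - ν ^ 2) / (2 * ν))) * ‖z.2 - w.2‖ ^ 2) := by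
      rw [← Real.exp_add]
      congr 1
      have e1 : ((1 + ν ^ 2) / (2 * ν) - 1) / ((1 - ν ^ 2) / (2 * ν)) = (1 - ν) / (1 + ν) := by
        rw [div_eq_div_iff (by positivity) (by positivity)]
        field_simp
        ring
      have e2 : ω / (2 * ((1 - ν ^ 2) / (2 * ν))) = ω * ν / (1 - ν ^ 2) := by field_simp
      have e3 : ω / (2 * (ω * t)) = 1 / (2 * t) := by field_simp
      rw [e1, e2, e3]
      ring
    rw [hE]
    field_simp
  · have h := ((hasDerivAt_id t).const_mul (-ω)).exp
    simpa using h.hasDerivWithinAt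
  · have := Real.exp_injective hab
    exact mul_left_cancel₀ (neg_ne_zero.2 hω.ne') this

theorem timeWeight_zero (lam t : ℝ) : timeWeight lam 0 t = ENNReal.ofReal (exp (-lam * t)) := by
  simp [timeWeight]

/-- The integrand is nonnegative, so the two integrals agree. At `z = w` the integral diverges and
both sides take the value `0`. -/
theorem greenKernel_eq_toReal {ω : ℝ} (hω : 0 < ω) (lam : ℝ) (z w : Config) :
    greenKernel ω lam z w = (timeKernel ω (timeWeight lam 0) z w).toReal := by
  have hm : Measurable fun t => exp (-lam * t) * heatKernel ω t z w := by
    refine Measurable.mul (by fun_prop) ?_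
    exact (measurable_heatKernel ω).comp
      (g := fun q : ℝ × Config × Config => heatKernel ω q.1 q.2.1 q.2.2)
      (measurable_id.prodMk (measurable_const (a := (z, w))))
  rw [greenKernel_eq_integral hω, integral_eq_lintegral_of_nonneg_ae, timeKernel]
  · congr 1
    refine setLIntegral_congr_fun measurableSet_Ioi fun t ht => ?_
    rw [timeWeight_zero, ENNReal.ofReal_mul (Real.exp_pos _).le]
  · filter_upwards [ae_restrict_mem measurableSet_Ioi] with t ht
    exact mul_nonneg (Real.exp_pos _).le (heatKernel_nonneg hω ht z w)
  · exact hm.aestronglyMeasurable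

end Green

/-! ### Integration by parts and the Laplacian in coordinates -/

section Calculus
open scoped ENNReal
open Real (exp sinh cosh)

theorem isAddHaarMeasure_volume_config : (volume : Measure Config).IsAddHaarMeasure :=
  inferInstanceAs ((volume : Measure Plane).prod (volume : Measure Plane)).IsAddHaarMeasure

/-- The second derivative of `φ` in the direction `v`. -/
noncomputable def secondDeriv (φ : Config → ℂ) (v z : Config) : ℂ :=
  fderiv ℝ (fun y => fderiv ℝ φ y v) z v

variable {φ : Config → ℂ}

theorem contDiff_fderiv_apply (hφ : ContDiff ℝ ((⊤ : ℕ∞) : WithTop ℕ∞) φ) (v : Config) :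
    ContDiff ℝ ((⊤ : ℕ∞) : WithTop ℕ∞) fun y => fderiv ℝ φ y v :=
  (hφ.fderiv_right (by simp)).clm_apply contDiff_const

theorem continuous_secondDeriv (hφ : ContDiff ℝ ((⊤ : ℕ∞) : WithTop ℕ∞) φ) (v : Config) :
    Continuous (secondDeriv φ v) :=
  (contDiff_fderiv_apply (contDiff_fderiv_apply hφ v) v).continuous

theorem hasCompactSupport_secondDeriv (hs : HasCompactSupport φ) (v : Config) :
    HasCompactSupport (secondDeriv φ v) :=
  (hs.fderiv_apply ℝ v).fderiv_apply ℝ v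

/-- Integration by parts, twice in the direction `v`. -/
theorem integral_smul_secondDeriv (hφ : ContDiff ℝ ((⊤ : ℕ∞) : WithTop ℕ∞) φ)
    (hs : HasCompactSupport φ) {f f' f'' : Config → ℝ} {v : Config}
    (hf : ∀ z, HasLineDerivAt ℝ f (f' z) z v) (hf' : ∀ z, HasLineDerivAt ℝ f' (f'' z) z v)
    (hc : Continuous f) (hc' : Continuous f') (hc'' : Continuous f'') :
    ∫ z, f z • secondDeriv φ v z = ∫ z, f'' z • φ z := by
  have := isAddHaarMeasure_volume_config
  have hD := contDiff_fderiv_apply hφ v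
  have hDs := hs.fderiv_apply ℝ v
  have hφd : ∀ z, HasLineDerivAt ℝ φ (fderiv ℝ φ z v) z v := fun z =>
    ((hφ.differentiable (by simp)) z).hasFDerivAt.hasLineDerivAt v
  have hφd2 : ∀ z, HasLineDerivAt ℝ (fun y => fderiv ℝ φ y v) (secondDeriv φ v z) z v := fun z =>
    ((hD.differentiable (by simp)) z).hasFDerivAt.hasLineDerivAt v
  have hInt : ∀ (g : Config → ℝ) (ψ : Config → ℂ), Continuous g → Continuous ψ →
      HasCompactSupport ψ → Integrable fun z => g z • ψ z := fun g ψ hg hψ hψs =>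
    (hg.smul hψ).integrable_of_hasCompactSupport (hψs.smul_left)
  have h1 := integral_bilinear_hasLineDerivAt_right_eq_neg_left_of_integrable
    (μ := (volume : Measure Config)) (f := f) (f' := f') (g := fun y => fderiv ℝ φ y v)
    (g' := secondDeriv φ v) (v := v) (B := ContinuousLinearMap.lsmul ℝ ℝ (E := ℂ))
    (hInt _ _ hc' hD.continuous hDs)
    (hInt _ _ hc (continuous_secondDeriv hφ v) (hasCompactSupport_secondDeriv hs v))
    (hInt _ _ hc hD.continuous hDs) (fun z _ => hf z) (fun z _ => hφd2 z)
  have h2 := integral_bilinear_hasLineDerivAt_right_eq_neg_left_of_integrable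
    (μ := (volume : Measure Config)) (f := f') (f' := f'') (g := φ)
    (g' := fun y => fderiv ℝ φ y v) (v := v) (B := ContinuousLinearMap.lsmul ℝ ℝ (E := ℂ))
    (hInt _ _ hc'' hφ.continuous hs) (hInt _ _ hc' hD.continuous hDs)
    (hInt _ _ hc' hφ.continuous hs) (fun z _ => hf' z) (fun z _ => hφd z)
  simp only [ContinuousLinearMap.lsmul_apply] at h1 h2
  rw [h1, h2, neg_neg]

/-- The `i`-th coordinate direction of the first plane. -/
noncomputable def dirX (i : Fin 2) : Config := (EuclideanSpace.single i 1, 0)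

/-- The `i`-th coordinate direction of the second plane. -/
noncomputable def dirY (i : Fin 2) : Config := (0, EuclideanSpace.single i 1)

theorem fderiv_slice_fst {g : Config → ℂ} (hg : Differentiable ℝ g) (x y e : Plane) :
    fderiv ℝ (fun x => g (x, y)) x e = fderiv ℝ g (x, y) (e, 0) := by
  have h : HasFDerivAt (fun x : Plane => (x, y))
      ((ContinuousLinearMap.id ℝ Plane).prod (0 : Plane →L[ℝ] Plane)) x :=
    (hasFDerivAt_id x).prodMk (hasFDerivAt_const y x)
  have h2 := ((hg (x, y)).hasFDerivAt.comp x h).fderiv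
  have h3 : (g ∘ fun x : Plane => (x, y)) = fun x => g (x, y) := rfl
  rw [h3] at h2
  rw [h2]
  simp

theorem fderiv_slice_snd {g : Config → ℂ} (hg : Differentiable ℝ g) (x y e : Plane) :
    fderiv ℝ (fun y => g (x, y)) y e = fderiv ℝ g (x, y) (0, e) := by
  have h : HasFDerivAt (fun y : Plane => (x, y))
      ((0 : Plane →L[ℝ] Plane).prod (ContinuousLinearMap.id ℝ Plane)) y :=
    (hasFDerivAt_const x y).prodMk (hasFDerivAt_id y)
  have h2 := ((hg (x, y)).hasFDerivAt.comp y h).fderiv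
  have h3 : (g ∘ fun y : Plane => (x, y)) = fun y => g (x, y) := rfl
  rw [h3] at h2
  rw [h2]
  simp

theorem laplacian_eq_sum_fderiv {f : Plane → ℂ} (hf : ContDiff ℝ ((⊤ : ℕ∞) : WithTop ℕ∞) f)
    (x : Plane) :
    Laplacian.laplacian f x = ∑ i : Fin 2,
      fderiv ℝ (fun y => fderiv ℝ f y (EuclideanSpace.single i 1)) x (EuclideanSpace.single i 1) := by
  rw [InnerProductSpace.laplacian_eq_iteratedFDeriv_orthonormalBasis f
    (EuclideanSpace.basisFun (Fin 2) ℝ)]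
  refine Finset.sum_congr rfl fun i _ => ?_
  have hd : DifferentiableAt ℝ (fderiv ℝ f) x :=
    ((hf.fderiv_right (m := ((⊤ : ℕ∞) : WithTop ℕ∞)) (by simp)).differentiable (by simp)) x
  rw [iteratedFDeriv_two_apply, fderiv_clm_apply hd (differentiableAt_const _)]
  simp

theorem laplacian_slice_fst (hφ : ContDiff ℝ ((⊤ : ℕ∞) : WithTop ℕ∞) φ) (z : Config) :
    Laplacian.laplacian (fun x : Plane => φ (x, z.2)) z.1 = ∑ i, secondDeriv φ (dirX i) z := by
  rw [laplacian_eq_sum_fderiv (f := fun x : Plane => φ (x, z.2))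
    (hφ.comp (contDiff_id.prodMk contDiff_const))]
  refine Finset.sum_congr rfl fun i _ => ?_
  simp_rw [fderiv_slice_fst (hφ.differentiable (by simp))]
  exact fderiv_slice_fst ((contDiff_fderiv_apply hφ _).differentiable (by simp)) _ _ _

theorem laplacian_slice_snd (hφ : ContDiff ℝ ((⊤ : ℕ∞) : WithTop ℕ∞) φ) (z : Config) :
    Laplacian.laplacian (fun y : Plane => φ (z.1, y)) z.2 = ∑ i, secondDeriv φ (dirY i) z := by
  rw [laplacian_eq_sum_fderiv (f := fun y : Plane => φ (z.1, y))
    (hφ.comp (contDiff_const.prodMk contDiff_id))]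
  refine Finset.sum_congr rfl fun i _ => ?_
  simp_rw [fderiv_slice_snd (hφ.differentiable (by simp))]
  exact fderiv_slice_snd ((contDiff_fderiv_apply hφ _).differentiable (by simp)) _ _ _

theorem freeHamiltonian_eq (ω : ℝ) (hφ : ContDiff ℝ ((⊤ : ℕ∞) : WithTop ℕ∞) φ) (z : Config) :
    freeHamiltonian ω φ z = -(1 / 2 : ℂ) * ∑ i, secondDeriv φ (dirX i) z
      - (1 / 2 : ℂ) * ∑ i, secondDeriv φ (dirY i) z
      + ((ω ^ 2 * ‖z.2‖ ^ 2 / 2 - ω : ℝ) : ℂ) * φ z := by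
  rw [freeHamiltonian, laplacian_slice_fst hφ, laplacian_slice_snd hφ]

theorem continuous_freeHamiltonian (ω : ℝ) (hφ : ContDiff ℝ ((⊤ : ℕ∞) : WithTop ℕ∞) φ) :
    Continuous (freeHamiltonian ω φ) := by
  have h1 : ∀ v, Continuous fun z => secondDeriv φ v z := continuous_secondDeriv hφ
  have h2 := hφ.continuous
  rw [funext (freeHamiltonian_eq ω hφ)]
  fun_prop

theorem hasCompactSupport_freeHamiltonian (ω : ℝ) (hφ : ContDiff ℝ ((⊤ : ℕ∞) : WithTop ℕ∞) φ)
    (hs : HasCompactSupport φ) : HasCompactSupport (freeHamiltonian ω φ) := by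
  refine HasCompactSupport.of_support_subset_isCompact hs fun z hz => ?_
  by_contra hzn
  apply hz
  have hsd : ∀ v, secondDeriv φ v z = 0 := fun v => by
    have h1 : tsupport (secondDeriv φ v) ⊆ tsupport φ :=
      (tsupport_fderiv_apply_subset ℝ v).trans (tsupport_fderiv_apply_subset ℝ v)
    exact image_eq_zero_of_notMem_tsupport fun h => hzn (h1 h)
  rw [freeHamiltonian_eq ω hφ]
  simp [hsd, image_eq_zero_of_notMem_tsupport hzn]

theorem hasDerivAt_gaussKernel_line (c α β : ℝ) (u v e : Plane) :
    HasDerivAt (fun s : ℝ => gaussKernel c α β (u + s • e) v)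
      (gaussKernel c α β u v * (-2 * α * inner ℝ u e + 2 * β * inner ℝ e v)) 0 := by
  have h1 : HasDerivAt (fun s : ℝ => u + s • e) e 0 := by
    simpa using ((hasDerivAt_id (0 : ℝ)).smul_const e).const_add u
  have h2 : HasDerivAt (fun s : ℝ => ‖u + s • e‖ ^ 2) (2 * inner ℝ u e) 0 := by
    simpa using h1.norm_sq
  have h3 : HasDerivAt (fun s : ℝ => inner ℝ (u + s • e) v) (inner ℝ e v) 0 := by
    simpa using h1.inner ℝ (hasDerivAt_const (0 : ℝ) v)
  have h4 := ((((h2.add_const (‖v‖ ^ 2)).const_mul (-α)).add (h3.const_mul (2 * β))).exp).const_mul c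
  convert! h4 using 1
  simp only [gaussKernel, Pi.add_apply, zero_smul, add_zero]
  ring

end Calculus

/-! ### The heat equation for the explicit kernel -/

section HeatEquation
open scoped ENNReal
open Real (exp sinh cosh)

variable {ω t : ℝ} {φ : Config → ℂ}

/-- Logarithmic derivative of the heat kernel in a coordinate of the first plane. -/
noncomputable def logDerivX (t : ℝ) (w : Config) (i : Fin 2) (z : Config) : ℝ :=
  -(1 / t) * z.1 i + 1 / t * w.1 i

/-- Logarithmic derivative of the heat kernel in a coordinate of the second plane. -/
noncomputable def logDerivY (ω t : ℝ) (w : Config) (i : Fin 2) (z : Config) : ℝ :=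
  -(ω * (cosh (ω * t) / sinh (ω * t))) * z.2 i + ω / sinh (ω * t) * w.2 i

/-- Logarithmic time derivative of the heat kernel. -/
noncomputable def heatRate (ω t : ℝ) (z w : Config) : ℝ :=
  1 / 2 * ∑ i, (logDerivX t w i z ^ 2 - 1 / t) +
    1 / 2 * ∑ i, (logDerivY ω t w i z ^ 2 - ω * (cosh (ω * t) / sinh (ω * t))) -
    (ω ^ 2 * ‖z.2‖ ^ 2 / 2 - ω)

theorem hasLineDerivAt_heatKernel_dirX (w z : Config) (i : Fin 2) :
    HasLineDerivAt ℝ (fun z => heatKernel ω t z w) (heatKernel ω t z w * logDerivX t w i z)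
      z (dirX i) := by
  have h := (hasDerivAt_gaussKernel_line (1 / (2 * Real.pi * t)) (1 / (2 * t)) (1 / (2 * t))
    z.1 w.1 (EuclideanSpace.single i 1)).mul_const (exp (ω * t) * mehler ω (ω * t) z.2 w.2)
  unfold HasLineDerivAt
  convert! h using 1
  · ext s
    simp [heatKernel, planeHeat, dirX]
  · simp only [heatKernel, planeHeat, logDerivX, EuclideanSpace.inner_single_left,
      EuclideanSpace.inner_single_right]
    simp
    ring

theorem hasLineDerivAt_heatKernel_dirY (w z : Config) (i : Fin 2) :
    HasLineDerivAt ℝ (fun z => heatKernel ω t z w) (heatKernel ω t z w * logDerivY ω t w i z)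
      z (dirY i) := by
  have h := ((hasDerivAt_gaussKernel_line (ω / (2 * Real.pi * sinh (ω * t)))
    (ω / 2 * (cosh (ω * t) / sinh (ω * t))) (ω / (2 * sinh (ω * t)))
    z.2 w.2 (EuclideanSpace.single i 1)).const_mul (exp (ω * t))).const_mul (planeHeat t z.1 w.1)
  unfold HasLineDerivAt
  convert! h using 1
  · ext s
    simp [heatKernel, mehler, dirY]
  · simp only [heatKernel, mehler, logDerivY, EuclideanSpace.inner_single_left,
      EuclideanSpace.inner_single_right]
    simp
    ring

theorem hasLineDerivAt_logDerivX (w z : Config) (i : Fin 2) :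
    HasLineDerivAt ℝ (logDerivX t w i) (-(1 / t)) z (dirX i) := by
  have h := (((hasDerivAt_id (0 : ℝ)).const_add (z.1 i)).const_mul (-(1 / t))).add_const
    (1 / t * w.1 i)
  unfold HasLineDerivAt
  convert! h using 1
  · ext s
    simp [logDerivX, dirX]
  · simp

theorem hasLineDerivAt_logDerivY (w z : Config) (i : Fin 2) :
    HasLineDerivAt ℝ (logDerivY ω t w i) (-(ω * (cosh (ω * t) / sinh (ω * t)))) z (dirY i) := by
  have h := (((hasDerivAt_id (0 : ℝ)).const_add (z.2 i)).const_mul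
    (-(ω * (cosh (ω * t) / sinh (ω * t))))).add_const (ω / sinh (ω * t) * w.2 i)
  unfold HasLineDerivAt
  convert! h using 1
  · ext s
    simp [logDerivY, dirY]
  · simp

/-- For a Gaussian the logarithmic derivative `l` is affine, so `p' = p l` gives `p'' = p (l² + l')`
with constant `l' = -a`. -/
theorem hasLineDerivAt_mul_logDeriv {p l : Config → ℝ} {a : ℝ} {z v : Config}
    (hp : HasLineDerivAt ℝ p (p z * l z) z v) (hl : HasLineDerivAt ℝ l (-a) z v) :
    HasLineDerivAt ℝ (fun z => p z * l z) (p z * (l z ^ 2 - a)) z v := by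
  have h := HasDerivAt.mul hp hl
  unfold HasLineDerivAt
  convert! h using 1
  simp
  ring

theorem continuous_heatKernel_left (ω t : ℝ) (w : Config) :
    Continuous fun z => heatKernel ω t z w := by
  unfold heatKernel planeHeat mehler gaussKernel
  fun_prop

theorem continuous_logDerivX (t : ℝ) (w : Config) (i : Fin 2) : Continuous (logDerivX t w i) := by
  unfold logDerivX
  fun_prop

theorem continuous_logDerivY (ω t : ℝ) (w : Config) (i : Fin 2) :
    Continuous (logDerivY ω t w i) := by
  unfold logDerivY
  fun_prop

theorem integrable_smul_of_hasCompactSupport {g : Config → ℝ} {ψ : Config → ℂ} (hg : Continuous g)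
    (hψ : Continuous ψ) (hs : HasCompactSupport ψ) : Integrable fun z => g z • ψ z :=
  (hg.smul hψ).integrable_of_hasCompactSupport hs.smul_left

/-- Green's identity for the heat kernel. -/
theorem integral_heatKernel_smul_freeHamiltonian (ω t : ℝ) (w : Config)
    (hφ : ContDiff ℝ ((⊤ : ℕ∞) : WithTop ℕ∞) φ) (hs : HasCompactSupport φ) :
    ∫ z, heatKernel ω t z w • freeHamiltonian ω φ z =
      -∫ z, (heatKernel ω t z w * heatRate ω t z w) • φ z := by
  have hp := continuous_heatKernel_left ω t w
  have hX := continuous_logDerivX t w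
  have hY := continuous_logDerivY ω t w
  have hX2 : ∀ i, Continuous fun z => heatKernel ω t z w * (logDerivX t w i z ^ 2 - 1 / t) :=
    fun i => hp.mul (((hX i).pow 2).sub continuous_const)
  have hY2 : ∀ i, Continuous fun z => heatKernel ω t z w *
      (logDerivY ω t w i z ^ 2 - ω * (cosh (ω * t) / sinh (ω * t))) :=
    fun i => hp.mul (((hY i).pow 2).sub continuous_const)
  have hV : Continuous fun z : Config => heatKernel ω t z w * (ω ^ 2 * ‖z.2‖ ^ 2 / 2 - ω) :=
    hp.mul (by fun_prop)
  have eX : ∀ i, ∫ z, heatKernel ω t z w • secondDeriv φ (dirX i) z =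
      ∫ z, (heatKernel ω t z w * (logDerivX t w i z ^ 2 - 1 / t)) • φ z := fun i =>
    integral_smul_secondDeriv hφ hs (fun z => hasLineDerivAt_heatKernel_dirX w z i)
      (fun z => hasLineDerivAt_mul_logDeriv (p := fun z => heatKernel ω t z w)
        (hasLineDerivAt_heatKernel_dirX w z i) (hasLineDerivAt_logDerivX w z i)) hp (hp.mul (hX i)) (hX2 i)
  have eY : ∀ i, ∫ z, heatKernel ω t z w • secondDeriv φ (dirY i) z =
      ∫ z, (heatKernel ω t z w * (logDerivY ω t w i z ^ 2 -
        ω * (cosh (ω * t) / sinh (ω * t)))) • φ z := fun i =>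
    integral_smul_secondDeriv hφ hs (fun z => hasLineDerivAt_heatKernel_dirY w z i)
      (fun z => hasLineDerivAt_mul_logDeriv (p := fun z => heatKernel ω t z w)
        (hasLineDerivAt_heatKernel_dirY w z i) (hasLineDerivAt_logDerivY w z i)) hp (hp.mul (hY i)) (hY2 i)
  have iX : ∀ i, Integrable fun z => heatKernel ω t z w • secondDeriv φ (dirX i) z := fun i =>
    integrable_smul_of_hasCompactSupport hp (continuous_secondDeriv hφ _)
      (hasCompactSupport_secondDeriv hs _)
  have iY : ∀ i, Integrable fun z => heatKernel ω t z w • secondDeriv φ (dirY i) z := fun i =>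
    integrable_smul_of_hasCompactSupport hp (continuous_secondDeriv hφ _)
      (hasCompactSupport_secondDeriv hs _)
  have jX := fun i => integrable_smul_of_hasCompactSupport (hX2 i) hφ.continuous hs
  have jY := fun i => integrable_smul_of_hasCompactSupport (hY2 i) hφ.continuous hs
  have jV := integrable_smul_of_hasCompactSupport hV hφ.continuous hs
  have hleft : ∀ z, heatKernel ω t z w • freeHamiltonian ω φ z =
      (-(1 / 2 : ℂ)) * ∑ i, heatKernel ω t z w • secondDeriv φ (dirX i) z +
      (-(1 / 2 : ℂ)) * ∑ i, heatKernel ω t z w • secondDeriv φ (dirY i) z +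
      (heatKernel ω t z w * (ω ^ 2 * ‖z.2‖ ^ 2 / 2 - ω)) • φ z := fun z => by
    rw [freeHamiltonian_eq ω hφ, ← Finset.smul_sum, ← Finset.smul_sum]
    simp only [Complex.real_smul]
    push_cast
    ring
  have hright : ∀ z, (heatKernel ω t z w * heatRate ω t z w) • φ z =
      (1 / 2 : ℂ) * ∑ i, (heatKernel ω t z w * (logDerivX t w i z ^ 2 - 1 / t)) • φ z +
      (1 / 2 : ℂ) * ∑ i, (heatKernel ω t z w * (logDerivY ω t w i z ^ 2 -
        ω * (cosh (ω * t) / sinh (ω * t)))) • φ z -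
      (heatKernel ω t z w * (ω ^ 2 * ‖z.2‖ ^ 2 / 2 - ω)) • φ z := fun z => by
    rw [heatRate, ← Finset.sum_smul, ← Finset.sum_smul, ← Finset.mul_sum, ← Finset.mul_sum]
    simp only [Complex.real_smul]
    push_cast
    ring
  simp_rw [hleft, hright]
  have sX := (integrable_finsetSum Finset.univ fun i _ => iX i).const_mul (-(1 / 2 : ℂ))
  have sY := (integrable_finsetSum Finset.univ fun i _ => iY i).const_mul (-(1 / 2 : ℂ))
  have rX := (integrable_finsetSum Finset.univ fun i _ => jX i).const_mul (1 / 2 : ℂ)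
  have rY := (integrable_finsetSum Finset.univ fun i _ => jY i).const_mul (1 / 2 : ℂ)
  have sXY : Integrable fun z => -(1 / 2 : ℂ) * ∑ i, heatKernel ω t z w • secondDeriv φ (dirX i) z +
      -(1 / 2 : ℂ) * ∑ i, heatKernel ω t z w • secondDeriv φ (dirY i) z := sX.add sY
  have rXY : Integrable fun z =>
      (1 / 2 : ℂ) * ∑ i, (heatKernel ω t z w * (logDerivX t w i z ^ 2 - 1 / t)) • φ z +
      (1 / 2 : ℂ) * ∑ i, (heatKernel ω t z w * (logDerivY ω t w i z ^ 2 -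
        ω * (cosh (ω * t) / sinh (ω * t)))) • φ z := rX.add rY
  rw [integral_add sXY jV, integral_add sX sY, integral_sub rXY jV, integral_add rX rY]
  simp only [integral_const_mul]
  rw [integral_finsetSum _ fun i _ => iX i, integral_finsetSum _ fun i _ => iY i,
    integral_finsetSum _ fun i _ => jX i, integral_finsetSum _ fun i _ => jY i]
  simp only [eX, eY]
  ring

/-- `coth² = 1 + 1 / sinh²` cancels the oscillator potential, which leaves the form produced by
differentiating the kernel in time. -/
theorem heatRate_eq (hω : 0 < ω) (ht : 0 < t) (z w : Config) :
    heatRate ω t z w = -(1 / t) + 1 / (2 * t ^ 2) * (‖z.1‖ ^ 2 + ‖w.1‖ ^ 2) -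
      1 / t ^ 2 * inner ℝ z.1 w.1 + ω - ω * (cosh (ω * t) / sinh (ω * t)) +
      ω ^ 2 / (2 * sinh (ω * t) ^ 2) * (‖z.2‖ ^ 2 + ‖w.2‖ ^ 2) -
      ω ^ 2 * cosh (ω * t) / sinh (ω * t) ^ 2 * inner ℝ z.2 w.2 := by
  have hsh := Real.sinh_pos_iff.2 (mul_pos hω ht)
  have hsq : (cosh (ω * t) / sinh (ω * t)) ^ 2 = 1 + (1 / sinh (ω * t)) ^ 2 := by
    field_simp
    rw [Real.cosh_sq]
  simp only [heatRate, logDerivX, logDerivY, EuclideanSpace.real_norm_sq_eq, PiLp.inner_apply,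
    Fin.sum_univ_two, RCLike.inner_apply, conj_trivial]
  linear_combination (ω ^ 2 / 2 * (z.2 0 ^ 2 + z.2 1 ^ 2)) * hsq

/-- The heat equation. -/
theorem hasDerivAt_heatKernel_time (hω : 0 < ω) (ht : 0 < t) (z w : Config) :
    HasDerivAt (fun t => heatKernel ω t z w) (heatKernel ω t z w * heatRate ω t z w) t := by
  have hsh := Real.sinh_pos_iff.2 (mul_pos hω ht)
  have hpi := Real.pi_pos
  have hsq := Real.cosh_sq (ω * t)
  have h1 : HasDerivAt (fun t : ℝ => ω * t) ω t := by
    simpa using (hasDerivAt_id t).const_mul ω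
  have hS : HasDerivAt (fun t => sinh (ω * t)) (cosh (ω * t) * ω) t := h1.sinh
  have hC : HasDerivAt (fun t => cosh (ω * t)) (sinh (ω * t) * ω) t := h1.cosh
  have hinv : HasDerivAt (fun t : ℝ => 1 / (2 * t)) (-(1 / (2 * t ^ 2))) t := by
    have := ((hasDerivAt_id t).const_mul 2).inv (by simpa using ht.ne')
    simp only [one_div]
    convert! this using 1
    simp only [id]
    field_simp
  set N₁ := ‖z.1‖ ^ 2 + ‖w.1‖ ^ 2 with hN₁
  set I₁ : ℝ := inner ℝ z.1 w.1 with hI₁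
  set N₂ := ‖z.2‖ ^ 2 + ‖w.2‖ ^ 2 with hN₂
  set I₂ : ℝ := inner ℝ z.2 w.2 with hI₂
  have hE₁ : HasDerivAt (fun t : ℝ => exp (-(1 / (2 * t)) * N₁ + 2 * (1 / (2 * t)) * I₁))
      (exp (-(1 / (2 * t)) * N₁ + 2 * (1 / (2 * t)) * I₁) *
        (1 / (2 * t ^ 2) * N₁ - 1 / t ^ 2 * I₁)) t := by
    have := ((hinv.neg.mul_const N₁).add ((hinv.const_mul 2).mul_const I₁)).exp
    convert! this using 1
    simp only [Pi.add_apply, Pi.neg_apply]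
    congr 1
    field_simp
    ring
  have hc₁ : HasDerivAt (fun t : ℝ => 1 / (2 * Real.pi * t)) (-(1 / (2 * Real.pi * t ^ 2))) t := by
    have := hinv.mul_const (1 / Real.pi)
    convert! this using 1
    · ext s
      rcases eq_or_ne s 0 with rfl | hs
      · simp
      · field_simp
    · field_simp
  have hα₂ : HasDerivAt (fun t => ω / 2 * (cosh (ω * t) / sinh (ω * t)))
      (-(ω ^ 2 / (2 * sinh (ω * t) ^ 2))) t := by
    have := (hC.div hS hsh.ne').const_mul (ω / 2)
    convert! this using 1
    field_simp
    rw [hsq]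
    ring
  have hβ₂ : HasDerivAt (fun t => ω / (2 * sinh (ω * t)))
      (-(ω ^ 2 * cosh (ω * t) / (2 * sinh (ω * t) ^ 2))) t := by
    have := (hasDerivAt_const t ω).div (hS.const_mul 2) (by positivity)
    convert! this using 1
    field_simp
    ring
  have hE₂ : HasDerivAt (fun t : ℝ => exp (-(ω / 2 * (cosh (ω * t) / sinh (ω * t))) * N₂ +
      2 * (ω / (2 * sinh (ω * t))) * I₂))
      (exp (-(ω / 2 * (cosh (ω * t) / sinh (ω * t))) * N₂ + 2 * (ω / (2 * sinh (ω * t))) * I₂) *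
        (ω ^ 2 / (2 * sinh (ω * t) ^ 2) * N₂ -
          ω ^ 2 * cosh (ω * t) / sinh (ω * t) ^ 2 * I₂)) t := by
    have := ((hα₂.neg.mul_const N₂).add ((hβ₂.const_mul 2).mul_const I₂)).exp
    convert! this using 1
    simp only [Pi.add_apply, Pi.neg_apply]
    congr 1
    field_simp
    ring
  have hc₂ : HasDerivAt (fun t => ω / (2 * Real.pi * sinh (ω * t)))
      (-(ω ^ 2 * cosh (ω * t) / (2 * Real.pi * sinh (ω * t) ^ 2))) t := by
    have := (hasDerivAt_const t ω).div (hS.const_mul (2 * Real.pi)) (by positivity)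
    convert! this using 1
    field_simp
    ring
  have h := (hc₁.mul hE₁).mul (h1.exp.mul (hc₂.mul hE₂))
  unfold heatKernel planeHeat mehler gaussKernel
  convert! h using 1
  rw [heatRate_eq hω ht, ← hN₁, ← hN₂, ← hI₁, ← hI₂]
  simp only [Pi.mul_apply]
  -- With the three exponentials as free variables, a rational identity remains.
  generalize exp _ = A
  generalize exp _ = B
  generalize exp _ = D
  field_simp
  ring

end HeatEquation

/-! ### The initial limit of the semigroup and the resolvent equation -/

section Resolvent
open scoped ENNReal Topology
open Real (exp sinh cosh)
open Filter (Tendsto)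

variable {ω t : ℝ} {φ : Config → ℂ}

/-- The right side has no vanishing denominator, which gives continuity down to `t = 0`. -/
theorem cosh_sub_one_div_sinh (s : ℝ) : (cosh s - 1) / sinh s = sinh s / (cosh s + 1) := by
  have hc := Real.cosh_pos s
  rcases eq_or_ne (sinh s) 0 with h | h
  · simp [h]
  · rw [div_eq_div_iff h (by positivity)]
    linear_combination Real.cosh_sq s

theorem tendsto_div_sinh : Tendsto (fun s : ℝ => s / sinh s) (𝓝[>] 0) (𝓝 1) := by
  have h := (Real.hasDerivAt_sinh 0).tendsto_slope.mono_left
    (nhdsWithin_mono _ fun s (hs : 0 < s) => hs.ne' : 𝓝[>] (0 : ℝ) ≤ 𝓝[≠] 0)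
  have h2 := h.inv₀ (by simp)
  refine (h2.congr fun s => ?_).trans (by simp)
  simp [slope_def_field, inv_div]

/-- The heat kernel in parabolic coordinates centred at `w`, as a function of time and of the
ratio `r = ω t / sinh (ω t)`. -/
noncomputable def scaledHeatKernel (ω : ℝ) (w ζ : Config) (t r : ℝ) : ℝ :=
  1 / (2 * Real.pi) * exp (-(1 / 2) * ‖ζ.1‖ ^ 2) * (exp (ω * t) * (r / (2 * Real.pi) *
    exp (-(ω / 2 * (sinh (ω * t) / (cosh (ω * t) + 1))) *
      (‖w.2 + Real.sqrt t • ζ.2‖ ^ 2 + ‖w.2‖ ^ 2) - r / 2 * ‖ζ.2‖ ^ 2)))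

theorem continuous_scaledHeatKernel (ω : ℝ) (w : Config) :
    Continuous fun q : Config × ℝ × ℝ => scaledHeatKernel ω w q.1 q.2.1 q.2.2 := by
  have h1 : Continuous fun q : Config × ℝ × ℝ => sinh (ω * q.2.1) :=
    Real.continuous_sinh.comp (by fun_prop)
  have h2 : Continuous fun q : Config × ℝ × ℝ => cosh (ω * q.2.1) + 1 :=
    (Real.continuous_cosh.comp (by fun_prop)).add continuous_const
  unfold scaledHeatKernel
  fun_prop (disch := exact fun q => (add_pos (Real.cosh_pos _) one_pos).ne')

/-- `t² = (√t)⁴` is the Jacobian of `z = w + √t ζ` on `ℝ⁴`; it removes the singularity of the kernel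
at `t = 0`. -/
theorem sq_mul_heatKernel_eq (hω : 0 < ω) (ht : 0 < t) (w ζ : Config) :
    t ^ 2 * heatKernel ω t (w + Real.sqrt t • ζ) w =
      scaledHeatKernel ω w ζ t (ω * t / sinh (ω * t)) := by
  have hsh := Real.sinh_pos_iff.2 (mul_pos hω ht)
  have hpi := Real.pi_pos
  have hn : ∀ v : Plane, ‖Real.sqrt t • v‖ ^ 2 = t * ‖v‖ ^ 2 := fun v => by
    rw [norm_smul, mul_pow, Real.norm_eq_abs, sq_abs, Real.sq_sqrt ht.le]
  rw [heatKernel, planeHeat_eq, mehler_eq, scaledHeatKernel, cosh_sub_one_div_sinh]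
  simp only [Prod.fst_add, Prod.snd_add, Prod.smul_fst, Prod.smul_snd, add_sub_cancel_left, hn]
  have e1 : -(1 / (2 * t)) * (t * ‖ζ.1‖ ^ 2) = -(1 / 2) * ‖ζ.1‖ ^ 2 := by field_simp
  have e2 : ω / (2 * sinh (ω * t)) * (t * ‖ζ.2‖ ^ 2) =
      ω * t / sinh (ω * t) / 2 * ‖ζ.2‖ ^ 2 := by field_simp
  rw [e1, e2]
  field_simp

theorem integral_heatKernel_smul_eq (hω : 0 < ω) (ht : 0 < t) (w : Config) (φ : Config → ℂ) :
    ∫ z, heatKernel ω t z w • φ z =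
      ∫ ζ, scaledHeatKernel ω w ζ t (ω * t / sinh (ω * t)) • φ (w + Real.sqrt t • ζ) := by
  have := isAddHaarMeasure_volume_config
  have h1 := Measure.integral_comp_smul_of_nonneg (volume : Measure Config)
    (fun y => heatKernel ω t (w + y) w • φ (w + y)) (Real.sqrt t) (hR := Real.sqrt_nonneg t)
  have h2 : Real.sqrt t ^ 4 = t ^ 2 := by
    rw [show (4 : ℕ) = 2 * 2 from rfl, pow_mul, Real.sq_sqrt ht.le]
  rw [integral_add_left_eq_self (fun y => heatKernel ω t y w • φ y) w] at h1
  simp only [Module.finrank_prod, finrank_euclideanSpace, Fintype.card_fin, Nat.reduceAdd, h2]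
    at h1
  simp_rw [← sq_mul_heatKernel_eq hω ht, mul_smul]
  rw [integral_smul, h1, smul_inv_smul₀ (by positivity)]

theorem scaledHeatKernel_le {r : ℝ} (hω : 0 < ω) (ht : 0 < t) (ht1 : ω * t ≤ 1)
    (hr : 1 / 2 ≤ r) (hr1 : r ≤ 1) (w ζ : Config) :
    |scaledHeatKernel ω w ζ t r| ≤
      exp 1 * (exp (-(1 / 2) * ‖ζ.1‖ ^ 2) * exp (-(1 / 4) * ‖ζ.2‖ ^ 2)) := by
  have hsh := Real.sinh_pos_iff.2 (mul_pos hω ht)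
  have hc := Real.cosh_pos (ω * t)
  have hpi := Real.pi_gt_three
  have h1 : 1 / (2 * Real.pi) ≤ 1 := by
    rw [div_le_one (by positivity)]
    linarith
  have h2 : r / (2 * Real.pi) ≤ 1 := by
    rw [div_le_one (by positivity)]
    linarith
  have hr0 : 0 < r := by linarith
  rw [abs_of_nonneg (by unfold scaledHeatKernel; positivity), scaledHeatKernel]
  calc _ ≤ 1 * exp (-(1 / 2) * ‖ζ.1‖ ^ 2) * (exp 1 * (1 * exp (-(1 / 4) * ‖ζ.2‖ ^ 2))) := by
        gcongr
        have h3 : 0 ≤ ω / 2 * (sinh (ω * t) / (cosh (ω * t) + 1)) *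
            (‖w.2 + Real.sqrt t • ζ.2‖ ^ 2 + ‖w.2‖ ^ 2) := by positivity
        have h4 : 1 / 4 * ‖ζ.2‖ ^ 2 ≤ r / 2 * ‖ζ.2‖ ^ 2 := by
          exact mul_le_mul_of_nonneg_right (by linarith) (sq_nonneg _)
        linarith
    _ = _ := by ring

theorem scaledHeatKernel_zero_one (ω : ℝ) (w ζ : Config) :
    scaledHeatKernel ω w ζ 0 1 = 1 / (2 * Real.pi) * exp (-(1 / 2) * ‖ζ.1‖ ^ 2) *
      (1 / (2 * Real.pi) * exp (-(1 / 2) * ‖ζ.2‖ ^ 2)) := by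
  simp [scaledHeatKernel]

attribute [local irreducible] scaledHeatKernel

theorem integral_exp_neg_half_sq_norm_plane :
    ∫ v : Plane, exp (-(1 / 2) * ‖v‖ ^ 2) = 2 * Real.pi := by
  rw [GaussianFourier.integral_rexp_neg_mul_sq_norm (by norm_num)]
  simp
  ring

/-- In parabolic coordinates the kernel tends to a fixed Gaussian of total mass one, and for small
`t` it is dominated by another fixed Gaussian. -/
theorem tendsto_integral_heatKernel_smul (hω : 0 < ω) (w : Config) (hφ : Continuous φ)
    {M : ℝ} (hM : ∀ z, ‖φ z‖ ≤ M) :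
    Tendsto (fun t => ∫ z, heatKernel ω t z w • φ z) (𝓝[>] 0) (𝓝 (φ w)) := by
  have hpi := Real.pi_pos
  have hM0 : 0 ≤ M := (norm_nonneg _).trans (hM 0)
  have hωt : Tendsto (fun t : ℝ => ω * t) (𝓝[>] 0) (𝓝[>] 0) := by
    refine tendsto_nhdsWithin_of_tendsto_nhds_of_eventually_within _ ?_ ?_
    · have : Continuous fun t : ℝ => ω * t := by fun_prop
      simpa using (this.tendsto 0).mono_left nhdsWithin_le_nhds
    · filter_upwards [self_mem_nhdsWithin] with t ht using mul_pos hω ht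
  have hr := tendsto_div_sinh.comp hωt
  have ht0 : Tendsto (fun t : ℝ => t) (𝓝[>] 0) (𝓝 0) := Filter.tendsto_id.mono_left nhdsWithin_le_nhds
  have hlim : ∀ ζ : Config, Tendsto
      (fun t => scaledHeatKernel ω w ζ t (ω * t / sinh (ω * t)) • φ (w + Real.sqrt t • ζ))
      (𝓝[>] 0) (𝓝 (((1 / (2 * Real.pi) * exp (-(1 / 2) * ‖ζ.1‖ ^ 2)) *
        (1 / (2 * Real.pi) * exp (-(1 / 2) * ‖ζ.2‖ ^ 2))) • φ w)) := by
    intro ζ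
    refine Tendsto.smul ?_ ?_
    · have hc : Continuous fun q : ℝ × ℝ => scaledHeatKernel ω w ζ q.1 q.2 :=
        (continuous_scaledHeatKernel ω w).comp (Continuous.prodMk_right ζ)
      have := (hc.tendsto (0, 1)).comp (ht0.prodMk_nhds hr)
      rw [← scaledHeatKernel_zero_one ω w ζ]
      exact this
    · have hc : Continuous fun t => φ (w + Real.sqrt t • ζ) := by fun_prop
      have h1 := (hc.tendsto 0).comp ht0
      rw [Real.sqrt_zero, zero_smul, add_zero] at h1
      exact h1
  have hint1 := integrable_exp_neg_mul_sq_norm_plane (D := 1 / 2) (by norm_num)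
  have hint2 := integrable_exp_neg_mul_sq_norm_plane (D := 1 / 4) (by norm_num)
  have hval : ∫ ζ : Config, ((1 / (2 * Real.pi) * exp (-(1 / 2) * ‖ζ.1‖ ^ 2)) *
      (1 / (2 * Real.pi) * exp (-(1 / 2) * ‖ζ.2‖ ^ 2))) • φ w = φ w := by
    rw [integral_smul_const, Measure.volume_eq_prod,
      integral_prod_mul (fun v : Plane => 1 / (2 * Real.pi) * exp (-(1 / 2) * ‖v‖ ^ 2))
        (fun v : Plane => 1 / (2 * Real.pi) * exp (-(1 / 2) * ‖v‖ ^ 2)), integral_const_mul,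
      integral_exp_neg_half_sq_norm_plane, one_div_mul_cancel (by positivity)]
    simp
  have hdom : Integrable fun ζ : Config =>
      exp 1 * (exp (-(1 / 2) * ‖ζ.1‖ ^ 2) * exp (-(1 / 4) * ‖ζ.2‖ ^ 2)) * M :=
    ((hint1.mul_prod hint2).const_mul _).mul_const _
  have hmain := tendsto_integral_filter_of_dominated_convergence (μ := (volume : Measure Config)) _
    ?_ ?_ hdom (.of_forall hlim)
  · rw [hval] at hmain
    refine hmain.congr' ?_
    filter_upwards [self_mem_nhdsWithin] with t ht
    rw [integral_heatKernel_smul_eq hω ht]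
  · refine .of_forall fun t => Continuous.aestronglyMeasurable ?_
    have : Continuous fun ζ => scaledHeatKernel ω w ζ t (ω * t / sinh (ω * t)) :=
      (continuous_scaledHeatKernel ω w).comp (Continuous.prodMk_left (t, ω * t / sinh (ω * t)))
    fun_prop
  -- For `ω t ≤ 1` the ratio `ω t / sinh (ω t)` lies in `[1/2, 1]`, as the Gaussian bound requires.
  · have hev : ∀ᶠ t in 𝓝[>] (0 : ℝ), t < 1 / ω :=
      ht0.eventually (gt_mem_nhds (by positivity))
    filter_upwards [self_mem_nhdsWithin, hev] with t ht ht1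
    have ht' : 0 < t := ht
    have hs := mul_pos hω ht'
    have hs1 : ω * t ≤ 1 := by
      rw [lt_div_iff₀ hω] at ht1
      linarith
    have hsh := Real.sinh_pos_iff.2 hs
    refine .of_forall fun ζ => ?_
    rw [norm_smul, Real.norm_eq_abs]
    refine mul_le_mul (scaledHeatKernel_le hω ht' hs1 ?_ ?_ w ζ) (hM _) (norm_nonneg _)
      (by positivity)
    · rw [div_le_div_iff₀ (by norm_num) hsh]
      linarith [sinh_le_two_mul hs.le hs1]
    · rw [div_le_one hsh]
      exact Real.self_le_sinh_iff.2 hs.le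

theorem continuousOn_heatKernel_mul_heatRate (hω : 0 < ω) (w : Config) :
    ContinuousOn (fun q : ℝ × Config => heatKernel ω q.1 q.2 w * heatRate ω q.1 q.2 w)
      (Set.Ioi 0 ×ˢ Set.univ) := by
  have h1 : ContinuousOn (fun q : ℝ × Config => q.1⁻¹) (Set.Ioi 0 ×ˢ Set.univ) :=
    continuousOn_fst.inv₀ fun q hq => (ne_of_gt hq.1)
  have h2 : ContinuousOn (fun q : ℝ × Config => (sinh (ω * q.1))⁻¹) (Set.Ioi 0 ×ˢ Set.univ) :=
    (Real.continuous_sinh.comp (by fun_prop : Continuous fun q : ℝ × Config => ω * q.1)).continuousOn.inv₀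
      fun q hq => (Real.sinh_pos_iff.2 (mul_pos hω hq.1)).ne'
  have h3 : Continuous fun q : ℝ × Config => cosh (ω * q.1) :=
    Real.continuous_cosh.comp (by fun_prop)
  simp only [heatKernel, planeHeat, mehler, gaussKernel, heatRate, logDerivX, logDerivY,
    Fin.sum_univ_two, div_eq_mul_inv, mul_inv]
  fun_prop

/-- Differentiation under the integral; the time derivative is bounded on the compact set `[t/2, 2t]
× tsupport φ`. -/
theorem hasDerivAt_integral_heatKernel_smul (hω : 0 < ω) (ht : 0 < t) (w : Config)
    (hφ : Continuous φ) (hs : HasCompactSupport φ) :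
    HasDerivAt (fun t => ∫ z, heatKernel ω t z w • φ z)
      (∫ z, (heatKernel ω t z w * heatRate ω t z w) • φ z) t := by
  have hcomp : IsCompact (Set.Icc (t / 2) (2 * t) ×ˢ tsupport φ) := isCompact_Icc.prod hs
  obtain ⟨M, hM⟩ := hcomp.exists_bound_of_continuousOn
    ((continuousOn_heatKernel_mul_heatRate hω w).mono fun q hq =>
      ⟨lt_of_lt_of_le (by positivity : 0 < t / 2) hq.1.1, Set.mem_univ _⟩)
  have hrate : Continuous fun z => heatRate ω t z w := by
    have h1 := continuous_logDerivX t w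
    have h2 := continuous_logDerivY ω t w
    unfold heatRate
    fun_prop
  refine (hasDerivAt_integral_of_dominated_loc_of_deriv_le (bound := fun z => M * ‖φ z‖)
    (F' := fun t z => (heatKernel ω t z w * heatRate ω t z w) • φ z)
    (Ioo_mem_nhds (by linarith : t / 2 < t) (by linarith : t < 2 * t)) ?_ ?_ ?_ ?_ ?_ ?_).2
  · exact .of_forall fun s =>
      ((continuous_heatKernel_left ω s w).smul hφ).aestronglyMeasurable
  · exact integrable_smul_of_hasCompactSupport (continuous_heatKernel_left ω t w) hφ hs
  · exact (((continuous_heatKernel_left ω t w).mul hrate).smul hφ).aestronglyMeasurable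
  · refine .of_forall fun z s hst => ?_
    by_cases hz : z ∈ tsupport φ
    · rw [norm_smul]
      gcongr
      exact hM (s, z) ⟨⟨hst.1.le, hst.2.le⟩, hz⟩
    · simp [image_eq_zero_of_notMem_tsupport hz]
  · exact (hφ.integrable_of_hasCompactSupport hs).norm.const_mul _
  · refine .of_forall fun z s hst => ?_
    exact (hasDerivAt_heatKernel_time hω (by linarith [hst.1]) z w).smul_const (φ z)

theorem lintegral_enorm_heatKernel_smul_le (hω : 0 < ω) (ht : 0 < t) (w : Config)
    {M : ℝ} (hM : ∀ z, ‖φ z‖ ≤ M) :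
    ∫⁻ z, ‖heatKernel ω t z w • φ z‖ₑ ≤ 2 * ENNReal.ofReal M := by
  calc _ ≤ ∫⁻ z, ENNReal.ofReal (heatKernel ω t w z) * ENNReal.ofReal M := by
        refine lintegral_mono fun z => ?_
        rw [enorm_smul, heatKernel_comm, Real.enorm_eq_ofReal (heatKernel_nonneg hω ht _ _)]
        gcongr
        rw [← ofReal_norm]
        exact ENNReal.ofReal_le_ofReal (hM z)
    _ ≤ _ := by
        rw [lintegral_mul_const' _ _ ENNReal.ofReal_ne_top]
        gcongr
        exact lintegral_heatKernel_le hω ht w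

theorem norm_integral_heatKernel_smul_le (hω : 0 < ω) (ht : 0 < t) (w : Config)
    {M : ℝ} (hM : ∀ z, ‖φ z‖ ≤ M) : ‖∫ z, heatKernel ω t z w • φ z‖ ≤ 2 * M := by
  have hM0 : 0 ≤ M := (norm_nonneg _).trans (hM 0)
  have h := (enorm_integral_le_lintegral_enorm (μ := volume)
    (fun z => heatKernel ω t z w • φ z)).trans (lintegral_enorm_heatKernel_smul_le hω ht w hM)
  have h2 : (2 : ℝ≥0∞) * ENNReal.ofReal M = ENNReal.ofReal (2 * M) := by
    rw [ENNReal.ofReal_mul (by norm_num), ENNReal.ofReal_ofNat]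
  rw [← ofReal_norm, h2] at h
  exact (ENNReal.ofReal_le_ofReal_iff (by positivity)).1 h

attribute [local irreducible] heatKernel

/-- The heat kernel has mass at most `2` in `z`, uniformly in `t`, and `exp(-λ t)` is integrable. -/
theorem integrable_exp_smul_heatKernel {lam : ℝ} (hω : 0 < ω) (hlam : 0 < lam) (w : Config)
    {ψ : Config → ℂ} (hψ : Continuous ψ) {M : ℝ} (hM : ∀ z, ‖ψ z‖ ≤ M) :
    Integrable (Function.uncurry fun (t : ℝ) (z : Config) =>
      exp (-lam * t) • heatKernel ω t z w • ψ z)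
      ((volume.restrict (Set.Ioi (0 : ℝ))).prod (volume : Measure Config)) := by
  have hm : Measurable (Function.uncurry fun (t : ℝ) (z : Config) =>
      exp (-lam * t) • heatKernel ω t z w • ψ z) := by
    have h1 : Measurable fun q : ℝ × Config => heatKernel ω q.1 q.2 w :=
      (measurable_heatKernel ω).comp
        (g := fun q : ℝ × Config × Config => heatKernel ω q.1 q.2.1 q.2.2)
        (measurable_fst.prodMk (measurable_snd.prodMk measurable_const))
    have h2 := hψ.measurable
    have h3 : Measurable fun q : ℝ × Config => exp (-lam * q.1) := by fun_prop
    exact h3.smul (h1.smul (h2.comp measurable_snd))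
  refine ⟨hm.aestronglyMeasurable, ?_⟩
  rw [HasFiniteIntegral, lintegral_prod _ hm.enorm.aemeasurable]
  simp only [Function.uncurry_apply_pair]
  calc _ ≤ ∫⁻ t in Set.Ioi (0 : ℝ), timeWeight lam 0 t * (2 * ENNReal.ofReal M) := by
        refine setLIntegral_mono' measurableSet_Ioi fun t ht => ?_
        simp_rw [enorm_smul (exp (-lam * t))]
        rw [lintegral_const_mul' _ _ (by simp), timeWeight_zero,
          Real.enorm_eq_ofReal (Real.exp_pos _).le]
        gcongr
        exact lintegral_enorm_heatKernel_smul_le hω ht w hM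
    _ < ∞ := by
        rw [lintegral_mul_const _ (measurable_timeWeight lam 0)]
        exact ENNReal.mul_lt_top (lintegral_timeWeight_lt_top hlam 0)
          (ENNReal.mul_lt_top (by simp) ENNReal.ofReal_lt_top)

theorem integral_timeKernel_mul_eq {lam : ℝ} (hω : 0 < ω) (hlam : 0 < lam) (w : Config)
    {ψ : Config → ℂ} (hψ : Continuous ψ) {M : ℝ} (hM : ∀ z, ‖ψ z‖ ≤ M) :
    ∫ z, (((timeKernel ω (timeWeight lam 0) z w).toReal : ℝ) : ℂ) * ψ z =
      ∫ t in Set.Ioi (0 : ℝ), exp (-lam * t) • ∫ z, heatKernel ω t z w • ψ z := by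
  simp_rw [← integral_smul]
  rw [integral_integral_swap (integrable_exp_smul_heatKernel hω hlam w hψ hM)]
  refine integral_congr_ae (.of_forall fun z => ?_)
  simp only [← greenKernel_eq_toReal hω, greenKernel_eq_integral hω, smul_smul]
  rw [integral_smul_const, Complex.real_smul]

/-- The Green function inverts `H₀ + λ` on smooth compactly supported functions. -/
theorem integral_timeKernel_mul_freeHamiltonian {lam : ℝ} (hω : 0 < ω) (hlam : 0 < lam)
    (w : Config) (hφ : ContDiff ℝ ((⊤ : ℕ∞) : WithTop ℕ∞) φ) (hs : HasCompactSupport φ) :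
    ∫ z, (((timeKernel ω (timeWeight lam 0) z w).toReal : ℝ) : ℂ) *
      (freeHamiltonian ω φ z + (lam : ℂ) * φ z) = φ w := by
  have hHc := continuous_freeHamiltonian ω hφ
  have hHs := hasCompactSupport_freeHamiltonian ω hφ hs
  have hψ : Continuous fun z => freeHamiltonian ω φ z + (lam : ℂ) * φ z :=
    hHc.add (continuous_const.mul hφ.continuous)
  have hψs : HasCompactSupport fun z => freeHamiltonian ω φ z + (lam : ℂ) * φ z :=
    hHs.add hs.mul_left
  obtain ⟨M, hM⟩ := hs.exists_bound_of_continuous hφ.continuous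
  obtain ⟨N, hN⟩ := hψs.exists_bound_of_continuous hψ
  set u : ℝ → ℂ := fun t => ∫ z, heatKernel ω t z w • φ z with hu
  have hsplit : ∀ t, ∫ z, heatKernel ω t z w • (freeHamiltonian ω φ z + (lam : ℂ) * φ z) =
      -(∫ z, (heatKernel ω t z w * heatRate ω t z w) • φ z) + (lam : ℂ) * u t := fun t => by
    have i1 := integrable_smul_of_hasCompactSupport (continuous_heatKernel_left ω t w) hHc hHs
    have i2 := integrable_smul_of_hasCompactSupport (continuous_heatKernel_left ω t w)
      hφ.continuous hs
    have hc : ∀ z, heatKernel ω t z w • ((lam : ℂ) * φ z) =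
        (lam : ℂ) * heatKernel ω t z w • φ z := fun z =>
      (mul_smul_comm _ _ _).symm
    simp only [smul_add, hc]
    rw [integral_add i1 (i2.const_mul _), integral_const_mul,
      integral_heatKernel_smul_freeHamiltonian ω t w hφ hs]
  rw [integral_timeKernel_mul_eq hω hlam w hψ hN]
  -- By `hsplit` and the heat equation the integrand is `exp(-λ t) (λ u - u')`, whose primitive is
  -- `-exp(-λ t) u`. Giving it its limit `-φ w` at `0` makes it continuous there; since it vanishes
  -- at infinity, the integral is `φ w`.
  set F : ℝ → ℂ := fun t => if t = 0 then -φ w else -(exp (-lam * t) • u t) with hF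
  have hF0 : ∀ t : ℝ, 0 < t → F t = -(exp (-lam * t) • u t) := fun t ht => if_neg ht.ne'
  have hexp : ∀ t, HasDerivAt (fun t : ℝ => exp (-lam * t)) (exp (-lam * t) * -lam) t := fun t => by
    simpa using ((hasDerivAt_id t).const_mul (-lam)).exp
  have hderiv : ∀ t ∈ Set.Ioi (0 : ℝ), HasDerivAt F (exp (-lam * t) •
      ∫ z, heatKernel ω t z w • (freeHamiltonian ω φ z + (lam : ℂ) * φ z)) t := fun t ht => by
    have h := ((hexp t).smul (hasDerivAt_integral_heatKernel_smul hω ht w hφ.continuous hs)).neg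
    have h2 : HasDerivAt F _ t := h.congr_of_eventuallyEq (by
      filter_upwards [Ioi_mem_nhds ht] with s hs using hF0 s hs)
    convert! h2 using 1
    rw [hsplit]
    simp only [Complex.real_smul, hu]
    push_cast
    ring
  have hcont : ContinuousWithinAt F (Set.Ici 0) 0 := by
    rw [← Set.Ioi_insert, continuousWithinAt_insert_self]
    have h1 : Tendsto (fun t : ℝ => exp (-lam * t)) (𝓝[>] 0) (𝓝 1) := by
      simpa using ((hexp 0).continuousAt.tendsto).mono_left nhdsWithin_le_nhds
    have h2 := (h1.smul (tendsto_integral_heatKernel_smul hω w hφ.continuous hM)).neg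
    have h3 : F 0 = -((1 : ℝ) • φ w) := by simp [hF]
    rw [ContinuousWithinAt, h3]
    refine h2.congr' ?_
    filter_upwards [self_mem_nhdsWithin] with t ht using (hF0 t ht).symm
  have htop : Tendsto F Filter.atTop (𝓝 0) := by
    have h1 : Tendsto (fun t : ℝ => exp (-lam * t) * (2 * M)) Filter.atTop (𝓝 0) := by
      have : Tendsto (fun t : ℝ => -lam * t) Filter.atTop Filter.atBot :=
        Filter.tendsto_id.const_mul_atTop_of_neg (neg_lt_zero.2 hlam)
      simpa using (Real.tendsto_exp_atBot.comp this).mul_const (2 * M)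
    refine squeeze_zero_norm' ?_ h1
    filter_upwards [Filter.eventually_gt_atTop 0] with t ht
    rw [hF0 t ht, norm_neg, norm_smul, Real.norm_eq_abs, abs_of_pos (Real.exp_pos _)]
    gcongr
    exact norm_integral_heatKernel_smul_le hω ht w hM
  have hInt : IntegrableOn (fun t => exp (-lam * t) •
      ∫ z, heatKernel ω t z w • (freeHamiltonian ω φ z + (lam : ℂ) * φ z)) (Set.Ioi 0) := by
    have := (integrable_exp_smul_heatKernel hω hlam w hψ hN).integral_prod_left
    simp only [Function.uncurry_apply_pair, integral_smul] at this
    exact this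
  rw [integral_Ioi_of_hasDerivAt_of_tendsto hcont hderiv hInt htop]
  simp [hF]

/-- Duality: Fubini moves the kernel from `f` onto `(H₀ + λ) φ`, where it returns `φ` pointwise. -/
theorem isFreeResolvent_of_isKernelOp {lam : ℝ} (hω : 0 < ω) (hlam : 0 < lam)
    {G : L2Config →L[ℂ] L2Config} (hG : IsKernelOp (timeKernel ω (timeWeight lam 0)) G) :
    IsFreeResolvent ω lam G := by
  intro f φ hφ hs
  have hψ : Continuous fun z => freeHamiltonian ω φ z + (lam : ℂ) * φ z :=
    (continuous_freeHamiltonian ω hφ).add (continuous_const.mul hφ.continuous)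
  have hψs : HasCompactSupport fun z => freeHamiltonian ω φ z + (lam : ℂ) * φ z :=
    (hasCompactSupport_freeHamiltonian ω hφ hs).add hs.mul_left
  have hL2 : ∫⁻ z, ‖freeHamiltonian ω φ z + (lam : ℂ) * φ z‖ₑ ^ 2 < ∞ := by
    have h := (hψ.memLp_of_hasCompactSupport hψs (p := 2) (μ := volume)).eLpNorm_lt_top
    rw [← eLpNorm_two_sq]
    exact ENNReal.pow_lt_top h
  have hswap := (l2Bounded_timeKernel hω (measurable_timeWeight lam 0)).integral_mul_swap
    (measurable_timeKernel ω (measurable_timeWeight lam 0))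
    (lintegral_timeWeight_ne_top hlam 0)
    (measurable_Lp_two f) (lintegral_enorm_sq_Lp_two_lt_top f) hψ.measurable hL2
  simp_rw [integral_timeKernel_mul_freeHamiltonian hω hlam _ hφ hs] at hswap
  rw [← hswap]
  refine integral_congr_ae ?_
  filter_upwards [hG f] with z hz
  rw [hz.2]

end Resolvent
end ZeroRange

/-! ### Assembly of the main theorem -/

theorem mainTheorem11 (ω lam : ℝ) (hω : 0 < ω) (hlam : 0 < lam) :
    ∃ (G : ZeroRange.L2Config →L[ℂ] ZeroRange.L2Config)
      (Pot : ZeroRange.L2Plane →L[ℂ] ZeroRange.L2Config),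
      ZeroRange.IsFreeResolvent ω lam G ∧
      ZeroRange.IsIntegralOperator (ZeroRange.greenKernel ω lam) G ∧
      ZeroRange.IsIntegralOperator (ZeroRange.potentialKernel ω lam) Pot ∧
      ∀ k : ℕ, (k : ℝ) < lam → ∀ p : ℝ, 2 / ((k : ℝ) + 1) < p →
        ZeroRange.IsSchatten p (ContinuousLinearMap.adjoint Pot ∘L (G ^ k) ∘L Pot) := by
  have hφ := ZeroRange.measurable_timeWeight lam 0
  obtain ⟨G, hG⟩ := (ZeroRange.l2Bounded_timeKernel hω hφ).exists_isKernelOp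
    (ZeroRange.measurable_timeKernel ω hφ)
    (ZeroRange.lintegral_timeWeight_ne_top hlam 0)
  obtain ⟨Pot, hP⟩ := (ZeroRange.l2Bounded_diagKernel hω hφ).exists_isKernelOp
    (ZeroRange.measurable_diagKernel ω hφ)
    (ZeroRange.lintegral_timeWeight_div_sqrt_ne_top hlam 0)
  have hgreen : ZeroRange.greenKernel ω lam = fun z w =>
      (ZeroRange.timeKernel ω (ZeroRange.timeWeight lam 0) z w).toReal :=
    funext₂ (ZeroRange.greenKernel_eq_toReal hω lam)
  have hpot : ZeroRange.potentialKernel ω lam = fun z u =>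
      (ZeroRange.diagKernel ω (ZeroRange.timeWeight lam 0) z u).toReal :=
    funext₂ fun z u => ZeroRange.greenKernel_eq_toReal hω lam z (u, u)
  refine ⟨G, Pot, ZeroRange.isFreeResolvent_of_isKernelOp hω hlam hG, ?_, ?_,
    fun k _ p hp => ZeroRange.isSchatten_adjoint_comp hω hlam hG hP k hp⟩
  · rw [hgreen]
    exact hG
  · rw [hpot]
    exact hP
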